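/- **Setting.** Let $\Lambda$ be the vertex set of a finite connected graph with graph distance $\mathsf d$, closed balls $B_r(x)$, and $|B_r(x)|\le Mr^d$ for all $x$ and all integers $r\ge 1$. Put a qubit on each vertex. Write $\partial S=\{x\in S:\ x \text{ has a neighbour outside } S\}$, and fix a total order on $\Lambda$. Let $$H=H_0+\sum_{r\ge1}\epsilon^rV_r,\qquad H_0=\sum_{I:\operatorname{diam}I\le k}h_IZ_I,\quad |h_I|\le h,$$ where $Z_I=\prod_{i\in I}Z_i$ are Pauli-$Z$ strings, and each $V_r=\sum_{S:\operatorname{diam}S\le r}V_{r,S}$ is Hermitian with $V_{r,S}$ supported on $S$ and $\sum_{r\ge1}\sup_v\sum_{S\ni v}\|V_{r,S}\|\le h$ (the series for $H$ being convergent). Write $A(t)=e^{iHt}Ae^{-iHt}$. **Paths.** Let $r,n$ be integers and $x\in\Lambda$. A path in $\Gamma^{(n)}(x)$ at scale $r$ is a sequence of sets $\Gamma_1,\dots,\Gamma_l\subseteq\Lambda$ with regions $R_{-1}=\emptyset$, $R_0=\{x\}$, such that $\Gamma_i\cap R_{i-2}=\emptyset$, $\Gamma_i\cap R_{i-1}\ne\emptyset$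 and $\Gamma_i\not\subseteq R_{i-1}$. The step $\Gamma_i$ is *small* if $\Gamma_i\setminus R_{i-1}\subseteq B_r(y)$ for some vertex $y\notin R_{i-1}$ adjacent to $R_{i-1}$; then $x_i$ denotes the least such $y$ and $R_i=R_{i-1}\cup B_r(x_i)$. Otherwise $\Gamma_i$ is *big* and $R_i=R_{i-1}\cup\Gamma_i$. The path stops at the first $i$ such that $\Gamma_i$ contains a vertex at distance at least $nr$ from $x$, or at $i=n+1$, whichever comes first. **Partial non-resonance.** Non-resonance with gap $\Delta$ holds in $B_r(y)$ if for every $S\subseteq B_r(y)$ the Hamiltonian $\sum_{I\subseteq S}h_IZ_I$ on the qubits of $S$ has minimal gap (between eigenvalues counted with multiplicity) at least $\Delta$. Partial non-resonance with parameters $(r,\Delta,n,\zeta)$ holds at $x$ if no path in $\Gamma^{(n)}(x)$ has more than $(1-\zeta)n$ small steps $\Gamma_i$ for which non-resonance with gap $\Delta$ fails in $B_r(x_i)$. **Statement.** Let $d,k\in\mathbb N$, $M\in\mathbb R$, $\xi,a,c>0$, $0<\zeta\le1$ and $0<\alpha<\frac1{5k+1}$. There are constants $C,C'>0$, and for every $c'>c$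 a constant $b>0$, all depending only on these parameters (and $b$ also on $c'$), such that the following holds for all systems as above (of any size) and all $\epsilon>0$ with $b\epsilon\le1$. Let $S_0,S_1\subseteq\Lambda$ be nonempty and disjoint, and put $D=\mathsf d(S_0,S_1)$. For $S\in\{S_0,S_1\}$ say that $\mathrm{NR}(S)$ holds if, for every integer $r_*\ge1$ and every $x\in\partial S$, partial non-resonance with parameters $(r_*,\Delta(r_*),n_*,\zeta)$ holds at $x$, where $n_*=\lfloor (D-1)/(r_*+1)\rfloor$ and $\Delta(r_*)\ge h\,a\exp(-c\,r_*^\xi)$. Define $$\lambda^{-1}=\frac{8(4c')^{1/\xi}}{\zeta},\qquad \mu=\frac{\alpha\zeta}8,\qquad v=(b\epsilon)^{\frac\alpha2\left(\min\left\{\lambda\log^{1/\xi}\left(\frac1{b\epsilon}\right),\ \frac{\zeta D}{8}\right\}-k\right)} .$$ If $\mathrm{NR}(S)$ holds for a set $S\in\{S_0,S_1\}$ with $|\partial S|=\min(|\partial S_0|,|\partial S_1|)$, then for all operators $A_{S_1}$, $B_{S_0}$ supported on $S_1$, $S_0$ and all $t\ge0$, $$\|[B_{S_0},A_{S_1}(t)]\|\le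 C\min(|\partial S_0|,|\partial S_1|)\,\|B_{S_0}\|\,\|A_{S_1}\|\left[\exp(C'h\,v\,t)-1\right]e^{-\mu D}.$$ If $\mathrm{NR}(S_0)$ holds, without any assumption on the sizes of the boundaries, the same bound holds with $|\partial S_0|$ in place of $\min(|\partial S_0|,|\partial S_1|)$. When $D\ge r_*(\epsilon):=\left(\frac1{4c'}\log\frac1{b\epsilon}\right)^{1/\xi}$, the velocity factor is $v=(b\epsilon)^{\frac\alpha2\left(\lambda\log^{1/\xi}(1/(b\epsilon))-k\right)}$. This expression is non-perturbatively small in $\epsilon$: divided by $\epsilon^N$ it tends to $0$ as $\epsilon\to0^+$, for every $N\in\mathbb N$. -/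

import Mathlib

open scoped Matrix.Norms.L2Operator

noncomputable section

namespace SlowLR

/-! ### Finite graphs -/

section Graph

variable {Λ : Type} [Fintype Λ]

/-- The closed ball of radius `r` in the graph distance. -/
def ball (G : SimpleGraph Λ) (x : Λ) (r : ℕ) : Finset Λ :=
  Finset.univ.filter fun y => G.dist x y ≤ r

/-- `|B_r(x)| ≤ M r ^ d` for all `x` and all `r ≥ 1`. -/
def IsDimensional (G : SimpleGraph Λ) (d : ℕ) (M : ℝ) : Prop :=
  ∀ (x : Λ) (r : ℕ), 1 ≤ r → ((ball G x r).card : ℝ) ≤ M * (r : ℝ) ^ d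

/-- `diam S ≤ r` in the graph distance of `Λ`. -/
def DiamLE (G : SimpleGraph Λ) (S : Finset Λ) (r : ℕ) : Prop :=
  ∀ x ∈ S, ∀ y ∈ S, G.dist x y ≤ r

/-- The distance `min_{x ∈ S, y ∈ T} d(x, y)` of two nonempty sets. -/
def setDist (G : SimpleGraph Λ) (S T : Finset Λ) : ℕ :=
  sInf {n : ℕ | ∃ x ∈ S, ∃ y ∈ T, G.dist x y = n}

open Classical in
/-- `∂S`: the vertices of `S` that have a neighbour outside `S`. -/
def boundary (G : SimpleGraph Λ) (S : Finset Λ) : Finset Λ :=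
  S.filter fun x => ∃ y, y ∉ S ∧ G.Adj x y

end Graph

/-! ### Qubit operators -/

section Operators

variable {Λ : Type} [Fintype Λ] [DecidableEq Λ]

/-- Operators on `(ℂ²)^{⊗ Λ}` as matrices in the computational basis `Λ → Fin 2`, with the
operator norm (largest singular value). -/
abbrev Op (Λ : Type) : Type := Matrix (Λ → Fin 2) (Λ → Fin 2) ℂ

/-- `X = Y ⊗ 1` for an operator `Y` on the qubits in `S`. -/
def SupportedOn (X : Op Λ) (S : Finset Λ) : Prop :=
  ∃ Y : Matrix (S → Fin 2) (S → Fin 2) ℂ, ∀ σ τ : Λ → Fin 2,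
    X σ τ = if ∀ i, i ∉ S → σ i = τ i then Y (fun i => σ i) (fun i => τ i) else 0

/-- The eigenvalue of the Pauli matrix `Z` on a computational basis state. -/
def zSign (s : Fin 2) : ℝ := if s = 0 then 1 else -1

/-- The Pauli string `Z_I = ∏_{i ∈ I} Z_i`. -/
def pauliZ (I : Finset Λ) : Op Λ :=
  Matrix.diagonal fun σ => ((∏ i ∈ I, zSign (σ i) : ℝ) : ℂ)

/-- The restriction `∑_{I ⊆ S} J_I Z_I` of the classical Hamiltonian `∑_I J_I Z_I`. -/
def classicalHam (J : Finset Λ → ℝ) (S : Finset Λ) : Op Λ :=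
  ∑ I ∈ S.powerset, (J I : ℂ) • pauliZ I

/-- The eigenvalue of `∑_{I ⊆ S} J_I Z_I` on the basis state `σ`. -/
def energy (J : Finset Λ → ℝ) (S : Finset Λ) (σ : Λ → Fin 2) : ℝ :=
  ∑ I ∈ S.powerset, J I * ∏ i ∈ I, zSign (σ i)

set_option linter.unusedSectionVars false in
theorem classicalHam_eq_diagonal (J : Finset Λ → ℝ) (S : Finset Λ) :
    classicalHam J S = Matrix.diagonal fun σ => ((energy J S σ : ℝ) : ℂ) := by
  ext σ τ
  simp only [classicalHam, energy, pauliZ, Matrix.sum_apply, Matrix.smul_apply,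
    Matrix.diagonal_apply, smul_eq_mul]
  by_cases h : σ = τ <;> simp [h]

/-- The minimal gap of `∑_{I ⊆ S} J_I Z_I`, as an operator on the qubits in `S` and with
eigenvalues counted with multiplicity, is at least `g`. -/
def GapGE (J : Finset Λ → ℝ) (S : Finset Λ) (g : ℝ) : Prop :=
  ∀ σ τ : Λ → Fin 2, (∃ i ∈ S, σ i ≠ τ i) → g ≤ |energy J S σ - energy J S τ|

/-- Heisenberg evolution `A(t) = e^{iHt} A e^{-iHt}`. -/
def heisenberg (H : Op Λ) (t : ℝ) (A : Op Λ) : Op Λ :=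
  NormedSpace.exp (((t : ℂ) * Complex.I) • H) * A *
    NormedSpace.exp ((-((t : ℂ) * Complex.I)) • H)

/-- `J` are the coefficients of a `k`-local sum of Pauli-`Z` strings of local strength `h`. -/
def IsClassicalLocal (G : SimpleGraph Λ) (k : ℕ) (h : ℝ) (J : Finset Λ → ℝ) : Prop :=
  ∀ I, |J I| ≤ h ∧ (J I ≠ 0 → DiamLE G I k)

/-- `V r S` (`r ≥ 1`) is the term supported on `S` of a Hermitian operator
`V_r = ∑_S V r S` of range at most `r`, with
`∑_{r ≥ 1} ‖V_r‖ ≤ h` for the local norm `‖V_r‖ = sup_v ∑_{S ∋ v} ‖V r S‖`. -/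
def IsLocalPerturbation (G : SimpleGraph Λ) (h : ℝ) (V : ℕ → Finset Λ → Op Λ) : Prop :=
  (∀ r, 1 ≤ r → (∑ S, V r S).IsHermitian) ∧
  (∀ r, 1 ≤ r → ∀ S, SupportedOn (V r S) S) ∧
  (∀ r, 1 ≤ r → ∀ S, V r S ≠ 0 → DiamLE G S r) ∧
  ∃ w : ℕ → ℝ,
    (∀ r, 1 ≤ r → ∀ v, ∑ S ∈ Finset.univ.filter (fun S => v ∈ S), ‖V r S‖ ≤ w r) ∧
    Summable (fun r => w (r + 1)) ∧ ∑' r, w (r + 1) ≤ h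

end Operators

/-! ### Paths and partial non-resonance -/

section Paths

variable {Λ : Type} [Fintype Λ] [LinearOrder Λ]

/-- The `(r, g)` non-resonance condition at `x`, where `g` is the required minimal gap. -/
def NonResonantAt (G : SimpleGraph Λ) (J : Finset Λ → ℝ) (r : ℕ) (g : ℝ) (x : Λ) : Prop :=
  ∀ S ⊆ ball G x r, GapGE J S g

/-- The vertices `x ∈ ∂(Rᶜ)` such that `B_r(x)` contains the part of `Γ` outside `R`. -/
def centers (G : SimpleGraph Λ) (r : ℕ) (R Γ : Finset Λ) : Finset Λ :=
  (boundary G Rᶜ).filter fun x => Γ \ R ⊆ ball G x r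

/-- A step `Γ` out of the region `R` is small if a ball of radius `r` around a vertex just
outside `R` contains the part of `Γ` outside `R`, and big otherwise. -/
def IsSmall (G : SimpleGraph Λ) (r : ℕ) (R Γ : Finset Λ) : Prop :=
  (centers G r R Γ).Nonempty

open Classical in
/-- The enlargement of the region `R` by a step `Γ`: by the ball around the least possible
center if `Γ` is small, and by `Γ` itself if `Γ` is big. -/
def absorb (G : SimpleGraph Λ) (r : ℕ) (R Γ : Finset Λ) : Finset Λ :=
  if hs : IsSmall G r R Γ then R ∪ ball G ((centers G r R Γ).min' hs) r else R ∪ Γ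

/-- The regions `S_int^(i)` of a path with steps `Γ 0, Γ 1, …` starting at `S₀`. -/
def region (G : SimpleGraph Λ) (r : ℕ) (S₀ : Finset Λ) (Γ : ℕ → Finset Λ) : ℕ → Finset Λ
  | 0 => S₀
  | i + 1 => absorb G r (region G r S₀ Γ i) (Γ i)

/-- The region before the last one: `S_int^(i-1)`, which is empty for `i = 0`. -/
def prevRegion (G : SimpleGraph Λ) (r : ℕ) (S₀ : Finset Λ) (Γ : ℕ → Finset Λ) : ℕ → Finset Λ
  | 0 => ∅
  | i + 1 => region G r S₀ Γ i

/-- `min_{y ∈ S₀} max_{x ∈ X} d(x, y) ≥ n r`. -/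
def Reaches (G : SimpleGraph Λ) (r n : ℕ) (S₀ X : Finset Λ) : Prop :=
  ∀ y ∈ S₀, ∃ x ∈ X, n * r ≤ G.dist x y

/-- The sets `Γ 0, …, Γ (l - 1)` form a path of the class `Γ^(n)(S₀)` at scale `r`: each step
avoids the region before the last one, meets the current region and leaves it, and the path
stops at the first step that reaches distance `n r`, or after `n + 1` steps. -/
def IsPath (G : SimpleGraph Λ) (r n : ℕ) (S₀ : Finset Λ) (l : ℕ) (Γ : ℕ → Finset Λ) : Prop :=
  1 ≤ l ∧ l ≤ n + 1 ∧
  (∀ i < l, Disjoint (Γ i) (prevRegion G r S₀ Γ i) ∧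
    (Γ i ∩ region G r S₀ Γ i).Nonempty ∧ (Γ i \ region G r S₀ Γ i).Nonempty) ∧
  (∀ i, i + 1 < l → ¬ Reaches G r n S₀ (Γ i)) ∧
  (l = n + 1 ∨ Reaches G r n S₀ (Γ (l - 1)))

/-- Step `i` of the path is small and non-resonance fails in the ball chosen for it. -/
def BadStep (G : SimpleGraph Λ) (J : Finset Λ → ℝ) (r : ℕ) (g : ℝ) (S₀ : Finset Λ)
    (Γ : ℕ → Finset Λ) (i : ℕ) : Prop :=
  ∃ hs : IsSmall G r (region G r S₀ Γ i) (Γ i),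
    ¬ NonResonantAt G J r g ((centers G r (region G r S₀ Γ i) (Γ i)).min' hs)

/-- The partial non-resonance condition at `x`, at scale `r`, with minimal gap `g`, path
parameter `n` and fraction `ζ`: no path starting at `x` has more than `(1 - ζ) n` bad steps. -/
def PartialNonResonantAt (G : SimpleGraph Λ) (J : Finset Λ → ℝ) (r : ℕ) (g : ℝ) (n : ℕ)
    (ζ : ℝ) (x : Λ) : Prop :=
  ∀ (l : ℕ) (Γ : ℕ → Finset Λ), IsPath G r n {x} l Γ →
    ¬ ∃ T ⊆ Finset.range l, (1 - ζ) * (n : ℝ) < (T.card : ℝ) ∧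
      ∀ i ∈ T, BadStep G J r g {x} Γ i

/-- Partial non-resonance at every vertex of `∂S` and at every scale `r ≥ 1`, with minimal gap
`Δ r` and path parameter `⌊(D - 1) / (r + 1)⌋`. -/
def PartialNonResonantOnBoundary (G : SimpleGraph Λ) (J : Finset Λ → ℝ) (Δ : ℕ → ℝ) (D : ℕ)
    (ζ : ℝ) (S : Finset Λ) : Prop :=
  ∀ r : ℕ, 1 ≤ r → ∀ x ∈ boundary G S,
    PartialNonResonantAt G J r (Δ r) ((D - 1) / (r + 1)) ζ x

end Paths

/-! ### Constants of the bound -/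

/-- `λ`, given by `λ⁻¹ = 8 (4 c')^{1/ξ} / ζ`. -/
def lam (ξ ζ c' : ℝ) : ℝ := (8 * (4 * c') ^ (1 / ξ) / ζ)⁻¹

/-- `λ log^{1/ξ}(1/(b ε))`; this is `ζ r / 8` at the scale
`r = (log (1/(b ε)) / (4 c'))^{1/ξ}`. -/
def scaleExponent (ξ ζ c' b ε : ℝ) : ℝ :=
  lam ξ ζ c' * Real.log ((b * ε)⁻¹) ^ (1 / ξ)

/-- `(b ε) ^ ((α / 2) (E - k))`, the factor multiplying `C' h` in the Lieb–Robinson velocity. -/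
def velocity (α : ℝ) (k : ℕ) (b ε E : ℝ) : ℝ :=
  (b * ε) ^ (α / 2 * (E - (k : ℝ)))

end SlowLR

end

/-! Removing from the Hamiltonian all terms that touch a region R and comparing evolutions by
Duhamel's formula shows that an operator inside a larger region R' feels the evolution of A only
through terms that cross the boundary of R' (`LocalSeries.norm_lie_heisenberg_le_sum`). Iterating
with growing regions expands the commutator over self-avoiding paths of such terms. With the trivial
bound at every step this gives a Lieb–Robinson bound with velocity of order h
(`LocalSeries.norm_lie_heisenberg_le_of_weight`). Every step costs a time integral, a factor of
order h/ν when growth e^{νt} is allowed, so a small velocity ν needs steps that pay it back.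

The gain comes from non-resonant balls. There the classical Hamiltonian has a gap g, and
perturbation theory turns the local Hamiltonian into a sum A + B, where A lives near the centre, B
lives away from it, and [B, A] vanishes up to order m (`LocalSeries.exists_conserved`).
Order-by-order conservation rests on a purely formal fact: the obstruction to solving order j has no
diagonal part (`map_coeff_commutator_eq_zero`, `sum_lie_dress_eq_zero`). Division by energy
differences costs only a constant over g, without a factor of the Hilbert space dimension, because
the eigenvalues are g-separated (`norm_solve_le`). Since A almost commutes with the rest, a
perturbation outside the ball reaches the centre only with amplitude about (ε/g)^{m+1} times powers
of the volume and 1 + (hτ)², where m is about r/(2k+3)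
(`LocalSeries.norm_lie_heisenberg_le_of_gap`). For r up to r_*(ε) the stretched-exponential gap
costs at most (bε)^{-1/4}, so a good step earns q^r with q = e^{-L} (bε)^γ and γ = `decayExp k`
(`exists_coupling`).

The count is made in `LocalSeries.norm_lie_heisenberg_le_path`. Partial non-resonance allows at most
(1-ζ)n small steps in resonant balls, so about ζn units of distance are crossed with a small factor.
Terms of large diameter cross several units at once, but their own smallness in ε pays for them. The
hypothesis α < 1/(5k+1) leaves enough room for the good steps to outweigh all factors h/ν when ν =
C'hv.

Three regimes are distinguished in `exists_bound_localSeries`: v ≥ 1, where the ordinary bound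
suffices; S₀ and S₁ so close that one non-resonant ball of radius D - 1 separates them; and many
balls between them. The given perturbation is reduced to Hermitian local terms up to a multiple of
the identity, and the roles of S₀ and S₁ are exchanged by reversing time. -/

noncomputable section

namespace SlowLR

open scoped Matrix

/-! ### Algebras of operators with given support -/

section Support

set_option linter.unusedSectionVars false

variable {Λ : Type} [Fintype Λ] [DecidableEq Λ]

/-- The configuration `σ` with the spin at `i` flipped. -/
def flip (i : Λ) (σ : Λ → Fin 2) : Λ → Fin 2 := Function.update σ i (1 - σ i)

theorem flip_flip (i : Λ) (σ : Λ → Fin 2) : flip i (flip i σ) = σ := by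
  simp [flip]

theorem flip_self_apply (i : Λ) (σ : Λ → Fin 2) : flip i σ i = 1 - σ i := by
  simp [flip]

theorem flip_apply_of_ne {i j : Λ} (h : j ≠ i) (σ : Λ → Fin 2) : flip i σ j = σ j := by
  simp [flip, h]

/-- Spin flip at `i` as a permutation of configurations. -/
def flipEquiv (i : Λ) : (Λ → Fin 2) ≃ (Λ → Fin 2) :=
  ⟨flip i, flip i, flip_flip i, flip_flip i⟩

/-- The Pauli matrix `X_i`. -/
def pauliX (i : Λ) : Op Λ := fun σ τ => if τ = flip i σ then 1 else 0

theorem pauliX_mul_apply (i : Λ) (M : Op Λ) (σ τ : Λ → Fin 2) :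
    (pauliX i * M) σ τ = M (flip i σ) τ := by
  simp [Matrix.mul_apply, pauliX]

theorem mul_pauliX_apply (i : Λ) (M : Op Λ) (σ τ : Λ → Fin 2) :
    (M * pauliX i) σ τ = M σ (flip i τ) := by
  have : ∀ ρ, (τ = flip i ρ) = (ρ = flip i τ) := fun ρ => by
    refine propext ⟨fun h => ?_, fun h => ?_⟩ <;> rw [h, flip_flip]
  simp [Matrix.mul_apply, pauliX, this]

/-- The algebra of operators supported on `S`: those commuting with all Pauli matrices at the
vertices outside `S`. -/
def supp (S : Finset Λ) : Subalgebra ℂ (Op Λ) :=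
  Subalgebra.centralizer ℂ {P | ∃ i, i ∉ S ∧ (P = pauliZ {i} ∨ P = pauliX i)}

theorem mem_supp_iff_commute {S : Finset Λ} {M : Op Λ} :
    M ∈ supp S ↔ ∀ i, i ∉ S → Commute (pauliZ {i}) M ∧ Commute (pauliX i) M := by
  simp only [supp, Subalgebra.mem_centralizer_iff, Set.mem_ofPred_eq]
  constructor
  · intro h i hi
    exact ⟨h _ ⟨i, hi, Or.inl rfl⟩, h _ ⟨i, hi, Or.inr rfl⟩⟩
  · rintro h _ ⟨i, hi, rfl | rfl⟩
    exacts [(h i hi).1, (h i hi).2]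

theorem zSign_injective : Function.Injective zSign := by
  intro a b h
  fin_cases a <;> fin_cases b <;> simp [zSign] at h ⊢ <;> norm_num at h

theorem commute_pauliZ_iff {i : Λ} {M : Op Λ} :
    Commute (pauliZ {i}) M ↔ ∀ σ τ, σ i ≠ τ i → M σ τ = 0 := by
  rw [Commute, SemiconjBy, ← Matrix.ext_iff]
  simp only [pauliZ, Finset.prod_singleton, Matrix.diagonal_mul, Matrix.mul_diagonal]
  refine forall_congr' fun σ => forall_congr' fun τ => ?_
  constructor
  · intro h hne
    have h2 : ((zSign (σ i) : ℂ) - (zSign (τ i) : ℂ)) * M σ τ = 0 := by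
      rw [sub_mul, h]; ring
    rcases mul_eq_zero.1 h2 with h3 | h3
    · exact absurd (zSign_injective (by exact_mod_cast sub_eq_zero.1 h3)) hne
    · exact h3
  · intro h
    by_cases hne : σ i = τ i
    · rw [hne, mul_comm]
    · rw [h hne]; simp

theorem commute_pauliX_iff {i : Λ} {M : Op Λ} :
    Commute (pauliX i) M ↔ ∀ σ τ, M (flip i σ) (flip i τ) = M σ τ := by
  rw [Commute, SemiconjBy, ← Matrix.ext_iff]
  simp only [pauliX_mul_apply, mul_pauliX_apply]
  constructor
  · intro h σ τ
    rw [h, flip_flip]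
  · intro h σ τ
    rw [← h σ, flip_flip]

theorem mem_supp_iff {S : Finset Λ} {M : Op Λ} :
    M ∈ supp S ↔ ∀ i, i ∉ S → (∀ σ τ, σ i ≠ τ i → M σ τ = 0) ∧
      ∀ σ τ, M (flip i σ) (flip i τ) = M σ τ := by
  simp only [mem_supp_iff_commute, commute_pauliZ_iff, commute_pauliX_iff]

theorem SupportedOn.mem_supp {S : Finset Λ} {M : Op Λ} (h : SupportedOn M S) : M ∈ supp S := by
  obtain ⟨Y, hY⟩ := h
  rw [mem_supp_iff]
  intro i hi
  refine ⟨fun σ τ hne => ?_, fun σ τ => ?_⟩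
  · rw [hY, if_neg]
    exact fun h => hne (h i hi)
  · have h1 : ∀ (σ : Λ → Fin 2) (j : S), flip i σ j = σ j := fun σ j =>
      flip_apply_of_ne (fun e : (j : Λ) = i => hi (e ▸ j.2)) σ
    rw [hY, hY]
    simp only [h1]
    congr 1
    refine propext (forall_congr' fun j => forall_congr' fun _ => ?_)
    by_cases hj : j = i
    · subst hj
      simp [flip_self_apply]
    · rw [flip_apply_of_ne hj, flip_apply_of_ne hj]

theorem supp_mono {S T : Finset Λ} (h : S ⊆ T) : supp S ≤ supp T := by
  intro M hM
  rw [mem_supp_iff] at hM ⊢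
  exact fun i hi => hM i fun h' => hi (h h')

theorem apply_eq_zero_of_mem_supp {S : Finset Λ} {M : Op Λ} (hM : M ∈ supp S) {σ τ : Λ → Fin 2}
    {i : Λ} (hi : i ∉ S) (h : σ i ≠ τ i) : M σ τ = 0 :=
  ((mem_supp_iff.1 hM) i hi).1 σ τ h

/-- Induction on `U`: at each new vertex the two configurations carry the same spin, so either `η`
already agrees with it or both arguments are flipped there, and the simultaneous flip is commutation
with the Pauli X. -/
theorem apply_piecewise_of_mem_supp {S : Finset Λ} {M : Op Λ} (hM : M ∈ supp S)
    {σ τ : Λ → Fin 2} (h : ∀ i, i ∉ S → σ i = τ i) (η : Λ → Fin 2) (U : Finset Λ)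
    (hU : Disjoint U S) : M (U.piecewise η σ) (U.piecewise η τ) = M σ τ := by
  induction U using Finset.induction_on with
  | empty => simp
  | insert i U hiU ih =>
    rw [Finset.disjoint_insert_left] at hU
    rw [← ih hU.2, Finset.piecewise_insert, Finset.piecewise_insert]
    have h1 : U.piecewise η σ i = σ i := Finset.piecewise_eq_of_notMem _ _ _ hiU
    have h2 : U.piecewise η τ i = σ i := by
      rw [Finset.piecewise_eq_of_notMem _ _ _ hiU, h i hU.1]
    by_cases he : η i = σ i
    · congr 1
      · rw [he, ← h1, Function.update_eq_self]
      · rw [he, ← h2, Function.update_eq_self]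
    · have he' : η i = 1 - σ i := by
        generalize η i = a at he ⊢
        generalize σ i = b at he ⊢
        fin_cases a <;> fin_cases b <;> simp_all
      rw [← ((mem_supp_iff.1 hM) i hU.1).2 (U.piecewise η σ)]
      simp only [flip, h1, h2, he']

/-- In either product only one intermediate configuration contributes: it takes the spins of τ on
the support of the left factor and those of σ elsewhere. The matrix elements of each factor then
agree in the two products, because spins outside its support may be changed in both arguments. If σ
and τ differ outside both supports, everything vanishes. -/
theorem commute_of_mem_supp {S T : Finset Λ} (hST : Disjoint S T) {M N : Op Λ}
    (hM : M ∈ supp S) (hN : N ∈ supp T) : Commute M N := by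
  change M * N = N * M
  ext σ τ
  by_cases hag : ∀ i, i ∉ S → i ∉ T → σ i = τ i
  · rw [Matrix.mul_apply, Matrix.mul_apply,
      Finset.sum_eq_single (S.piecewise τ σ), Finset.sum_eq_single (T.piecewise τ σ), mul_comm]
    · have e1 : T.piecewise τ σ = Sᶜ.piecewise τ σ := by
        ext1 i
        by_cases hS : i ∈ S
        · have hT : i ∉ T := Finset.disjoint_left.1 hST hS
          simp [Finset.piecewise, hS, hT]
        · by_cases hT : i ∈ T
          · simp [Finset.piecewise, hS, hT]
          · simp [Finset.piecewise, hS, hT, hag i hS hT]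
      have e2 : S.piecewise τ σ = Tᶜ.piecewise τ σ := by
        ext1 i
        by_cases hT : i ∈ T
        · have hS : i ∉ S := Finset.disjoint_right.1 hST hT
          simp [Finset.piecewise, hS, hT]
        · by_cases hS : i ∈ S
          · simp [Finset.piecewise, hS, hT]
          · simp [Finset.piecewise, hS, hT, hag i hS hT]
      congr 1
      · rw [← apply_piecewise_of_mem_supp hN (σ := σ) (τ := T.piecewise τ σ) (η := τ) (U := Tᶜ),
          ← e2]
        · congr 1
          ext1 i
          by_cases hT : i ∈ T <;> simp [Finset.piecewise, hT]
        · intro i hi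
          simp [hi]
        · exact disjoint_compl_left
      · rw [← apply_piecewise_of_mem_supp hM (σ := σ) (τ := S.piecewise τ σ) (η := τ) (U := Sᶜ),
          ← e1]
        · congr 1
          ext1 i
          by_cases hS : i ∈ S <;> simp [Finset.piecewise, hS]
        · intro i hi
          simp [hi]
        · exact disjoint_compl_left
    · intro ρ _ hρ
      obtain ⟨i, hi⟩ := Function.ne_iff.1 hρ
      by_cases hT : i ∈ T
      · have hS : i ∉ S := Finset.disjoint_right.1 hST hT
        rw [apply_eq_zero_of_mem_supp hM hS, mul_zero]
        simpa [Finset.piecewise, hT] using hi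
      · rw [apply_eq_zero_of_mem_supp hN hT, zero_mul]
        simpa [Finset.piecewise, hT, eq_comm] using hi
    · simp
    · intro ρ _ hρ
      obtain ⟨i, hi⟩ := Function.ne_iff.1 hρ
      by_cases hS : i ∈ S
      · have hT : i ∉ T := Finset.disjoint_left.1 hST hS
        rw [apply_eq_zero_of_mem_supp hN hT, mul_zero]
        simpa [Finset.piecewise, hS] using hi
      · rw [apply_eq_zero_of_mem_supp hM hS, zero_mul]
        simpa [Finset.piecewise, hS, eq_comm] using hi
    · simp
  · push Not at hag
    obtain ⟨i, hS, hT, hne⟩ := hag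
    rw [Matrix.mul_apply, Matrix.mul_apply, Finset.sum_eq_zero, Finset.sum_eq_zero]
    · intro ρ _
      by_cases h : σ i = ρ i
      · rw [apply_eq_zero_of_mem_supp hM hS (by rwa [← h]), mul_zero]
      · rw [apply_eq_zero_of_mem_supp hN hT h, zero_mul]
    · intro ρ _
      by_cases h : σ i = ρ i
      · rw [apply_eq_zero_of_mem_supp hN hT (by rwa [← h]), mul_zero]
      · rw [apply_eq_zero_of_mem_supp hM hS h, zero_mul]

theorem isClosed_supp (S : Finset Λ) : IsClosed (supp S : Set (Op Λ)) := by
  rw [supp, Subalgebra.coe_centralizer]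
  exact Set.isClosed_centralizer _

theorem exp_mem_supp {S : Finset Λ} {M : Op Λ} (hM : M ∈ supp S) :
    NormedSpace.exp M ∈ supp S := by
  rw [mem_supp_iff_commute] at hM ⊢
  exact fun i hi => ⟨(hM i hi).1.symm.exp_left.symm, (hM i hi).2.symm.exp_left.symm⟩

theorem lie_mem_supp {S : Finset Λ} {M N : Op Λ} (hM : M ∈ supp S) (hN : N ∈ supp S) :
    ⁅M, N⁆ ∈ supp S := by
  rw [Ring.lie_def]
  exact sub_mem (mul_mem hM hN) (mul_mem hN hM)

theorem lie_eq_zero_of_mem_supp {S T : Finset Λ} (hST : Disjoint S T) {M N : Op Λ}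
    (hM : M ∈ supp S) (hN : N ∈ supp T) : ⁅M, N⁆ = 0 := by
  rw [Ring.lie_def, (commute_of_mem_supp hST hM hN).eq, sub_self]

theorem pauliZ_mem_supp (I : Finset Λ) : pauliZ I ∈ supp I := by
  rw [mem_supp_iff]
  intro i hi
  refine ⟨fun σ τ h => ?_, fun σ τ => ?_⟩
  · rw [pauliZ, Matrix.diagonal_apply_ne]
    rintro rfl
    exact h rfl
  · have : ∀ σ : Λ → Fin 2, ∏ j ∈ I, zSign (flip i σ j) = ∏ j ∈ I, zSign (σ j) := fun σ =>
      Finset.prod_congr rfl fun j hj => by rw [flip_apply_of_ne (fun e : j = i => hi (e ▸ hj))]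
    have hinj : flip i σ = flip i τ ↔ σ = τ := (flipEquiv i).injective.eq_iff
    simp only [pauliZ, Matrix.diagonal_apply, this, hinj]

theorem norm_lie_le (X Y : Op Λ) : ‖⁅X, Y⁆‖ ≤ 2 * ‖X‖ * ‖Y‖ := by
  rw [Ring.lie_def]
  calc ‖X * Y - Y * X‖ ≤ ‖X * Y‖ + ‖Y * X‖ := norm_sub_le _ _
    _ ≤ ‖X‖ * ‖Y‖ + ‖Y‖ * ‖X‖ := add_le_add (norm_mul_le _ _) (norm_mul_le _ _)
    _ = _ := by ring

end Support

/-! ### Heisenberg evolution -/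

section Heisenberg

set_option linter.unusedSectionVars false

variable {Λ : Type} [Fintype Λ] [DecidableEq Λ]

theorem exp_mem_unitary {H : Op Λ} (hH : H.IsHermitian) (t : ℝ) :
    NormedSpace.exp (((t : ℂ) * Complex.I) • H) ∈ unitary (Op Λ) := by
  let : NormedAlgebra ℚ (Op Λ) := NormedAlgebra.restrictScalars ℚ ℂ (Op Λ)
  refine NormedSpace.exp_mem_unitary_of_mem_skewAdjoint ?_
  rw [skewAdjoint.mem_iff, star_smul, show star H = H from hH]
  simp

theorem exp_mul_exp_neg (H : Op Λ) (t : ℝ) :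
    NormedSpace.exp (((t : ℂ) * Complex.I) • H) *
      NormedSpace.exp ((-((t : ℂ) * Complex.I)) • H) = 1 := by
  let : NormedAlgebra ℚ (Op Λ) := NormedAlgebra.restrictScalars ℚ ℂ (Op Λ)
  rw [← NormedSpace.exp_add_of_commute, neg_smul, add_neg_cancel, NormedSpace.exp_zero]
  exact ((Commute.refl H).smul_left _).smul_right _

theorem exp_neg_mul_exp (H : Op Λ) (t : ℝ) :
    NormedSpace.exp ((-((t : ℂ) * Complex.I)) • H) *
      NormedSpace.exp (((t : ℂ) * Complex.I) • H) = 1 := by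
  let : NormedAlgebra ℚ (Op Λ) := NormedAlgebra.restrictScalars ℚ ℂ (Op Λ)
  rw [← NormedSpace.exp_add_of_commute, neg_smul, neg_add_cancel, NormedSpace.exp_zero]
  exact ((Commute.refl H).smul_left _).smul_right _

theorem norm_heisenberg {H : Op Λ} (hH : H.IsHermitian) (t : ℝ) (A : Op Λ) :
    ‖heisenberg H t A‖ = ‖A‖ := by
  have h2 := exp_mem_unitary hH (-t)
  rw [Complex.ofReal_neg, neg_mul] at h2
  rw [heisenberg, CStarRing.norm_mul_mem_unitary _ h2,
    CStarRing.norm_mem_unitary_mul _ (exp_mem_unitary hH t)]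

theorem heisenberg_zero (H A : Op Λ) : heisenberg H 0 A = A := by
  simp [heisenberg]

theorem heisenberg_mul (H : Op Λ) (t : ℝ) (A B : Op Λ) :
    heisenberg H t (A * B) = heisenberg H t A * heisenberg H t B := by
  simp only [heisenberg]
  have h := exp_neg_mul_exp H t
  generalize NormedSpace.exp (((t : ℂ) * Complex.I) • H) = U at h ⊢
  generalize NormedSpace.exp ((-((t : ℂ) * Complex.I)) • H) = W at h ⊢
  calc U * (A * B) * W = U * A * 1 * B * W := by noncomm_ring
    _ = _ := by rw [← h]; noncomm_ring

theorem heisenberg_sub (H : Op Λ) (t : ℝ) (A B : Op Λ) :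
    heisenberg H t (A - B) = heisenberg H t A - heisenberg H t B := by
  simp only [heisenberg]; noncomm_ring

theorem heisenberg_smul (H : Op Λ) (t : ℝ) (c : ℂ) (A : Op Λ) :
    heisenberg H t (c • A) = c • heisenberg H t A := by
  simp [heisenberg]

theorem heisenberg_lie (H : Op Λ) (t : ℝ) (A B : Op Λ) :
    heisenberg H t ⁅A, B⁆ = ⁅heisenberg H t A, heisenberg H t B⁆ := by
  simp only [Ring.lie_def, heisenberg_sub, heisenberg_mul]

theorem heisenberg_of_commute {H A : Op Λ} (h : Commute H A) (t : ℝ) :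
    heisenberg H t A = A := by
  have h1 : Commute (NormedSpace.exp (((t : ℂ) * Complex.I) • H)) A :=
    (h.smul_left _).exp_left
  rw [heisenberg, h1.eq, mul_assoc, exp_mul_exp_neg, mul_one]

theorem heisenberg_self (H : Op Λ) (t : ℝ) : heisenberg H t H = H :=
  heisenberg_of_commute (Commute.refl H) t

theorem heisenberg_neg (H A : Op Λ) (t : ℝ) : heisenberg (-H) t A = heisenberg H (-t) A := by
  simp [heisenberg]

theorem heisenberg_neg_heisenberg (H A : Op Λ) (t : ℝ) :
    heisenberg H (-t) (heisenberg H t A) = A := by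
  simp only [heisenberg, Complex.ofReal_neg, neg_mul, neg_neg]
  have h := exp_neg_mul_exp H t
  generalize NormedSpace.exp (((t : ℂ) * Complex.I) • H) = U at h ⊢
  generalize NormedSpace.exp ((-((t : ℂ) * Complex.I)) • H) = W at h ⊢
  calc W * (U * A * W) * U = (W * U) * A * (W * U) := by noncomm_ring
    _ = A := by rw [h]; simp

theorem heisenberg_heisenberg_neg (H A : Op Λ) (t : ℝ) :
    heisenberg H t (heisenberg H (-t) A) = A := by
  simpa using heisenberg_neg_heisenberg H A (-t)

theorem heisenberg_add_smul_one (H A : Op Λ) (c : ℂ) (t : ℝ) :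
    heisenberg (H + c • 1) t A = heisenberg H t A := by
  let : NormedAlgebra ℚ (Op Λ) := NormedAlgebra.restrictScalars ℚ ℂ (Op Λ)
  have key : ∀ a : ℂ, NormedSpace.exp (a • (H + c • (1 : Op Λ))) =
      NormedSpace.exp (a • H) * NormedSpace.exp ((a * c) • (1 : Op Λ)) := fun a => by
    rw [smul_add, smul_smul, NormedSpace.exp_add_of_commute]
    exact ((Commute.one_right _).smul_right _)
  have hc : ∀ a : ℂ, ∀ X : Op Λ, Commute (NormedSpace.exp (a • (1 : Op Λ))) X := fun a X =>
    ((Commute.one_left X).smul_left a).exp_left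
  have h1 : NormedSpace.exp (((t : ℂ) * Complex.I * c) • (1 : Op Λ)) *
      NormedSpace.exp ((-((t : ℂ) * Complex.I) * c) • (1 : Op Λ)) = 1 := by
    rw [← NormedSpace.exp_add_of_commute, ← add_smul]
    · simp
    · exact ((Commute.refl _).smul_left _).smul_right _
  rw [heisenberg, heisenberg, key, key]
  have h2 := hc ((t : ℂ) * Complex.I * c)
  generalize NormedSpace.exp (((t : ℂ) * Complex.I) • H) = U
  generalize NormedSpace.exp ((-((t : ℂ) * Complex.I)) • H) = W
  generalize NormedSpace.exp (((t : ℂ) * Complex.I * c) • (1 : Op Λ)) = P at h1 h2 ⊢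
  generalize NormedSpace.exp ((-((t : ℂ) * Complex.I) * c) • (1 : Op Λ)) = Q at h1 ⊢
  calc U * P * A * (W * Q) = U * (P * (A * W)) * Q := by noncomm_ring
    _ = U * A * W * (P * Q) := by rw [(h2 (A * W)).eq]; noncomm_ring
    _ = _ := by rw [h1, mul_one]

theorem heisenberg_mem_supp {S : Finset Λ} {H A : Op Λ} (hH : H ∈ supp S) (hA : A ∈ supp S)
    (t : ℝ) : heisenberg H t A ∈ supp S :=
  mul_mem (mul_mem (exp_mem_supp (Subalgebra.smul_mem _ hH _)) hA)
    (exp_mem_supp (Subalgebra.smul_mem _ hH _))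

theorem hasDerivAt_exp_mul_I (H : Op Λ) (c : ℂ) (t : ℝ) :
    HasDerivAt (fun u : ℝ => NormedSpace.exp (((u : ℂ) * c) • H))
      (c • (NormedSpace.exp (((t : ℂ) * c) • H) * H)) t := by
  have h := (hasDerivAt_exp_smul_const (𝕂 := ℝ) (c • H) t)
  have e : ∀ u : ℝ, u • c • H = ((u : ℂ) * c) • H := fun u => by
    rw [mul_smul, Complex.coe_smul]
  simp only [e, mul_smul_comm] at h
  exact h

theorem hasDerivAt_heisenberg_comp (H : Op Λ) {g : ℝ → ℝ} {g' : ℝ} {f : ℝ → Op Λ} {f' : Op Λ}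
    {s : ℝ} (hg : HasDerivAt g g' s) (hf : HasDerivAt f f' s) :
    HasDerivAt (fun s => heisenberg H (g s) (f s))
      (heisenberg H (g s) ((((g' : ℂ) * Complex.I) • ⁅H, f s⁆) + f')) s := by
  have h1 := (hasDerivAt_exp_mul_I H Complex.I (g s)).scomp s hg
  have h2 := (hasDerivAt_exp_mul_I H (-Complex.I) (g s)).scomp s hg
  have h3 := (h1.mul hf).mul h2
  have e : ∀ t : ℝ, -((t : ℂ) * Complex.I) = (t : ℂ) * -Complex.I := fun t => by ring
  simp only [heisenberg, e]
  refine h3.congr_deriv ?_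
  simp only [Function.comp, Pi.mul_apply, Ring.lie_def, ← Complex.coe_smul]
  have hc : Commute (NormedSpace.exp (((g s : ℂ) * -Complex.I) • H)) H :=
    ((Commute.refl H).smul_left _).exp_left
  have hc' := hc.eq
  generalize NormedSpace.exp (((g s : ℂ) * Complex.I) • H) = U at *
  generalize NormedSpace.exp (((g s : ℂ) * -Complex.I) • H) = W at *
  rw [hc']
  simp only [smul_mul_assoc, mul_smul_comm, smul_smul, add_mul, mul_add, mul_sub, sub_mul,
    smul_sub, mul_assoc, neg_smul, mul_neg, smul_neg]
  abel

/-- Duhamel's formula in differential form. -/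
theorem hasDerivAt_heisenberg_heisenberg (H₁ H₂ C : Op Λ) (t s : ℝ) :
    HasDerivAt (fun s => heisenberg H₁ (t - s) (heisenberg H₂ s C))
      (-Complex.I • heisenberg H₁ (t - s) ⁅H₁ - H₂, heisenberg H₂ s C⁆) s := by
  have h1 := hasDerivAt_heisenberg_comp H₂ (hasDerivAt_id s) (hasDerivAt_const s C)
  have h2 := hasDerivAt_heisenberg_comp H₁ ((hasDerivAt_id s).const_sub t) h1
  refine h2.congr_deriv ?_
  simp only [id, add_zero, Complex.ofReal_one, one_mul, heisenberg_smul, heisenberg_lie H₂,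
    heisenberg_self]
  rw [← heisenberg_smul]
  congr 1
  simp only [Ring.lie_def, Complex.ofReal_neg, Complex.ofReal_one, neg_mul, one_mul, neg_smul,
    sub_mul, mul_sub, smul_sub]
  abel

theorem norm_sub_le_of_norm_deriv_le_exp {E : Type*} [NormedAddCommGroup E] [NormedSpace ℝ E]
    {f f' : ℝ → E} {t c κ : ℝ} (ht : 0 ≤ t) (hκ : 0 < κ)
    (hf : ∀ s, HasDerivAt f (f' s) s)
    (hb : ∀ s, 0 ≤ s → s ≤ t → ‖f' s‖ ≤ c * Real.exp (κ * s)) :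
    ‖f t - f 0‖ ≤ c / κ * (Real.exp (κ * t) - 1) := by
  refine image_norm_le_of_norm_deriv_right_le_deriv_boundary (a := 0) (b := t)
    (f := fun s => f s - f 0) (f' := f') (B := fun s => c / κ * (Real.exp (κ * s) - 1))
    (B' := fun s => c * Real.exp (κ * s)) ?_ ?_ ?_ ?_ ?_ ⟨ht, le_rfl⟩
  · exact fun s _ => ((hf s).sub_const _).continuousAt.continuousWithinAt
  · exact fun s _ => ((hf s).sub_const _).hasDerivWithinAt
  · simp
  · intro s
    have h1 : HasDerivAt (fun s : ℝ => Real.exp (κ * s)) (Real.exp (κ * s) * (κ * 1)) s :=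
      ((hasDerivAt_id s).const_mul κ).exp
    refine ((h1.sub_const 1).const_mul (c / κ)).congr_deriv ?_
    field_simp
  · exact fun s hs => hb s hs.1 hs.2.le

theorem norm_sub_le_of_norm_deriv_le_affine {E : Type*} [NormedAddCommGroup E] [NormedSpace ℝ E]
    {f f' : ℝ → E} {t c₀ c₁ : ℝ} (ht : 0 ≤ t)
    (hf : ∀ s, HasDerivAt f (f' s) s)
    (hb : ∀ s, 0 ≤ s → s ≤ t → ‖f' s‖ ≤ c₀ + c₁ * s) :
    ‖f t - f 0‖ ≤ c₀ * t + c₁ * t ^ 2 / 2 := by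
  refine image_norm_le_of_norm_deriv_right_le_deriv_boundary (a := 0) (b := t)
    (f := fun s => f s - f 0) (f' := f') (B := fun s => c₀ * s + c₁ * s ^ 2 / 2)
    (B' := fun s => c₀ + c₁ * s) ?_ ?_ ?_ ?_ ?_ ⟨ht, le_rfl⟩
  · exact fun s _ => ((hf s).sub_const _).continuousAt.continuousWithinAt
  · exact fun s _ => ((hf s).sub_const _).hasDerivWithinAt
  · simp
  · intro s
    refine (((hasDerivAt_id s).const_mul c₀).add
      ((((hasDerivAt_id s).pow 2).const_mul c₁).div_const 2)).congr_deriv ?_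
    simp
    ring
  · exact fun s hs => hb s hs.1 hs.2.le

/-- Unitary invariance moves the evolution from one entry of the commutator to the other; this
serves both the near conservation of an operator and the exchange of S₀ and S₁. -/
theorem norm_lie_heisenberg_neg {H : Op Λ} (hH : H.IsHermitian) (t : ℝ) (X C : Op Λ) :
    ‖⁅heisenberg H (-t) X, C⁆‖ = ‖⁅X, heisenberg H t C⁆‖ := by
  rw [← norm_heisenberg hH t, heisenberg_lie, heisenberg_heisenberg_neg]

/-- Two Hamiltonians give close evolutions of `C` when their difference almost commutes with the
evolution of `C`. -/
theorem norm_heisenberg_sub_heisenberg_le {H₁ H₂ C : Op Λ} (h₁ : H₁.IsHermitian) {t c₀ c₁ : ℝ}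
    (ht : 0 ≤ t) (hb : ∀ s, 0 ≤ s → ‖⁅H₁ - H₂, heisenberg H₂ s C⁆‖ ≤ c₀ + c₁ * s) :
    ‖heisenberg H₂ t C - heisenberg H₁ t C‖ ≤ c₀ * t + c₁ * t ^ 2 / 2 := by
  have h := norm_sub_le_of_norm_deriv_le_affine ht
    (hasDerivAt_heisenberg_heisenberg H₁ H₂ C t) (c₀ := c₀) (c₁ := c₁) (fun s hs _ => by
      rw [norm_smul, norm_neg, Complex.norm_I, one_mul, norm_heisenberg h₁]
      exact hb s hs)
  simpa [heisenberg_zero] using h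

theorem norm_heisenberg_sub_self_le {H C : Op Λ} (hH : H.IsHermitian) {t : ℝ} (ht : 0 ≤ t) :
    ‖heisenberg H (-t) C - C‖ ≤ ‖⁅H, C⁆‖ * t := by
  -- The comparison evolution is that of the zero Hamiltonian; the commutator with H evolves
  -- unitarily, so its norm is constant in time.
  have h := norm_heisenberg_sub_heisenberg_le (H₁ := 0) (H₂ := -H) (C := C) (t := t)
    (c₀ := ‖⁅H, C⁆‖) (c₁ := 0) (by simp [Matrix.IsHermitian]) ht (fun s _ => by
      have e : heisenberg (-H) s ⁅-H, C⁆ = ⁅-H, heisenberg (-H) s C⁆ := by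
        rw [heisenberg_lie, heisenberg_self]
      rw [zero_mul, add_zero, zero_sub, neg_neg]
      have e2 : ⁅H, heisenberg (-H) s C⁆ = heisenberg (-H) s ⁅H, C⁆ := by
        rw [heisenberg_lie, heisenberg_neg H H, heisenberg_self]
      rw [e2, norm_heisenberg hH.neg])
  have e0 : heisenberg (0 : Op Λ) t C = C := heisenberg_of_commute (Commute.zero_left C) t
  rw [e0, heisenberg_neg] at h
  simpa using h

/-- If `K` almost commutes with `H₂` and commutes with `C`, then adding `K` to `H₂` hardly
changes the evolution of `C`. -/
theorem norm_heisenberg_add_sub_le {K H₂ C : Op Λ} (hK : K.IsHermitian) (h₂ : H₂.IsHermitian)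
    (hKC : ⁅K, C⁆ = 0) {t δ : ℝ} (ht : 0 ≤ t) (hδ : ‖⁅H₂, K⁆‖ ≤ δ) :
    ‖heisenberg H₂ t C - heisenberg (K + H₂) t C‖ ≤ δ * ‖C‖ * t ^ 2 := by
  have h := norm_heisenberg_sub_heisenberg_le (H₁ := K + H₂) (H₂ := H₂) (C := C) (t := t)
    (c₀ := 0) (c₁ := 2 * δ * ‖C‖) (hK.add h₂) ht (fun s hs => by
      rw [add_sub_cancel_right, ← norm_lie_heisenberg_neg h₂, zero_add]
      -- As K commutes with C, only the drift of K during time s matters. It is at most δ s, and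
      -- integration gives the quadratic growth in t.
      have e : ⁅heisenberg H₂ (-s) K, C⁆ = ⁅heisenberg H₂ (-s) K - K, C⁆ := by
        rw [← sub_zero ⁅heisenberg H₂ (-s) K, C⁆, ← hKC]
        simp only [Ring.lie_def]; noncomm_ring
      rw [e]
      refine (norm_lie_le _ _).trans ?_
      have h3 := (norm_heisenberg_sub_self_le (C := K) h₂ hs).trans
        (mul_le_mul_of_nonneg_right hδ hs)
      nlinarith [norm_nonneg C])
  refine h.trans_eq ?_
  ring

end Heisenberg

/-! ### Division by energy differences -/

section Solve

set_option linter.unusedSectionVars false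

/-- The square of the constant in the bound on the division by energy differences. -/
def spacingConst : ℝ := ∑' n : ℤ, 9 / (((|n| : ℤ) : ℝ) + 1) ^ 2

theorem summable_spacing : Summable fun n : ℤ => 9 / (((|n| : ℤ) : ℝ) + 1) ^ 2 := by
  have h : Summable fun n : ℕ => 9 / ((n : ℝ) + 1) ^ 2 := by
    have h1 := (summable_nat_add_iff 1).2 (Real.summable_one_div_nat_pow.2 (by norm_num : 1 < 2))
    refine (h1.mul_left 9).congr fun n => ?_
    push_cast
    ring
  refine Summable.of_nat_of_neg ?_ ?_ <;> simpa using h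

theorem spacingConst_pos : 0 < spacingConst :=
  summable_spacing.tsum_pos (fun n => by positivity) 0 (by norm_num)

/-- Points with mutual distance at least g have distinct values of ⌊x / g⌋, so the sum is dominated
by the convergent series over the integers, however many points there are. -/
theorem sum_inv_sq_le_of_spaced {ι : Type*} (T : Finset ι) (x : ι → ℝ) {g : ℝ} (hg : 0 < g)
    (h₁ : ∀ a ∈ T, g ≤ |x a|) (h₂ : ∀ a ∈ T, ∀ b ∈ T, a ≠ b → g ≤ |x a - x b|) :
    ∑ a ∈ T, (1 / |x a|) ^ 2 ≤ spacingConst / g ^ 2 := by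
  classical
  have hinj : Set.InjOn (fun a => ⌊x a / g⌋) (T : Set ι) := by
    intro a ha b hb hab
    by_contra hne
    have h := Int.abs_sub_lt_one_of_floor_eq_floor hab
    rw [← sub_div, abs_div, abs_of_pos hg, div_lt_one hg] at h
    exact absurd (h₂ a ha b hb hne) (not_le.2 h)
  -- With n = ⌊x / g⌋ one has |n| ≤ |x / g| + 1 and 1 ≤ |x / g|, hence |n| + 1 ≤ 3 |x / g|; this is
  -- the origin of the 9 in `spacingConst`.
  have hterm : ∀ a ∈ T, (1 / |x a|) ^ 2 ≤
      (9 / (((|⌊x a / g⌋| : ℤ) : ℝ) + 1) ^ 2) / g ^ 2 := by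
    intro a ha
    have h3 : g * ((((|⌊x a / g⌋| : ℤ) : ℝ) + 1) / 3) ≤ |x a| := by
      have h4 : 1 ≤ |x a / g| := by
        rw [abs_div, abs_of_pos hg, le_div_iff₀ hg, one_mul]
        exact h₁ a ha
      have h5 : ((|⌊x a / g⌋| : ℤ) : ℝ) ≤ |x a / g| + 1 := by
        rw [Int.cast_abs, abs_le]
        have := Int.floor_le (x a / g)
        have := Int.lt_floor_add_one (x a / g)
        have := le_abs_self (x a / g)
        have := neg_abs_le (x a / g)
        constructor <;> linarith
      have h6 : (((|⌊x a / g⌋| : ℤ) : ℝ) + 1) / 3 ≤ |x a / g| := by linarith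
      calc _ ≤ g * |x a / g| := by gcongr
        _ = |x a| := by rw [abs_div, abs_of_pos hg]; field_simp
    have hpos : 0 < g * ((((|⌊x a / g⌋| : ℤ) : ℝ) + 1) / 3) := by positivity
    calc (1 / |x a|) ^ 2 ≤ (1 / (g * ((((|⌊x a / g⌋| : ℤ) : ℝ) + 1) / 3))) ^ 2 := by gcongr
      _ = _ := by field_simp; norm_num
  calc ∑ a ∈ T, (1 / |x a|) ^ 2
      ≤ ∑ a ∈ T, (9 / (((|⌊x a / g⌋| : ℤ) : ℝ) + 1) ^ 2) / g ^ 2 := Finset.sum_le_sum hterm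
    _ = (∑ n ∈ T.image fun a => ⌊x a / g⌋, 9 / (((|n| : ℤ) : ℝ) + 1) ^ 2) / g ^ 2 := by
        rw [Finset.sum_image hinj, Finset.sum_div]
    _ ≤ _ := by
        gcongr
        exact summable_spacing.sum_le_tsum _ fun n _ => by positivity

/-- Schur's test: Cauchy–Schwarz in each row with weights ‖T i j‖, then summation over the rows with
the column bound. -/
theorem norm_le_of_row_col_sums {n : Type*} [Fintype n] [DecidableEq n] (T : Matrix n n ℂ)
    {c : ℝ} (hc : 0 ≤ c) (hrow : ∀ i, ∑ j, ‖T i j‖ ≤ c) (hcol : ∀ j, ∑ i, ‖T i j‖ ≤ c) :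
    ‖T‖ ≤ c := by
  rw [Matrix.l2_opNorm_def]
  refine ContinuousLinearMap.opNorm_le_bound _ hc fun x => ?_
  refine (sq_le_sq₀ (norm_nonneg _) (by positivity)).1 ?_
  rw [mul_pow, EuclideanSpace.norm_sq_eq, EuclideanSpace.norm_sq_eq]
  have hi : ∀ i, ‖((Matrix.toEuclideanLin ≪≫ₗ LinearMap.toContinuousLinearMap) T x) i‖ ^ 2 ≤
      c * ∑ j, ‖T i j‖ * ‖x j‖ ^ 2 := by
    intro i
    have e : ((Matrix.toEuclideanLin ≪≫ₗ LinearMap.toContinuousLinearMap) T x) i =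
        ∑ j, T i j * x j := by
      simp [Matrix.mulVec, dotProduct, Matrix.toLpLin_apply]
    rw [e]
    calc ‖∑ j, T i j * x j‖ ^ 2 ≤ (∑ j, ‖T i j‖ * ‖x j‖) ^ 2 := by
          gcongr
          refine (norm_sum_le _ _).trans_eq ?_
          simp
      _ ≤ (∑ j, ‖T i j‖) * ∑ j, ‖T i j‖ * ‖x j‖ ^ 2 :=
          Finset.sum_sq_le_sum_mul_sum_of_sq_le_mul _ (fun _ _ => norm_nonneg _)
            (fun _ _ => by positivity) (fun _ _ => le_of_eq (by ring))
      _ ≤ _ := by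
          gcongr
          exact hrow i
  calc _ ≤ ∑ i, c * ∑ j, ‖T i j‖ * ‖x j‖ ^ 2 := Finset.sum_le_sum fun i _ => hi i
    _ = c * ∑ j, (∑ i, ‖T i j‖) * ‖x j‖ ^ 2 := by
        rw [← Finset.mul_sum, Finset.sum_comm]
        simp only [Finset.sum_mul]
    _ ≤ c * ∑ j, c * ‖x j‖ ^ 2 := by
        gcongr with j
        exact hcol j
    _ = _ := by rw [← Finset.mul_sum]; ring

theorem sum_norm_col_sq_le {n : Type*} [Fintype n] [DecidableEq n] (Y : Matrix n n ℂ) (j : n) :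
    ∑ i, ‖Y i j‖ ^ 2 ≤ ‖Y‖ ^ 2 := by
  have h := Matrix.l2_opNorm_mulVec Y (EuclideanSpace.single j (1 : ℂ))
  rw [PiLp.norm_single, norm_one, mul_one] at h
  have h2 := pow_le_pow_left₀ (norm_nonneg _) h 2
  rw [EuclideanSpace.norm_sq_eq] at h2
  refine le_trans (le_of_eq ?_) h2
  refine Finset.sum_congr rfl fun i _ => ?_
  simp

theorem sum_norm_row_sq_le {n : Type*} [Fintype n] [DecidableEq n] (Y : Matrix n n ℂ) (i : n) :
    ∑ j, ‖Y i j‖ ^ 2 ≤ ‖Y‖ ^ 2 := by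
  have h := sum_norm_col_sq_le Yᴴ i
  rw [Matrix.l2_opNorm_conjTranspose] at h
  simpa [Matrix.conjTranspose_apply] using h

variable {Λ : Type} [Fintype Λ] [DecidableEq Λ]

/-- The solution `T` of `[H₀, T] = Y` off the diagonal, for `H₀` diagonal with eigenvalues `e`. -/
def solve (e : (Λ → Fin 2) → ℝ) (Y : Op Λ) : Op Λ := fun σ τ => Y σ τ / ((e σ - e τ : ℝ) : ℂ)

/-- The diagonal part of an operator. -/
def diagPart (Y : Op Λ) : Op Λ := Matrix.diagonal fun σ => Y σ σ

theorem solve_add (e : (Λ → Fin 2) → ℝ) (Y Z : Op Λ) :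
    solve e (Y + Z) = solve e Y + solve e Z := by
  ext σ τ
  simp [solve, add_div]

theorem diagPart_add (Y Z : Op Λ) : diagPart (Y + Z) = diagPart Y + diagPart Z := by
  ext σ τ
  by_cases h : σ = τ <;> simp [diagPart, h]

theorem diagPart_isHermitian {Y : Op Λ} (hY : Y.IsHermitian) : (diagPart Y).IsHermitian := by
  rw [diagPart, Matrix.isHermitian_diagonal_iff]
  exact fun σ => hY.apply σ σ

theorem solve_isHermitian (e : (Λ → Fin 2) → ℝ) {Y : Op Λ} (hY : Yᴴ = -Y) :
    (solve e Y).IsHermitian := by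
  ext σ τ
  have h : star (Y τ σ) = -Y σ τ := by rw [← Matrix.conjTranspose_apply, hY]; rfl
  rw [Matrix.conjTranspose_apply, solve, star_div₀, h, solve]
  have : star (((e τ - e σ : ℝ) : ℂ)) = -((e σ - e τ : ℝ) : ℂ) := by
    simp [Complex.conj_ofReal]
  rw [this, neg_div_neg_eq]

theorem norm_diagPart_le (Y : Op Λ) : ‖diagPart Y‖ ≤ ‖Y‖ := by
  rw [diagPart, Matrix.l2_opNorm_diagonal, pi_norm_le_iff_of_nonneg (norm_nonneg _)]
  intro σ
  have h := sum_norm_col_sq_le Y σ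
  have h2 := Finset.single_le_sum (f := fun i => ‖Y i σ‖ ^ 2) (fun _ _ => by positivity)
    (Finset.mem_univ σ)
  exact (sq_le_sq₀ (norm_nonneg _) (norm_nonneg _)).1 (h2.trans h)

theorem diagPart_mem_supp {S : Finset Λ} {Y : Op Λ} (hY : Y ∈ supp S) : diagPart Y ∈ supp S := by
  rw [mem_supp_iff] at hY ⊢
  intro i hi
  have hinj : ∀ σ τ : Λ → Fin 2, flip i σ = flip i τ ↔ σ = τ := fun _ _ =>
    (flipEquiv i).injective.eq_iff
  refine ⟨fun σ τ h => ?_, fun σ τ => ?_⟩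
  · rw [diagPart, Matrix.diagonal_apply_ne]
    rintro rfl
    exact h rfl
  · simp only [diagPart, Matrix.diagonal_apply, hinj, (hY i hi).2]

/-- Cauchy–Schwarz in each row and column pairs the entries of Y, square summable to ‖Y‖², with the
inverse energy differences, whose squares are summable because the energies are separated by g. The
bound has no factor of the dimension 2^|Q|. -/
theorem norm_solve_le {Q : Finset Λ} {e : (Λ → Fin 2) → ℝ} {g : ℝ} (hg : 0 < g)
    (hgap : ∀ σ τ : Λ → Fin 2, (∃ i ∈ Q, σ i ≠ τ i) → g ≤ |e σ - e τ|)
    {Y : Op Λ} (hY : Y ∈ supp Q) : ‖solve e Y‖ ≤ √spacingConst / g * ‖Y‖ := by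
  classical
  have hs := Real.sqrt_nonneg spacingConst
  have key : ∀ (y : (Λ → Fin 2) → ℂ) (σ : Λ → Fin 2), ∑ τ, ‖y τ‖ ^ 2 ≤ ‖Y‖ ^ 2 →
      (∀ τ, (∃ i, i ∉ Q ∧ τ i ≠ σ i) → y τ = 0) →
      ∑ τ, ‖y τ‖ / |e τ - e σ| ≤ √spacingConst / g * ‖Y‖ := by
    intro y σ hy hy0
    -- Outside `T` nothing contributes: at τ = σ the quotient is a division by zero, hence 0, and if
    -- τ differs from σ outside Q the entry of Y vanishes.
    set T := Finset.univ.filter fun τ : Λ → Fin 2 => τ ≠ σ ∧ ∀ i, i ∉ Q → τ i = σ i with hT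
    have h1 : ∑ τ, ‖y τ‖ / |e τ - e σ| = ∑ τ ∈ T, ‖y τ‖ * (1 / |e τ - e σ|) := by
      rw [hT, Finset.sum_filter]
      refine Finset.sum_congr rfl fun τ _ => ?_
      split_ifs with h
      · ring
      · by_cases h0 : τ = σ
        · simp [h0]
        · rw [hy0 τ]
          · simp
          · by_contra hcon
            push Not at hcon
            exact h ⟨h0, hcon⟩
    have hdiff : ∀ τ τ' : Λ → Fin 2, (∀ i, i ∉ Q → τ i = σ i) → (∀ i, i ∉ Q → τ' i = σ i) →
        τ ≠ τ' → g ≤ |e τ - e τ'| := by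
      intro τ τ' h h' hne
      obtain ⟨i, hi⟩ := Function.ne_iff.1 hne
      refine hgap τ τ' ⟨i, ?_, hi⟩
      by_contra hiQ
      exact hi (by rw [h i hiQ, h' i hiQ])
    have h2 : ∑ τ ∈ T, (1 / |e τ - e σ|) ^ 2 ≤ spacingConst / g ^ 2 := by
      refine sum_inv_sq_le_of_spaced T (fun τ => e τ - e σ) hg (fun τ hτ => ?_)
        (fun τ hτ τ' hτ' hne => ?_)
      · rw [hT, Finset.mem_filter] at hτ
        exact hdiff τ σ hτ.2.2 (fun _ _ => rfl) hτ.2.1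
      · rw [hT, Finset.mem_filter] at hτ hτ'
        simpa using hdiff τ τ' hτ.2.2 hτ'.2.2 hne
    have h3 : ∑ τ ∈ T, ‖y τ‖ ^ 2 ≤ ‖Y‖ ^ 2 :=
      (Finset.sum_le_sum_of_subset_of_nonneg (Finset.subset_univ _)
        fun _ _ _ => by positivity).trans hy
    rw [h1]
    refine (sq_le_sq₀ (Finset.sum_nonneg fun _ _ => by positivity) (by positivity)).1 ?_
    calc _ ≤ (∑ τ ∈ T, ‖y τ‖ ^ 2) * ∑ τ ∈ T, (1 / |e τ - e σ|) ^ 2 :=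
          Finset.sum_mul_sq_le_sq_mul_sq _ _ _
      _ ≤ ‖Y‖ ^ 2 * (spacingConst / g ^ 2) :=
          mul_le_mul h3 h2 (Finset.sum_nonneg fun _ _ => by positivity) (by positivity)
      _ = _ := by
          rw [mul_pow, div_pow, Real.sq_sqrt spacingConst_pos.le]; ring
  have hne : ∀ σ τ, ‖solve e Y σ τ‖ = ‖Y σ τ‖ / |e τ - e σ| := fun σ τ => by
    rw [solve, norm_div, Complex.norm_real, Real.norm_eq_abs, abs_sub_comm]
  refine norm_le_of_row_col_sums _ (by positivity) (fun σ => ?_) (fun τ => ?_)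
  · simp only [hne]
    refine key _ σ (sum_norm_row_sq_le Y σ) fun τ ⟨i, hi, h⟩ => ?_
    exact apply_eq_zero_of_mem_supp hY hi h.symm
  · simp only [hne, abs_sub_comm (e τ)]
    refine key _ τ (sum_norm_col_sq_le Y τ) fun σ ⟨i, hi, h⟩ => ?_
    exact apply_eq_zero_of_mem_supp hY hi h

theorem lie_diagonal_apply (e : (Λ → Fin 2) → ℝ) (Y : Op Λ) (σ τ : Λ → Fin 2) :
    ⁅(Matrix.diagonal fun σ => ((e σ : ℝ) : ℂ) : Op Λ), Y⁆ σ τ =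
      ((e σ - e τ : ℝ) : ℂ) * Y σ τ := by
  rw [Ring.lie_def, Matrix.sub_apply, Matrix.diagonal_mul, Matrix.mul_diagonal]
  push_cast
  ring

theorem lie_solve {Q : Finset Λ} {e : (Λ → Fin 2) → ℝ} {g : ℝ} (hg : 0 < g)
    (hgap : ∀ σ τ : Λ → Fin 2, (∃ i ∈ Q, σ i ≠ τ i) → g ≤ |e σ - e τ|)
    {Y : Op Λ} (hY : Y ∈ supp Q) (hd : diagPart Y = 0) :
    ⁅(Matrix.diagonal fun σ => ((e σ : ℝ) : ℂ) : Op Λ), solve e Y⁆ = Y := by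
  ext σ τ
  rw [lie_diagonal_apply, solve]
  by_cases h : σ = τ
  · subst h
    have := congrFun (congrFun hd σ) σ
    simp only [diagPart, Matrix.diagonal_apply_eq, Matrix.zero_apply] at this
    simp [this]
  · obtain ⟨i, hi⟩ := Function.ne_iff.1 h
    by_cases hiQ : i ∈ Q
    · have h0 : e σ - e τ ≠ 0 := by
        intro h0
        have := hgap σ τ ⟨i, hiQ, hi⟩
        rw [h0, abs_zero] at this
        linarith
      rw [mul_div_cancel₀]
      exact_mod_cast h0
    · rw [apply_eq_zero_of_mem_supp hY hiQ hi]
      simp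

theorem solve_lie {Q : Finset Λ} {e : (Λ → Fin 2) → ℝ} {g : ℝ} (hg : 0 < g)
    (hgap : ∀ σ τ : Λ → Fin 2, (∃ i ∈ Q, σ i ≠ τ i) → g ≤ |e σ - e τ|)
    {Y : Op Λ} (hY : Y ∈ supp Q) :
    solve e ⁅(Matrix.diagonal fun σ => ((e σ : ℝ) : ℂ) : Op Λ), Y⁆ = Y - diagPart Y := by
  ext σ τ
  rw [solve, lie_diagonal_apply, Matrix.sub_apply, diagPart]
  by_cases h : σ = τ
  · subst h
    simp
  · obtain ⟨i, hi⟩ := Function.ne_iff.1 h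
    rw [Matrix.diagonal_apply_ne _ h, sub_zero]
    by_cases hiQ : i ∈ Q
    · have h0 : e σ - e τ ≠ 0 := by
        intro h0
        have := hgap σ τ ⟨i, hiQ, hi⟩
        rw [h0, abs_zero] at this
        linarith
      rw [mul_div_cancel_left₀]
      exact_mod_cast h0
    · rw [apply_eq_zero_of_mem_supp hY hiQ hi]
      simp

theorem diagPart_lie_diagonal (e : (Λ → Fin 2) → ℝ) (Y : Op Λ) :
    diagPart ⁅(Matrix.diagonal fun σ => ((e σ : ℝ) : ℂ) : Op Λ), Y⁆ = 0 := by
  rw [diagPart]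
  simp [lie_diagonal_apply]

/-- The energy difference of two configurations that agree outside S only involves strings meeting
S, and none of these contains a vertex at distance more than k from S. -/
theorem energy_flip_sub_energy_flip {G : SimpleGraph Λ} {k : ℕ} {J : Finset Λ → ℝ}
    (hJ : ∀ I, J I ≠ 0 → DiamLE G I k) {Q S : Finset Λ} {i : Λ}
    (hi : i ∈ Q → ∀ u ∈ S, k < G.dist u i) {σ τ : Λ → Fin 2} (hst : ∀ j, j ∉ S → σ j = τ j) :
    energy J Q (flip i σ) - energy J Q (flip i τ) = energy J Q σ - energy J Q τ := by
  simp only [energy, ← Finset.sum_sub_distrib, ← mul_sub]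
  refine Finset.sum_congr rfl fun I hI => ?_
  rw [Finset.mem_powerset] at hI
  by_cases hJI : J I = 0
  · simp [hJI]
  by_cases hIS : Disjoint I S
  · have h1 : ∀ j ∈ I, σ j = τ j := fun j hj => hst j (Finset.disjoint_left.1 hIS hj)
    have h2 : ∀ j ∈ I, flip i σ j = flip i τ j := fun j hj => by
      by_cases hji : j = i
      · subst hji; rw [flip_self_apply, flip_self_apply, h1 _ hj]
      · rw [flip_apply_of_ne hji, flip_apply_of_ne hji, h1 _ hj]
    have p1 : ∏ j ∈ I, zSign (σ j) = ∏ j ∈ I, zSign (τ j) :=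
      Finset.prod_congr rfl fun j hj => by rw [h1 j hj]
    have p2 : ∏ j ∈ I, zSign (flip i σ j) = ∏ j ∈ I, zSign (flip i τ j) :=
      Finset.prod_congr rfl fun j hj => by rw [h2 j hj]
    rw [p1, p2, sub_self, sub_self]
  · have hiI : i ∉ I := fun h => by
      obtain ⟨u, huI, huS⟩ := Finset.not_disjoint_iff.1 hIS
      exact absurd (hJ I hJI u huI i h) (not_le.2 (hi (hI h) u huS))
    have : ∀ σ : Λ → Fin 2, ∏ j ∈ I, zSign (flip i σ j) = ∏ j ∈ I, zSign (σ j) := fun σ =>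
      Finset.prod_congr rfl fun j hj => by
        rw [flip_apply_of_ne (fun e : j = i => hiI (e ▸ hj))]
    rw [this, this]

/-- Division by energy differences enlarges supports by the range of the classical
Hamiltonian. -/
theorem solve_mem_supp {G : SimpleGraph Λ} {k : ℕ} {J : Finset Λ → ℝ}
    (hJ : ∀ I, J I ≠ 0 → DiamLE G I k) {Q S S' : Finset Λ} (hSS' : S ⊆ S')
    (hS' : ∀ i ∈ Q, ∀ u ∈ S, G.dist u i ≤ k → i ∈ S') {Y : Op Λ} (hY : Y ∈ supp S) :
    solve (energy J Q) Y ∈ supp S' := by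
  rw [mem_supp_iff]
  intro i hi
  have hiS : i ∉ S := fun h => hi (hSS' h)
  refine ⟨fun σ τ h => ?_, fun σ τ => ?_⟩
  · rw [solve, apply_eq_zero_of_mem_supp hY hiS h, zero_div]
  · rw [solve, solve, ((mem_supp_iff.1 hY) i hiS).2]
    by_cases hst : ∀ j, j ∉ S → σ j = τ j
    · rw [energy_flip_sub_energy_flip hJ _ hst]
      intro hiQ u hu
      by_contra hle
      exact hi (hS' i hiQ u hu (not_lt.1 hle))
    · push Not at hst
      obtain ⟨j, hj, hne⟩ := hst
      rw [apply_eq_zero_of_mem_supp hY hj hne, zero_div, zero_div]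

theorem solve_mem_supp_self (J : Finset Λ → ℝ) {Q : Finset Λ} {Y : Op Λ} (hY : Y ∈ supp Q) :
    solve (energy J Q) Y ∈ supp Q := by
  rw [mem_supp_iff]
  intro i hi
  refine ⟨fun σ τ h => by rw [solve, apply_eq_zero_of_mem_supp hY hi h, zero_div],
    fun σ τ => ?_⟩
  have : ∀ σ : Λ → Fin 2, energy J Q (flip i σ) = energy J Q σ := fun σ => by
    refine Finset.sum_congr rfl fun I hI => ?_
    rw [Finset.mem_powerset] at hI
    rw [Finset.prod_congr rfl fun j hj => by
        rw [flip_apply_of_ne (fun e : j = i => hi (e ▸ hI hj))]]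
  rw [solve, solve, ((mem_supp_iff.1 hY) i hi).2, this, this]

end Solve

/-! ### Formal perturbation theory -/

section Formal

/-- `D` stands for the diagonal part. At order zero the commutator is [H₀, ·], which `D` kills. For
j + 1, the vanishing of order zero makes the constant coefficient of A a polynomial f(H₀).
Subtracting f(H), which commutes with the whole series H, does not change the commutator and leaves
a multiple of X; dividing by X lowers the order by one. -/
theorem map_coeff_commutator_eq_zero {R M : Type*} [Ring R] [Algebra ℂ R] [AddCommGroup M]
    (H : PowerSeries R) (D : R →+ M)
    (hD : ∀ a, D (PowerSeries.coeff 0 H * a - a * PowerSeries.coeff 0 H) = 0)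
    (hc : ∀ a, Commute (PowerSeries.coeff 0 H) a →
      ∃ f : Polynomial ℂ, a = Polynomial.aeval (PowerSeries.coeff 0 H) f) (j : ℕ) :
    ∀ A : PowerSeries R, (∀ i < j, PowerSeries.coeff i (H * A - A * H) = 0) →
      D (PowerSeries.coeff j (H * A - A * H)) = 0 := by
  induction j with
  | zero =>
    intro A _
    simpa using hD (PowerSeries.coeff 0 A)
  | succ j ih =>
    intro A hA
    have h0 := hA 0 (Nat.succ_pos j)
    have h0' : Commute (PowerSeries.coeff 0 H) (PowerSeries.coeff 0 A) := by
      have : PowerSeries.coeff 0 H * PowerSeries.coeff 0 A -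
        PowerSeries.coeff 0 A * PowerSeries.coeff 0 H = 0 := by
        simpa using h0
      exact sub_eq_zero.1 this
    obtain ⟨f, hf⟩ := hc _ h0'
    have hcomm : Commute H (Polynomial.aeval H f) := by
      simpa using (Polynomial.commute_X f).map (Polynomial.aeval H)
    have hcst : PowerSeries.constantCoeff (A - Polynomial.aeval H f) = 0 := by
      have e : PowerSeries.constantCoeff (Polynomial.aeval H f) =
          Polynomial.aeval (PowerSeries.coeff 0 H) f := by
        let φ : PowerSeries R →ₐ[ℂ] R :=
          { PowerSeries.constantCoeff (R := R) with
            commutes' := fun r => by simp [PowerSeries.algebraMap_apply] }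
        exact (Polynomial.aeval_algHom_apply φ H f).symm.trans (by simp [φ])
      rw [map_sub, e, ← hf]
      simp
    set A' : PowerSeries R := PowerSeries.mk fun p =>
      PowerSeries.coeff (p + 1) (A - Polynomial.aeval H f) with hA'
    have hX := PowerSeries.eq_X_mul_shift_add_const (A - Polynomial.aeval H f)
    rw [hcst, map_zero, add_zero, ← hA'] at hX
    have hcm : H * A - A * H = PowerSeries.X * (H * A' - A' * H) := by
      have h1 : H * A - A * H = H * (A - Polynomial.aeval H f) -
          (A - Polynomial.aeval H f) * H := by
        rw [mul_sub, sub_mul, hcomm.eq]; abel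
      rw [h1, hX, mul_sub, ← mul_assoc, ← PowerSeries.X_mul (φ := H), mul_assoc, mul_assoc]
    rw [hcm, PowerSeries.coeff_succ_X_mul]
    refine ih A' fun i hi => ?_
    rw [← PowerSeries.coeff_succ_X_mul, ← hcm]
    exact hA (i + 1) (by omega)

end Formal

/-! ### Locally conserved operators -/

section Dress

set_option linter.unusedSectionVars false

variable {Λ : Type} [Fintype Λ] [DecidableEq Λ]

/-- The perturbation series of a conserved operator: `∑_j dress e H S j` commutes with
`∑_j H j` order by order, where `H 0` is diagonal with nondegenerate eigenvalues `e`, and its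
diagonal part at order `j` is that of `S j`. -/
def dress (e : (Λ → Fin 2) → ℝ) (H S : ℕ → Op Λ) : ℕ → Op Λ
  | j => diagPart (S j) - solve e (∑ l : Fin j, ⁅H (j - l), dress e H S l⁆)
decreasing_by exact l.2

variable {e : (Λ → Fin 2) → ℝ} {H S : ℕ → Op Λ}

theorem dress_eq (e : (Λ → Fin 2) → ℝ) (H S : ℕ → Op Λ) (j : ℕ) :
    dress e H S j =
      diagPart (S j) - solve e (∑ l ∈ Finset.range j, ⁅H (j - l), dress e H S l⁆) := by
  rw [dress, ← Fin.sum_univ_eq_sum_range (fun l => ⁅H (j - l), dress e H S l⁆)]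

theorem dress_add (e : (Λ → Fin 2) → ℝ) (H S S' : ℕ → Op Λ) (j : ℕ) :
    dress e H (fun l => S l + S' l) j = dress e H S j + dress e H S' j := by
  induction j using Nat.strong_induction_on with
  | _ j ih =>
    rw [dress_eq, dress_eq e H S, dress_eq e H S', diagPart_add]
    have h : ∑ l ∈ Finset.range j, ⁅H (j - l), dress e H (fun l => S l + S' l) l⁆ =
        ∑ l ∈ Finset.range j, ⁅H (j - l), dress e H S l⁆ +
          ∑ l ∈ Finset.range j, ⁅H (j - l), dress e H S' l⁆ := by
      rw [← Finset.sum_add_distrib]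
      refine Finset.sum_congr rfl fun l hl => ?_
      rw [ih l (Finset.mem_range.1 hl)]
      simp only [Ring.lie_def]
      noncomm_ring
    rw [h, solve_add]
    abel

theorem dress_isHermitian (hH : ∀ l, (H l).IsHermitian) (hS : ∀ l, (S l).IsHermitian) (j : ℕ) :
    (dress e H S j).IsHermitian := by
  induction j using Nat.strong_induction_on with
  | _ j ih =>
    rw [dress_eq]
    refine (diagPart_isHermitian (hS j)).sub (solve_isHermitian e ?_)
    rw [Matrix.conjTranspose_sum, ← Finset.sum_neg_distrib]
    refine Finset.sum_congr rfl fun l hl => ?_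
    rw [Ring.lie_def, Matrix.conjTranspose_sub, Matrix.conjTranspose_mul,
      Matrix.conjTranspose_mul, (hH _).eq, (ih l (Finset.mem_range.1 hl)).eq]
    abel

/-- `T j` is the region reached at order j; the second hypothesis says that one step of the
recursion from order l lands in it. -/
theorem dress_mem_supp {T : ℕ → Finset Λ} (hS : ∀ j, S j ∈ supp (T j))
    (hT : ∀ j, ∀ l < j, ∀ Y ∈ supp (T l), solve e ⁅H (j - l), Y⁆ ∈ supp (T j)) (j : ℕ) :
    dress e H S j ∈ supp (T j) := by
  induction j using Nat.strong_induction_on with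
  | _ j ih =>
    rw [dress_eq]
    refine sub_mem (diagPart_mem_supp (hS j)) ?_
    have hsum : ∀ s : Finset ℕ, s ⊆ Finset.range j →
        solve e (∑ l ∈ s, ⁅H (j - l), dress e H S l⁆) ∈ supp (T j) := by
      intro s hs
      induction s using Finset.induction_on with
      | empty =>
        have : solve e (0 : Op Λ) = 0 := by ext σ τ; simp [solve]
        rw [Finset.sum_empty, this]
        exact zero_mem _
      | insert a s ha ih' =>
        rw [Finset.sum_insert ha, solve_add]
        have haj : a < j := Finset.mem_range.1 (hs (Finset.mem_insert_self _ _))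
        exact add_mem (hT j a haj _ (ih a haj))
          (ih' fun x hx => hs (Finset.mem_insert_of_mem hx))
    exact hsum _ subset_rfl

/-! ### Conservation of the dressed series in a non-resonant region -/

section Gap

variable {Q : Finset Λ} {J : Finset Λ → ℝ} {g : ℝ}

/-- The Hamiltonian is itself a conserved series with its own diagonal parts, and the recursion
finds it again. Together with the linearity `dress_add`, splitting the source splits H exactly into
two separately conserved pieces. -/
theorem dress_self (hg : 0 < g) (hgap : GapGE J Q g) (hH : ∀ l, H l ∈ supp Q)
    (hH0 : H 0 = Matrix.diagonal fun σ => ((energy J Q σ : ℝ) : ℂ)) (j : ℕ) :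
    dress (energy J Q) H H j = H j := by
  induction j using Nat.strong_induction_on with
  | _ j ih =>
    rw [dress_eq]
    rcases Nat.eq_zero_or_pos j with rfl | hj
    · have : solve (energy J Q) (0 : Op Λ) = 0 := by ext σ τ; simp [solve]
      rw [Finset.range_zero, Finset.sum_empty, this, hH0, sub_zero]
      simp [diagPart]
    · have h1 : ∑ l ∈ Finset.range j, ⁅H (j - l), dress (energy J Q) H H l⁆ =
          ∑ l ∈ Finset.range j, ⁅H (j - l), H l⁆ :=
        Finset.sum_congr rfl fun l hl => by rw [ih l (Finset.mem_range.1 hl)]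
      -- The reflection l ↦ j - l turns the sum into its negative.
      have h2 : ∑ l ∈ Finset.range (j + 1), ⁅H (j - l), H l⁆ = 0 := by
        have h3 := Finset.sum_range_reflect (fun l => ⁅H (j - l), H l⁆) (j + 1)
        have h4 : ∑ l ∈ Finset.range (j + 1), ⁅H (j - (j + 1 - 1 - l)), H (j + 1 - 1 - l)⁆ =
            -∑ l ∈ Finset.range (j + 1), ⁅H (j - l), H l⁆ := by
          rw [← Finset.sum_neg_distrib]
          refine Finset.sum_congr rfl fun l hl => ?_
          have hl' : l ≤ j := Nat.lt_succ_iff.1 (Finset.mem_range.1 hl)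
          rw [Nat.add_sub_cancel, Nat.sub_sub_self hl']
          simp only [Ring.lie_def, neg_sub]
        rw [h4] at h3
        have h6 : (2 : ℂ) • ∑ l ∈ Finset.range (j + 1), ⁅H (j - l), H l⁆ = 0 := by
          rw [two_smul]
          nth_rewrite 1 [← h3]
          exact neg_add_cancel _
        exact (smul_eq_zero.1 h6).resolve_left two_ne_zero
      rw [Finset.sum_range_succ, Nat.sub_self] at h2
      have h5 : ∑ l ∈ Finset.range j, ⁅H (j - l), H l⁆ = ⁅H 0, -H j⁆ := by
        rw [eq_neg_of_add_eq_zero_left h2]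
        simp only [Ring.lie_def]
        noncomm_ring
      rw [h1, h5, hH0, solve_lie hg hgap (neg_mem (hH j))]
      have h6 : diagPart (-H j) = -diagPart (H j) := by
        ext σ τ
        by_cases h : σ = τ <;> simp [diagPart, h]
      rw [h6]
      abel

theorem dress_mem_supp_region (hH : ∀ l, H l ∈ supp Q) (hS : ∀ l, S l ∈ supp Q) (j : ℕ) :
    dress (energy J Q) H S j ∈ supp Q :=
  dress_mem_supp (T := fun _ => Q) hS
    (fun _ _ _ _ hY => solve_mem_supp_self J (lie_mem_supp (hH _) hY)) j

/-- The algebra of operators supported on a non-resonant region `Q`: the commutant of the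
classical Hamiltonian consists of its polynomials. -/
theorem exists_eq_aeval_of_commute (hg : 0 < g) (hgap : GapGE J Q g) {a : Op Λ}
    (ha : a ∈ supp Q)
    (hc : Commute (Matrix.diagonal fun σ => ((energy J Q σ : ℝ) : ℂ)) a) :
    ∃ f : Polynomial ℂ,
      a = Polynomial.aeval (Matrix.diagonal fun σ => ((energy J Q σ : ℝ) : ℂ) : Op Λ) f := by
  classical
  have hinj : ∀ σ τ : Λ → Fin 2, energy J Q σ = energy J Q τ → ∀ i ∈ Q, σ i = τ i := by
    intro σ τ h i hi
    by_contra hne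
    have := hgap σ τ ⟨i, hi, hne⟩
    rw [h, sub_self, abs_zero] at this
    linarith
  have hoff : ∀ σ τ, σ ≠ τ → a σ τ = 0 := by
    intro σ τ hne
    have h0 := lie_diagonal_apply (energy J Q) a σ τ
    rw [Ring.lie_def, hc.eq, sub_self, Matrix.zero_apply] at h0
    rcases mul_eq_zero.1 h0.symm with h1 | h1
    · have h2 : energy J Q σ = energy J Q τ := by
        have : energy J Q σ - energy J Q τ = 0 := by exact_mod_cast h1
        linarith
      obtain ⟨i, hi⟩ := Function.ne_iff.1 hne
      exact apply_eq_zero_of_mem_supp ha (fun hiQ => hi (hinj σ τ h2 i hiQ)) hi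
    · exact h1
  have hdiag : ∀ σ τ, energy J Q σ = energy J Q τ → a σ σ = a τ τ := by
    intro σ τ h
    have h1 := apply_piecewise_of_mem_supp ha (σ := σ) (τ := σ) (fun _ _ => rfl) τ Qᶜ
      disjoint_compl_left
    have h2 : Qᶜ.piecewise τ σ = τ := by
      ext1 i
      by_cases hi : i ∈ Q
      · simp [Finset.piecewise, hi, hinj σ τ h i hi]
      · simp [Finset.piecewise, hi]
    rw [h2] at h1
    exact h1.symm
  set r : ℂ → ℂ := fun z =>
    if h : ∃ σ, ((energy J Q σ : ℝ) : ℂ) = z then a h.choose h.choose else 0 with hr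
  have hr' : ∀ σ, r ((energy J Q σ : ℝ) : ℂ) = a σ σ := by
    intro σ
    have hex : ∃ τ, ((energy J Q τ : ℝ) : ℂ) = ((energy J Q σ : ℝ) : ℂ) := ⟨σ, rfl⟩
    simp only [hr]
    rw [dif_pos hex]
    exact hdiag _ _ (by exact_mod_cast hex.choose_spec)
  -- Off-diagonal entries of `a` vanish and its diagonal is a function of the energy, so it is the
  -- polynomial interpolating this function at the eigenvalues.
  refine ⟨Lagrange.interpolate (Finset.univ.image fun σ => ((energy J Q σ : ℝ) : ℂ)) id r, ?_⟩
  have hev : ∀ f : Polynomial ℂ,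
      Polynomial.aeval (Matrix.diagonal fun σ => ((energy J Q σ : ℝ) : ℂ) : Op Λ) f =
        Matrix.diagonal fun σ => f.eval ((energy J Q σ : ℝ) : ℂ) := by
    intro f
    have h1 := Polynomial.aeval_algHom_apply (Matrix.diagonalAlgHom (n := Λ → Fin 2) (α := ℂ) ℂ)
      (fun σ => ((energy J Q σ : ℝ) : ℂ)) f
    have h2 : Polynomial.aeval (fun σ => ((energy J Q σ : ℝ) : ℂ)) f =
        fun σ => f.eval ((energy J Q σ : ℝ) : ℂ) := by
      ext σ
      rw [Polynomial.aeval_pi_apply₂]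
      simp [Polynomial.aeval_def, Polynomial.eval₂_eq_eval_map]
    rw [h2] at h1
    exact h1
  rw [hev]
  ext σ τ
  by_cases h : σ = τ
  · subst h
    rw [Matrix.diagonal_apply_eq, ← hr' σ]
    exact (Lagrange.eval_interpolate_at_node (v := id) r (Function.injective_id.injOn)
      (Finset.mem_image_of_mem (fun σ => ((energy J Q σ : ℝ) : ℂ)) (Finset.mem_univ σ))).symm
  · rw [Matrix.diagonal_apply_ne _ h, hoff σ τ h]

/-- At order j the recursion has to solve [H₀, A_j] = -F, where F collects the lower orders. This is
possible exactly when F has no diagonal part, which is what `map_coeff_commutator_eq_zero` provides,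
whatever diagonal parts `S` prescribes. -/
theorem sum_lie_dress_eq_zero (hg : 0 < g) (hgap : GapGE J Q g) (hH : ∀ l, H l ∈ supp Q)
    (hH0 : H 0 = Matrix.diagonal fun σ => ((energy J Q σ : ℝ) : ℂ)) (hS : ∀ l, S l ∈ supp Q)
    (j : ℕ) :
    ∑ l ∈ Finset.range (j + 1), ⁅H (j - l), dress (energy J Q) H S l⁆ = 0 := by
  induction j using Nat.strong_induction_on with
  | _ j ih =>
    set A := dress (energy J Q) H S with hA
    have hAm : ∀ l, A l ∈ supp Q := dress_mem_supp_region hH hS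
    set F := ∑ l ∈ Finset.range j, ⁅H (j - l), A l⁆ with hF
    have hFm : F ∈ supp Q := sum_mem fun l _ => lie_mem_supp (hH _) (hAm l)
    have hFd : diagPart F = 0 := by
      -- The coefficient ring is `supp Q`, since only there is the commutant of H₀ made of
      -- polynomials in H₀. The series `AP` stops before order j, so that coefficient j of its
      -- commutator with `HP` is F and the lower ones vanish by induction.
      let HP : PowerSeries (supp Q) := PowerSeries.mk fun l => ⟨H l, hH l⟩
      let AP : PowerSeries (supp Q) := PowerSeries.mk fun l => if l < j then ⟨A l, hAm l⟩ else 0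
      let D : supp Q →+ Op Λ :=
        { toFun := fun a => diagPart (a : Op Λ)
          map_zero' := by ext σ τ; simp [diagPart]
          map_add' := fun a b => diagPart_add _ _ }
      have hco : ∀ n, ((PowerSeries.coeff n (HP * AP - AP * HP) : supp Q) : Op Λ) =
          ∑ l ∈ Finset.range (n + 1), ⁅H (n - l), if l < j then A l else 0⁆ := by
        intro n
        rw [map_sub, PowerSeries.coeff_mul, PowerSeries.coeff_mul,
          ← Finset.Nat.sum_antidiagonal_swap,
          Finset.Nat.sum_antidiagonal_eq_sum_range_succ_mk,
          Finset.Nat.sum_antidiagonal_eq_sum_range_succ_mk, ← Finset.sum_sub_distrib]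
        rw [AddSubmonoidClass.coe_finsetSum]
        refine Finset.sum_congr rfl fun l _ => ?_
        simp only [HP, AP, PowerSeries.coeff_mk, Prod.fst_swap, Prod.snd_swap, Ring.lie_def]
        split_ifs <;> simp
      have hmain := map_coeff_commutator_eq_zero HP D (fun a => ?_) (fun a hc => ?_) j AP
        (fun i hi => ?_)
      · have h1 : D (PowerSeries.coeff j (HP * AP - AP * HP)) = diagPart F := by
          change diagPart _ = _
          rw [hco, Finset.sum_range_succ, if_neg (lt_irrefl j)]
          congr 1
          rw [hF, Ring.lie_def, mul_zero, zero_mul, sub_zero, add_zero]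
          exact Finset.sum_congr rfl fun l hl => by rw [if_pos (Finset.mem_range.1 hl)]
        rw [← h1, hmain]
      · change diagPart _ = 0
        have := diagPart_lie_diagonal (energy J Q) (a : Op Λ)
        rw [← hH0, Ring.lie_def] at this
        simpa [HP] using this
      · have hc' : Commute (H 0) (a : Op Λ) := by
          have := congrArg (Subtype.val) hc.eq
          simp only [HP, PowerSeries.coeff_mk] at this
          exact this
        rw [hH0] at hc'
        obtain ⟨f, hf⟩ := exists_eq_aeval_of_commute hg hgap a.2 hc'
        refine ⟨f, ?_⟩
        apply Subtype.ext
        rw [hf, ← hH0]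
        simp [HP]
      · apply Subtype.ext
        rw [hco]
        refine Eq.trans ?_ (ih i hi)
        refine Finset.sum_congr rfl fun l hl => ?_
        rw [if_pos (lt_of_le_of_lt (Nat.lt_succ_iff.1 (Finset.mem_range.1 hl)) hi)]
    have h0 : ⁅H 0, A j⁆ = -F := by
      rw [hA, dress_eq, ← hA, ← hF]
      have h1 := lie_solve hg hgap hFm hFd
      have h2 : ⁅H 0, diagPart (S j)⁆ = 0 := by
        rw [hH0, Ring.lie_def, diagPart, Matrix.diagonal_mul_diagonal,
          Matrix.diagonal_mul_diagonal, sub_eq_zero]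
        congr 1
        ext σ
        ring
      rw [← hH0] at h1
      simp only [Ring.lie_def] at h1 h2 ⊢
      rw [mul_sub, sub_mul, sub_sub_sub_comm, h1, h2, zero_sub]
    rw [Finset.sum_range_succ, ← hF, Nat.sub_self, h0, add_neg_cancel]

end Gap

/-- Order j - l of the Hamiltonian brings ε^(j-l) w(j-l). As the w's sum to at most h, the
convolution over l costs a single factor 2cNh per order and no combinatorial factor, so a geometric
bound propagates. -/
theorem norm_dress_le {c ε κ N α h : ℝ} {w : ℕ → ℝ} (hc : 0 ≤ c) (hε : 0 ≤ ε) (hN : 0 ≤ N)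
    (hw : ∀ l, 0 ≤ w l) (hwh : ∀ s : Finset ℕ, ∑ l ∈ s, w l ≤ h)
    (hsolve : ∀ j, ‖solve e (∑ l ∈ Finset.range j, ⁅H (j - l), dress e H S l⁆)‖ ≤
      c * ‖∑ l ∈ Finset.range j, ⁅H (j - l), dress e H S l⁆‖)
    (hH : ∀ l, 1 ≤ l → ‖H l‖ ≤ N * (ε ^ l * w l))
    (hS : ∀ l, 1 ≤ l → ‖S l‖ ≤ N * (ε ^ l * w l)) (hS0 : ‖S 0‖ ≤ α)
    (hα : N * h ≤ α) (hκ : 1 + 2 * c * N * h ≤ κ) (j : ℕ) :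
    ‖dress e H S j‖ ≤ α * (ε * κ) ^ j := by
  have hh : 0 ≤ h := by simpa using hwh ∅
  have hα0 : 0 ≤ α := (mul_nonneg hN hh).trans hα
  have hκ1 : 1 ≤ κ := le_trans (by nlinarith [mul_nonneg (mul_nonneg hc hN) hh]) hκ
  induction j using Nat.strong_induction_on with
  | _ j ih =>
    rcases Nat.eq_zero_or_pos j with rfl | hj
    · have : solve e (0 : Op Λ) = 0 := by ext σ τ; simp [solve]
      rw [dress_eq, Finset.range_zero, Finset.sum_empty, this, sub_zero, pow_zero, mul_one]
      exact (norm_diagPart_le _).trans hS0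
    · obtain ⟨j, rfl⟩ : ∃ i, j = i + 1 := ⟨j - 1, by omega⟩
      rw [dress_eq]
      have h1 : ‖∑ l ∈ Finset.range (j + 1), ⁅H (j + 1 - l), dress e H S l⁆‖ ≤
          2 * N * α * ε ^ (j + 1) * κ ^ j * h := by
        calc _ ≤ ∑ l ∈ Finset.range (j + 1), ‖⁅H (j + 1 - l), dress e H S l⁆‖ :=
              norm_sum_le _ _
          _ ≤ ∑ l ∈ Finset.range (j + 1), 2 * N * α * ε ^ (j + 1) * κ ^ j * w (j + 1 - l) := by
              refine Finset.sum_le_sum fun l hl => ?_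
              have hl' := Finset.mem_range.1 hl
              have e1 : ε ^ (j + 1) = ε ^ (j + 1 - l) * ε ^ l := by
                rw [← pow_add]; congr 1; omega
              calc _ ≤ 2 * ‖H (j + 1 - l)‖ * ‖dress e H S l‖ := norm_lie_le _ _
                _ ≤ 2 * (N * (ε ^ (j + 1 - l) * w (j + 1 - l))) * (α * (ε * κ) ^ l) := by
                    have := hw (j + 1 - l)
                    exact mul_le_mul (by linarith [hH (j + 1 - l) (by omega)]) (ih l hl')
                      (norm_nonneg _) (by positivity)
                _ = 2 * N * α * ε ^ (j + 1) * κ ^ l * w (j + 1 - l) := by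
                    rw [e1, mul_pow]; ring
                _ ≤ _ := by
                    have := hw (j + 1 - l)
                    have hlj : l ≤ j := by omega
                    gcongr
          _ ≤ _ := by
              rw [← Finset.mul_sum]
              refine mul_le_mul_of_nonneg_left ?_ (by positivity)
              refine le_trans (le_of_eq ?_) (hwh ((Finset.range (j + 1)).image fun l => j + 1 - l))
              rw [Finset.sum_image]
              intro a ha b hb hab
              have ha' := Finset.mem_range.1 (Finset.mem_coe.1 ha)
              have hb' := Finset.mem_range.1 (Finset.mem_coe.1 hb)
              change j + 1 - a = j + 1 - b at hab
              omega
      have h2 : ‖diagPart (S (j + 1))‖ ≤ α * ε ^ (j + 1) * κ ^ j := by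
        calc _ ≤ ‖S (j + 1)‖ := norm_diagPart_le _
          _ ≤ N * (ε ^ (j + 1) * w (j + 1)) := hS _ (by omega)
          _ ≤ N * (ε ^ (j + 1) * h) := by
              have := hwh {j + 1}
              rw [Finset.sum_singleton] at this
              gcongr
          _ = (N * h) * ε ^ (j + 1) * 1 := by ring
          _ ≤ α * ε ^ (j + 1) * κ ^ j := by
              gcongr
              exact one_le_pow₀ hκ1
      calc _ ≤ ‖diagPart (S (j + 1))‖ +
            ‖solve e (∑ l ∈ Finset.range (j + 1), ⁅H (j + 1 - l), dress e H S l⁆)‖ :=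
            norm_sub_le _ _
        _ ≤ α * ε ^ (j + 1) * κ ^ j + c * (2 * N * α * ε ^ (j + 1) * κ ^ j * h) :=
            add_le_add h2 ((hsolve _).trans (mul_le_mul_of_nonneg_left h1 hc))
        _ = α * ε ^ (j + 1) * κ ^ j * (1 + 2 * c * N * h) := by ring
        _ ≤ α * ε ^ (j + 1) * κ ^ j * κ := by gcongr
        _ = _ := by rw [mul_pow]; ring

/-- In the commutator of the truncated sums all pairs of total order at most m cancel by
conservation. Each remaining pair has total order at least m + 1, and for each of the m + 1 orders
of `A` the w's are summed to h. -/
theorem norm_lie_truncation_le {A : ℕ → Op Λ} {ε κ N α h : ℝ} {w : ℕ → ℝ} (hε : 0 ≤ ε)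
    (hκ : 1 ≤ κ) (hεκ : ε * κ ≤ 1) (hN : 0 ≤ N) (hw : ∀ l, 0 ≤ w l) (hα : 0 ≤ α)
    (hwh : ∀ s : Finset ℕ, ∑ l ∈ s, w l ≤ h)
    (hcons : ∀ j, ∑ l ∈ Finset.range (j + 1), ⁅H (j - l), A l⁆ = 0)
    (hH : ∀ l, 1 ≤ l → ‖H l‖ ≤ N * (ε ^ l * w l)) (hA : ∀ j, ‖A j‖ ≤ α * (ε * κ) ^ j) (m : ℕ) :
    ‖⁅∑ l ∈ Finset.range (m + 1), H l, ∑ j ∈ Finset.range (m + 1), A j⁆‖ ≤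
      2 * N * α * h * ((m + 1) * (ε * κ) ^ (m + 1)) := by
  have hx : 0 ≤ ε * κ := by positivity
  have e1 : ⁅∑ l ∈ Finset.range (m + 1), H l, ∑ j ∈ Finset.range (m + 1), A j⁆ =
      ∑ j ∈ Finset.range (m + 1), ∑ l ∈ Finset.range (m + 1), ⁅H l, A j⁆ := by
    simp only [Ring.lie_def, Finset.sum_mul_sum, Finset.sum_sub_distrib]
    congr 1
    rw [Finset.sum_comm]
  have e2 : ∑ j ∈ Finset.range (m + 1), ∑ l ∈ Finset.range (m + 1 - j), ⁅H l, A j⁆ = 0 := by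
    rw [← Finset.sum_range_diag_flip (m + 1) (fun j l => ⁅H l, A j⁆)]
    exact Finset.sum_eq_zero fun n _ => hcons n
  have e3 : ∑ j ∈ Finset.range (m + 1), ∑ l ∈ Finset.range (m + 1), ⁅H l, A j⁆ =
      ∑ j ∈ Finset.range (m + 1), ∑ l ∈ Finset.Ico (m + 1 - j) (m + 1), ⁅H l, A j⁆ := by
    rw [← zero_add (∑ j ∈ Finset.range (m + 1), ∑ l ∈ Finset.Ico (m + 1 - j) (m + 1), ⁅H l, A j⁆),
      ← e2, ← Finset.sum_add_distrib]
    refine Finset.sum_congr rfl fun j _ => ?_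
    rw [Finset.sum_range_add_sum_Ico _ (Nat.sub_le _ _)]
  rw [e1, e3]
  calc _ ≤ ∑ j ∈ Finset.range (m + 1), ‖∑ l ∈ Finset.Ico (m + 1 - j) (m + 1), ⁅H l, A j⁆‖ :=
        norm_sum_le _ _
    _ ≤ ∑ j ∈ Finset.range (m + 1), 2 * N * α * h * (ε * κ) ^ (m + 1) := by
        refine Finset.sum_le_sum fun j hj => ?_
        have hj' := Finset.mem_range.1 hj
        calc _ ≤ ∑ l ∈ Finset.Ico (m + 1 - j) (m + 1), ‖⁅H l, A j⁆‖ := norm_sum_le _ _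
          _ ≤ ∑ l ∈ Finset.Ico (m + 1 - j) (m + 1), 2 * N * α * (ε * κ) ^ (m + 1) * w l := by
              refine Finset.sum_le_sum fun l hl => ?_
              rw [Finset.mem_Ico] at hl
              have := hw l
              calc _ ≤ 2 * ‖H l‖ * ‖A j‖ := norm_lie_le _ _
                _ ≤ 2 * (N * (ε ^ l * w l)) * (α * (ε * κ) ^ j) :=
                    mul_le_mul (by linarith [hH l (by omega)]) (hA j) (norm_nonneg _)
                      (by positivity)
                _ = 2 * N * α * w l * (ε * κ) ^ j * ε ^ l := by ring
                _ ≤ 2 * N * α * w l * (ε * κ) ^ j * (ε * κ) ^ l := by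
                    gcongr
                    exact le_mul_of_one_le_right hε hκ
                _ = 2 * N * α * w l * (ε * κ) ^ (j + l) := by rw [pow_add]; ring
                _ ≤ 2 * N * α * w l * (ε * κ) ^ (m + 1) := by
                    gcongr ?_ * ?_
                    exact pow_le_pow_of_le_one hx hεκ (by omega)
                _ = _ := by ring
          _ ≤ _ := by
              rw [← Finset.mul_sum]
              calc _ ≤ 2 * N * α * (ε * κ) ^ (m + 1) * h :=
                    mul_le_mul_of_nonneg_left (hwh _) (by positivity)
                _ = _ := by ring
    _ = _ := by
        rw [Finset.sum_const, Finset.card_range, nsmul_eq_mul]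
        push_cast
        ring

end Dress

/-! ### Interactions -/

section Interaction

set_option linter.unusedSectionVars false

variable {Λ : Type} [Fintype Λ] [DecidableEq Λ]

/-- An interaction `S ↦ ∑_l W l S` whose zeroth order is the classical Hamiltonian with
coefficients `J` of range `k` and strength `h`, and whose order `l ≥ 1` has range `l` and local
norm at most `ε ^ l * w l` with `∑ w ≤ h`. -/
structure LocalSeries (G : SimpleGraph Λ) (k : ℕ) (h ε : ℝ) (J : Finset Λ → ℝ)
    (W : ℕ → Finset Λ → Op Λ) (w : ℕ → ℝ) : Prop where
  zero : ∀ S, W 0 S = (J S : ℂ) • pauliZ S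
  abs_le : ∀ I, |J I| ≤ h
  diam_zero : ∀ I, J I ≠ 0 → DiamLE G I k
  isHermitian : ∀ l S, (W l S).IsHermitian
  mem_supp : ∀ l S, W l S ∈ supp S
  diam : ∀ l, 1 ≤ l → ∀ S, W l S ≠ 0 → DiamLE G S l
  empty : ∀ l, 1 ≤ l → W l ∅ = 0
  norm_le : ∀ l, 1 ≤ l → ∀ v, ∑ S ∈ Finset.univ.filter (fun S => v ∈ S), ‖W l S‖ ≤ ε ^ l * w l
  w_nonneg : ∀ l, 0 ≤ w l
  w_summable : Summable w
  w_le : ∑' l, w l ≤ h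

/-- The total interaction term on `S`. -/
def term (W : ℕ → Finset Λ → Op Λ) (S : Finset Λ) : Op Λ := ∑' l, W l S

/-- The Hamiltonian of all the terms that avoid `R`. -/
def ham (W : ℕ → Finset Λ → Op Λ) (R : Finset Λ) : Op Λ :=
  ∑ S ∈ Finset.univ.filter (fun S => Disjoint S R), term W S

theorem sum_meeting_le (f : Finset Λ → ℝ) (hf : ∀ S, 0 ≤ f S) (Q : Finset Λ) {c : ℝ}
    (hc : ∀ v ∈ Q, ∑ S ∈ Finset.univ.filter (fun S => v ∈ S), f S ≤ c) :
    ∑ S ∈ Finset.univ.filter (fun S => ¬Disjoint S Q), f S ≤ Q.card * c := by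
  calc _ ≤ ∑ S : Finset Λ, ∑ v ∈ Q, if v ∈ S then f S else 0 := by
        refine (Finset.sum_le_sum fun S hS => ?_).trans
          (Finset.sum_le_sum_of_subset_of_nonneg (Finset.subset_univ _) fun S _ _ => ?_)
        · obtain ⟨_, hS⟩ := Finset.mem_filter.1 hS
          obtain ⟨v, hvS, hvQ⟩ := Finset.not_disjoint_iff.1 hS
          refine le_trans ?_ (Finset.single_le_sum (f := fun v => if v ∈ S then f S else 0)
            (fun v _ => ?_) hvQ)
          · simp [hvS]
          · split_ifs
            exacts [hf S, le_rfl]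
        · refine Finset.sum_nonneg fun v _ => ?_
          split_ifs
          exacts [hf S, le_rfl]
    _ = ∑ v ∈ Q, ∑ S ∈ Finset.univ.filter (fun S => v ∈ S), f S := by
        rw [Finset.sum_comm]
        simp only [Finset.sum_filter]
    _ ≤ ∑ v ∈ Q, c := Finset.sum_le_sum hc
    _ = _ := by simp

variable {G : SimpleGraph Λ} {k : ℕ} {h ε : ℝ} {J : Finset Λ → ℝ}
  {W : ℕ → Finset Λ → Op Λ} {w : ℕ → ℝ}

theorem norm_pauliZ_le (I : Finset Λ) : ‖(pauliZ I : Op Λ)‖ ≤ 1 := by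
  rw [pauliZ, Matrix.l2_opNorm_diagonal, pi_norm_le_iff_of_nonneg zero_le_one]
  intro σ
  rw [Complex.norm_real, norm_prod]
  refine Finset.prod_le_one (fun _ _ => norm_nonneg _) fun i _ => ?_
  rw [zSign]
  split_ifs <;> simp

namespace LocalSeries

variable (hW : LocalSeries G k h ε J W w)

include hW

theorem h_nonneg : 0 ≤ h := (tsum_nonneg hW.w_nonneg).trans hW.w_le

theorem sum_w_le (s : Finset ℕ) : ∑ l ∈ s, w l ≤ h :=
  (hW.w_summable.sum_le_tsum s fun _ _ => hW.w_nonneg _).trans hW.w_le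

theorem norm_apply_le (l : ℕ) (hl : 1 ≤ l) (S : Finset Λ) (hε : 0 ≤ ε) :
    ‖W l S‖ ≤ ε ^ l * w l := by
  rcases S.eq_empty_or_nonempty with rfl | ⟨v, hv⟩
  · rw [hW.empty l hl, norm_zero]
    exact mul_nonneg (pow_nonneg hε l) (hW.w_nonneg l)
  · exact (Finset.single_le_sum (f := fun S => ‖W l S‖) (fun _ _ => norm_nonneg _)
      (by simpa using hv)).trans (hW.norm_le l hl v)

theorem summable_norm (hε : 0 ≤ ε) (hε1 : ε ≤ 1) (S : Finset Λ) :
    Summable fun l => ‖W l S‖ := by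
  rw [← summable_nat_add_iff 1]
  refine Summable.of_nonneg_of_le (fun _ => norm_nonneg _) (fun l => ?_)
    ((summable_nat_add_iff 1).2 hW.w_summable)
  refine (hW.norm_apply_le (l + 1) (by omega) S hε).trans ?_
  exact mul_le_of_le_one_left (hW.w_nonneg _) (pow_le_one₀ hε hε1)

theorem summable (hε : 0 ≤ ε) (hε1 : ε ≤ 1) (S : Finset Λ) : Summable fun l => W l S :=
  (hW.summable_norm hε hε1 S).of_norm

theorem diam_le (l : ℕ) (S : Finset Λ) (h0 : W l S ≠ 0) : DiamLE G S (max k l) := by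
  rcases Nat.eq_zero_or_pos l with rfl | hl
  · have : J S ≠ 0 := by
      rintro h1
      rw [hW.zero, h1] at h0
      simp at h0
    exact fun x hx y hy => (hW.diam_zero S this x hx y hy).trans (le_max_left _ _)
  · exact fun x hx y hy => (hW.diam l hl S h0 x hx y hy).trans (le_max_right _ _)

theorem term_isHermitian (hε : 0 ≤ ε) (hε1 : ε ≤ 1) (S : Finset Λ) :
    (term W S).IsHermitian := by
  have h1 := (hW.summable hε hε1 S).hasSum
  have h2 := h1.star
  have h3 : (fun l => star (W l S)) = fun l => W l S := funext fun l => hW.isHermitian l S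
  rw [h3] at h2
  exact h2.unique h1

theorem term_mem_supp (hε : 0 ≤ ε) (hε1 : ε ≤ 1) (S : Finset Λ) : term W S ∈ supp S := by
  refine (isClosed_supp S).mem_of_tendsto (hW.summable hε hε1 S).hasSum
    (Filter.Eventually.of_forall fun s => ?_)
  exact sum_mem fun l _ => hW.mem_supp l S

theorem ham_isHermitian (hε : 0 ≤ ε) (hε1 : ε ≤ 1) (R : Finset Λ) : (ham W R).IsHermitian := by
  rw [ham, Matrix.IsHermitian, Matrix.conjTranspose_sum]
  exact Finset.sum_congr rfl fun S _ => hW.term_isHermitian hε hε1 S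

theorem ham_mem_supp (hε : 0 ≤ ε) (hε1 : ε ≤ 1) (R : Finset Λ) : ham W R ∈ supp Rᶜ := by
  refine sum_mem fun S hS => ?_
  refine supp_mono ?_ (hW.term_mem_supp hε hε1 S)
  rw [Finset.subset_compl_iff_disjoint_right]
  exact (Finset.mem_filter.1 hS).2

theorem norm_sum_region_le {l : ℕ} (hl : 1 ≤ l) (Q : Finset Λ)
    (P : Finset (Finset Λ)) (hP : P ⊆ Q.powerset) :
    ‖∑ S ∈ P, W l S‖ ≤ Q.card * (ε ^ l * w l) := by
  refine le_trans ?_ (sum_meeting_le (fun S => ‖W l S‖) (fun _ => norm_nonneg _) Q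
    fun v _ => hW.norm_le l hl v)
  have h1 : ∑ S ∈ P, W l S = ∑ S ∈ P.filter (fun S => ¬Disjoint S Q), W l S := by
    rw [Finset.sum_filter_of_ne]
    intro S hS h0 hd
    have hSQ := Finset.mem_powerset.1 (hP hS)
    have : S = ∅ := Finset.disjoint_self_iff_empty S |>.1 (hd.mono_right hSQ)
    exact h0 (this ▸ hW.empty l hl)
  rw [h1]
  refine (norm_sum_le _ _).trans ?_
  refine Finset.sum_le_sum_of_subset_of_nonneg (fun S hS => ?_) fun _ _ _ => norm_nonneg _
  simpa using (Finset.mem_filter.1 hS).2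

theorem sum_region_mem_supp (l : ℕ) (Q : Finset Λ) (P : Finset (Finset Λ))
    (hP : P ⊆ Q.powerset) : ∑ S ∈ P, W l S ∈ supp Q :=
  sum_mem fun S hS => supp_mono (Finset.mem_powerset.1 (hP hS)) (hW.mem_supp l S)

theorem lie_region_mem_supp {l : ℕ} (hl : 1 ≤ l) {Q T T' : Finset Λ} (hTT' : T ⊆ T')
    (hT' : ∀ v ∈ Q, ∀ u ∈ T, G.dist u v ≤ l → v ∈ T') {Y : Op Λ} (hY : Y ∈ supp T) :
    ⁅∑ S ∈ Q.powerset, W l S, Y⁆ ∈ supp T' := by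
  have e : ⁅∑ S ∈ Q.powerset, W l S, Y⁆ = ∑ S ∈ Q.powerset, ⁅W l S, Y⁆ := by
    simp only [Ring.lie_def, Finset.sum_mul, Finset.mul_sum, Finset.sum_sub_distrib]
  rw [e]
  refine sum_mem fun S hS => ?_
  by_cases hd : Disjoint S T
  · rw [lie_eq_zero_of_mem_supp hd (hW.mem_supp l S) hY]
    exact zero_mem _
  by_cases h0 : W l S = 0
  · rw [h0, Ring.lie_def, zero_mul, mul_zero, sub_zero]
    exact zero_mem _
  · refine lie_mem_supp (supp_mono ?_ (hW.mem_supp l S)) (supp_mono hTT' hY)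
    intro v hv
    obtain ⟨u, huS, huT⟩ := Finset.not_disjoint_iff.1 hd
    exact hT' v (Finset.mem_powerset.1 hS hv) u huT (hW.diam l hl S h0 u huS v hv)

theorem summable_norm_tail (hε : 0 ≤ ε) (hε1 : ε ≤ 1) (m : ℕ) (S : Finset Λ) :
    Summable fun l => ‖W (l + (m + 1)) S‖ :=
  (summable_nat_add_iff (f := fun l => ‖W l S‖) (m + 1)).2 (hW.summable_norm hε hε1 S)

theorem tsum_tail_le (hε : 0 ≤ ε) (hε1 : ε ≤ 1) (m : ℕ) (v : Λ) :
    ∑' l, ∑ S ∈ Finset.univ.filter (fun S => v ∈ S), ‖W (l + (m + 1)) S‖ ≤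
      ε ^ (m + 1) * h := by
  have hws : Summable fun l => ε ^ (m + 1) * w (l + (m + 1)) :=
    ((summable_nat_add_iff (f := w) (m + 1)).2 hW.w_summable).mul_left _
  have h1 : ∀ l, ∑ S ∈ Finset.univ.filter (fun S => v ∈ S), ‖W (l + (m + 1)) S‖ ≤
      ε ^ (m + 1) * w (l + (m + 1)) := fun l => by
    refine (hW.norm_le _ (by omega) v).trans ?_
    refine mul_le_mul_of_nonneg_right ?_ (hW.w_nonneg _)
    exact pow_le_pow_of_le_one hε hε1 (by omega)
  have h2 : ∑' l, w (l + (m + 1)) ≤ h := by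
    refine le_trans ?_ hW.w_le
    rw [← hW.w_summable.sum_add_tsum_nat_add (m + 1)]
    exact le_add_of_nonneg_left (Finset.sum_nonneg fun _ _ => hW.w_nonneg _)
  calc _ ≤ ∑' l, ε ^ (m + 1) * w (l + (m + 1)) :=
        Summable.tsum_le_tsum h1 (summable_sum fun S _ => hW.summable_norm_tail hε hε1 m S) hws
    _ = ε ^ (m + 1) * ∑' l, w (l + (m + 1)) := tsum_mul_left
    _ ≤ ε ^ (m + 1) * h := mul_le_mul_of_nonneg_left h2 (by positivity)

theorem sum_norm_tail_le (hε : 0 ≤ ε) (hε1 : ε ≤ 1) (m : ℕ) (Q : Finset Λ) :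
    ∑ S ∈ Finset.univ.filter (fun S => ¬Disjoint S Q), ‖∑' l, W (l + (m + 1)) S‖ ≤
      Q.card * (ε ^ (m + 1) * h) := by
  have hs := hW.summable_norm_tail hε hε1 m
  have h1 : ∀ v, ∑ S ∈ Finset.univ.filter (fun S => v ∈ S), ∑' l, ‖W (l + (m + 1)) S‖ ≤
      ε ^ (m + 1) * h := fun v => by
    rw [← Summable.tsum_finsetSum fun S _ => hs S]
    exact hW.tsum_tail_le hε hε1 m v
  have h2 := sum_meeting_le (fun S => ∑' l, ‖W (l + (m + 1)) S‖)
    (fun S => tsum_nonneg fun _ => norm_nonneg _) Q fun v _ => h1 v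
  exact (Finset.sum_le_sum fun S _ => norm_tsum_le_tsum_norm (hs S)).trans h2

/-- Source terms of order j meet the core and have diameter at most max k j. In passing from order l
to j the commutator moves the support outwards by j - l and the division by energies by k, in all at
most (k + 1)(j - l). -/
theorem dress_inner_mem_supp (hconn : G.Connected) (Q : Finset Λ) (y : Λ) (ρ j : ℕ) :
    dress (energy J Q) (fun l => ∑ S ∈ Q.powerset, W l S)
      (fun l => ∑ S ∈ Q.powerset.filter
        (fun S => ¬Disjoint S (Q.filter fun v => G.dist y v ≤ ρ)), W l S) j ∈
      supp (Q.filter fun v => G.dist y v ≤ ρ + k + (k + 1) * j) := by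
  have htri : ∀ u v l, G.dist u v ≤ l → G.dist y v ≤ G.dist y u + l := fun u v l huv =>
    (hconn.dist_triangle (u := y) (v := u) (w := v)).trans (by omega)
  revert j
  refine dress_mem_supp
    (T := fun j => Q.filter fun v => G.dist y v ≤ ρ + k + (k + 1) * j) (fun j => ?_) (fun j l hlj Y hY => ?_)
  · refine sum_mem fun S hS => ?_
    rw [Finset.mem_filter, Finset.mem_powerset, Finset.not_disjoint_iff] at hS
    obtain ⟨hSQ, u, huS, huc⟩ := hS
    by_cases h0 : W j S = 0
    · rw [h0]; exact zero_mem _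
    refine supp_mono (fun v hv => ?_) (hW.mem_supp j S)
    have h1 := hW.diam_le j S h0 u huS v hv
    have h2 := htri u v _ h1
    have h3 := (Finset.mem_filter.1 huc).2
    have h4 : max k j ≤ k + j := by omega
    have h5 : j ≤ (k + 1) * j := Nat.le_mul_of_pos_left j (by omega)
    exact Finset.mem_filter.2 ⟨hSQ hv, by omega⟩
  · have hY' : ⁅∑ S ∈ Q.powerset, W (j - l) S, Y⁆ ∈
        supp (Q.filter fun v => G.dist y v ≤ ρ + k + (k + 1) * l + (j - l)) := by
      refine hW.lie_region_mem_supp (by omega) ?_ ?_ hY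
      · intro v hv
        rw [Finset.mem_filter] at hv ⊢
        exact ⟨hv.1, by omega⟩
      · intro v hv u hu huv
        have := htri u v _ huv
        rw [Finset.mem_filter] at hu ⊢
        exact ⟨hv, by omega⟩
    have hmul : (k + 1) * j = (k + 1) * l + (k + 1) * (j - l) := by
      rw [← mul_add]; congr 1; omega
    have hmul2 : k + (j - l) ≤ (k + 1) * (j - l) := by
      obtain ⟨i, hi⟩ : ∃ i, j - l = i + 1 := ⟨j - l - 1, by omega⟩
      rw [hi]; nlinarith
    refine solve_mem_supp hW.diam_zero ?_ ?_ hY'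
    · intro v hv
      rw [Finset.mem_filter] at hv ⊢
      exact ⟨hv.1, by omega⟩
    · intro v hv u hu huv
      have := htri u v _ huv
      rw [Finset.mem_filter] at hu ⊢
      exact ⟨hv, by omega⟩

/-- The same spreading, measured inwards: source terms avoid the core, and each order brings the
support closer to y by at most k + 1. The inequality is written additively to avoid truncated
subtraction. -/
theorem dress_outer_mem_supp (hconn : G.Connected) (Q : Finset Λ) (y : Λ) (ρ j : ℕ) :
    dress (energy J Q) (fun l => ∑ S ∈ Q.powerset, W l S)
      (fun l => ∑ S ∈ Q.powerset.filter
        (fun S => Disjoint S (Q.filter fun v => G.dist y v ≤ ρ)), W l S) j ∈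
      supp (Q.filter fun v => ρ < G.dist y v + (k + 1) * j) := by
  have htri : ∀ u v l, G.dist u v ≤ l → G.dist y v ≤ G.dist y u + l := fun u v l huv =>
    (hconn.dist_triangle (u := y) (v := u) (w := v)).trans (by omega)
  have htri' : ∀ u v l, G.dist u v ≤ l → G.dist y u ≤ G.dist y v + l := fun u v l huv => by
    refine htri v u l ?_
    rwa [SimpleGraph.dist_comm]
  revert j
  refine dress_mem_supp
    (T := fun j => Q.filter fun v => ρ < G.dist y v + (k + 1) * j) (fun j => ?_) (fun j l hlj Y hY => ?_)
  · refine sum_mem fun S hS => ?_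
    rw [Finset.mem_filter, Finset.mem_powerset] at hS
    refine supp_mono (fun v hv => ?_) (hW.mem_supp j S)
    have h1 := Finset.disjoint_left.1 hS.2 hv
    rw [Finset.mem_filter, not_and, not_le] at h1
    have := h1 (hS.1 hv)
    exact Finset.mem_filter.2 ⟨hS.1 hv, by omega⟩
  · have hY' : ⁅∑ S ∈ Q.powerset, W (j - l) S, Y⁆ ∈
        supp (Q.filter fun v => ρ < G.dist y v + (k + 1) * l + (j - l)) := by
      refine hW.lie_region_mem_supp (by omega) ?_ ?_ hY
      · intro v hv
        rw [Finset.mem_filter] at hv ⊢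
        exact ⟨hv.1, by omega⟩
      · intro v hv u hu huv
        have := htri' u v _ huv
        rw [Finset.mem_filter] at hu ⊢
        exact ⟨hv, by omega⟩
    have hmul : (k + 1) * j = (k + 1) * l + (k + 1) * (j - l) := by
      rw [← mul_add]; congr 1; omega
    have hmul2 : k + (j - l) ≤ (k + 1) * (j - l) := by
      obtain ⟨i, hi⟩ : ∃ i, j - l = i + 1 := ⟨j - l - 1, by omega⟩
      rw [hi]; nlinarith
    refine solve_mem_supp hW.diam_zero ?_ ?_ hY'
    · intro v hv
      rw [Finset.mem_filter] at hv ⊢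
      exact ⟨hv.1, by omega⟩
    · intro v hv u hu huv
      have := htri' u v _ huv
      rw [Finset.mem_filter] at hu ⊢
      exact ⟨hv, by omega⟩

/-- The truncated Hamiltonian of Q is split by whether the source terms meet the core around y. Both
dressed parts are conserved up to order m; since A commutes with itself, [B, A] is the truncation
error of [H, A]. The sum A + B is exact, so no unitary rotation is needed and the supports stay
strict. -/
theorem exists_conserved (hε : 0 < ε) (hh : 0 < h) {Q : Finset Λ} {y : Λ} {ρ m : ℕ}
    {g N C₁ κ : ℝ} (hg : 0 < g) (hgap : GapGE J Q g) (hN : Q.card ≤ N) (hC₁ : 1 ≤ C₁)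
    (hJ₁ : ∀ v, ∑ S ∈ Finset.univ.filter (fun S => v ∈ S), ‖W 0 S‖ ≤ C₁ * h)
    (hκ : 1 + 2 * (√spacingConst / g) * N * h ≤ κ) (hεκ : ε * κ ≤ 1) (hconn : G.Connected) :
    ∃ A B : Op Λ, A.IsHermitian ∧ B.IsHermitian ∧
      A + B = ∑ l ∈ Finset.range (m + 1), ∑ S ∈ Q.powerset, W l S ∧
      A ∈ supp (Q.filter fun v => G.dist y v ≤ ρ + k + (k + 1) * m) ∧
      B ∈ supp (Q.filter fun v => ρ < G.dist y v + (k + 1) * m) ∧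
      ‖⁅B, A⁆‖ ≤ 2 * N * (N * C₁ * h) * h * ((m + 1) * (ε * κ) ^ (m + 1)) := by
  set H : ℕ → Op Λ := fun l => ∑ S ∈ Q.powerset, W l S with hH
  set core := Q.filter fun v => G.dist y v ≤ ρ with hcore
  set Si : ℕ → Op Λ := fun l => ∑ S ∈ Q.powerset.filter (fun S => ¬Disjoint S core), W l S
    with hSi
  set So : ℕ → Op Λ := fun l => ∑ S ∈ Q.powerset.filter (fun S => Disjoint S core), W l S
    with hSo
  have hN0 : 0 ≤ N := le_trans (by positivity) hN
  have hsum : (fun l => Si l + So l) = H := by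
    funext l
    simp only [hSi, hSo, hH]
    rw [add_comm]
    exact Finset.sum_filter_add_sum_filter_not _ _ _
  have hHs : ∀ l, H l ∈ supp Q := fun l => hW.sum_region_mem_supp l Q _ subset_rfl
  have hSis : ∀ l, Si l ∈ supp Q := fun l =>
    hW.sum_region_mem_supp l Q _ (Finset.filter_subset _ _)
  have hherm : ∀ (P : Finset (Finset Λ)) l, (∑ S ∈ P, W l S).IsHermitian := fun P l => by
    rw [Matrix.IsHermitian, Matrix.conjTranspose_sum]
    exact Finset.sum_congr rfl fun S _ => hW.isHermitian l S
  have hH0 : H 0 = Matrix.diagonal fun σ => ((energy J Q σ : ℝ) : ℂ) := by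
    rw [← classicalHam_eq_diagonal]
    exact Finset.sum_congr rfl fun S _ => hW.zero S
  set A := fun j => dress (energy J Q) H Si j with hA
  set B := fun j => dress (energy J Q) H So j with hB
  have hAB : ∀ j, A j + B j = H j := fun j => by
    rw [hA, hB, ← dress_add, hsum, dress_self hg hgap hHs hH0]
  have hAs : ∀ j, A j ∈ supp (Q.filter fun v => G.dist y v ≤ ρ + k + (k + 1) * j) :=
    hW.dress_inner_mem_supp hconn Q y ρ
  have hBs : ∀ j, B j ∈ supp (Q.filter fun v => ρ < G.dist y v + (k + 1) * j) :=
    hW.dress_outer_mem_supp hconn Q y ρ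
  have hκ1 : 1 ≤ κ := le_trans (by
    have : 0 ≤ 2 * (√spacingConst / g) * N * h := by positivity
    linarith) hκ
  have hHn : ∀ l, 1 ≤ l → ‖H l‖ ≤ N * (ε ^ l * w l) := fun l hl =>
    (hW.norm_sum_region_le hl Q _ subset_rfl).trans
      (mul_le_mul_of_nonneg_right hN (mul_nonneg (by positivity) (hW.w_nonneg l)))
  have hSn : ∀ l, 1 ≤ l → ‖Si l‖ ≤ N * (ε ^ l * w l) := fun l hl =>
    (hW.norm_sum_region_le hl Q _ (Finset.filter_subset _ _)).trans
      (mul_le_mul_of_nonneg_right hN (mul_nonneg (by positivity) (hW.w_nonneg l)))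
  have hS0 : ‖Si 0‖ ≤ N * C₁ * h := by
    calc ‖Si 0‖ ≤ ∑ S ∈ Q.powerset.filter (fun S => ¬Disjoint S core), ‖W 0 S‖ :=
          norm_sum_le _ _
      _ ≤ ∑ S ∈ Finset.univ.filter (fun S => ¬Disjoint S Q), ‖W 0 S‖ := by
          refine Finset.sum_le_sum_of_subset_of_nonneg (fun S hS => ?_)
            fun _ _ _ => norm_nonneg _
          rw [Finset.mem_filter] at hS ⊢
          exact ⟨Finset.mem_univ _, fun hd => hS.2 (hd.mono_right (Finset.filter_subset _ _))⟩
      _ ≤ Q.card * (C₁ * h) :=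
          sum_meeting_le _ (fun _ => norm_nonneg _) Q fun v _ => hJ₁ v
      _ ≤ N * (C₁ * h) := by gcongr
      _ = _ := by ring
  have hAn : ∀ j, ‖A j‖ ≤ (N * C₁ * h) * (ε * κ) ^ j := by
    refine norm_dress_le (c := √spacingConst / g) (by positivity) hε.le hN0 hW.w_nonneg
      hW.sum_w_le (fun j => ?_) hHn hSn hS0 ?_ hκ
    · exact norm_solve_le hg hgap
        (sum_mem fun l _ => lie_mem_supp (hHs _) (dress_mem_supp_region hHs hSis l))
    · have : N * h * 1 ≤ N * h * C₁ := mul_le_mul_of_nonneg_left hC₁ (by positivity)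
      linarith
  have hcons := sum_lie_dress_eq_zero hg hgap hHs hH0 hSis
  have htr := norm_lie_truncation_le hε.le hκ1 hεκ hN0 hW.w_nonneg (by positivity)
    hW.sum_w_le hcons hHn hAn m
  have hABs : ∑ j ∈ Finset.range (m + 1), A j + ∑ j ∈ Finset.range (m + 1), B j =
      ∑ l ∈ Finset.range (m + 1), H l := by
    rw [← Finset.sum_add_distrib]
    exact Finset.sum_congr rfl fun j _ => hAB j
  refine ⟨∑ j ∈ Finset.range (m + 1), A j, ∑ j ∈ Finset.range (m + 1), B j, ?_, ?_, hABs,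
    ?_, ?_, ?_⟩
  · rw [Matrix.IsHermitian, Matrix.conjTranspose_sum]
    exact Finset.sum_congr rfl fun j _ => dress_isHermitian (hherm _) (hherm _) j
  · rw [Matrix.IsHermitian, Matrix.conjTranspose_sum]
    exact Finset.sum_congr rfl fun j _ => dress_isHermitian (hherm _) (hherm _) j
  · refine sum_mem fun j hj => supp_mono (fun v hv => ?_) (hAs j)
    rw [Finset.mem_filter] at hv ⊢
    have hj' : j ≤ m := Nat.lt_succ_iff.1 (Finset.mem_range.1 hj)
    have : (k + 1) * j ≤ (k + 1) * m := Nat.mul_le_mul_left _ hj'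
    exact ⟨hv.1, by omega⟩
  · refine sum_mem fun j hj => supp_mono (fun v hv => ?_) (hBs j)
    rw [Finset.mem_filter] at hv ⊢
    have hj' : j ≤ m := Nat.lt_succ_iff.1 (Finset.mem_range.1 hj)
    have : (k + 1) * j ≤ (k + 1) * m := Nat.mul_le_mul_left _ hj'
    exact ⟨hv.1, by omega⟩
  · have e : ⁅∑ j ∈ Finset.range (m + 1), B j, ∑ j ∈ Finset.range (m + 1), A j⁆ =
        ⁅∑ l ∈ Finset.range (m + 1), H l, ∑ j ∈ Finset.range (m + 1), A j⁆ := by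
      rw [← hABs]
      simp only [Ring.lie_def]
      noncomm_ring
    rw [e]
    exact htr

end LocalSeries

end Interaction

/-! ### Propagation through a non-resonant region -/

section GoodStep

set_option linter.unusedSectionVars false

variable {Λ : Type} [Fintype Λ] [DecidableEq Λ]
  {G : SimpleGraph Λ} {k : ℕ} {h ε : ℝ} {J : Finset Λ → ℝ}
  {W : ℕ → Finset Λ → Op Λ} {w : ℕ → ℝ}

namespace LocalSeries

variable (hW : LocalSeries G k h ε J W w)

include hW

/-- Three groups: orders up to m inside Q; terms not contained in Q, kept whole away from Q and cut
at order m where they cross its edge; and the tails beyond order m of all terms that meet Q. -/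
theorem ham_eq_truncation (hε : 0 ≤ ε) (hε1 : ε ≤ 1) {R Q : Finset Λ} (hQR : Disjoint Q R)
    (m : ℕ) :
    ham W R = ∑ l ∈ Finset.range (m + 1), ∑ S ∈ Q.powerset, W l S +
      ∑ S ∈ Finset.univ.filter (fun S => Disjoint S R), (if S ⊆ Q then 0 else
        if Disjoint S Q then term W S else ∑ l ∈ Finset.range (m + 1), W l S) +
      ∑ S ∈ Finset.univ.filter (fun S => Disjoint S R),
        (if Disjoint S Q then 0 else ∑' l, W (l + (m + 1)) S) := by
  have h0 : ∑ l ∈ Finset.range (m + 1), ∑ S ∈ Q.powerset, W l S =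
      ∑ S ∈ Finset.univ.filter (fun S => Disjoint S R),
        (if S ⊆ Q then ∑ l ∈ Finset.range (m + 1), W l S else 0) := by
    rw [Finset.sum_comm, ← Finset.sum_filter, Finset.filter_filter]
    refine Finset.sum_congr ?_ fun _ _ => rfl
    ext S
    simp only [Finset.mem_powerset, Finset.mem_filter, Finset.mem_univ, true_and]
    exact ⟨fun hS => ⟨hQR.mono_left hS, hS⟩, fun hS => hS.2⟩
  rw [h0, ham, ← Finset.sum_add_distrib, ← Finset.sum_add_distrib]
  refine Finset.sum_congr rfl fun S _ => ?_
  have h1 : term W S = ∑ l ∈ Finset.range (m + 1), W l S + ∑' l, W (l + (m + 1)) S :=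
    ((hW.summable hε hε1 S).sum_add_tsum_nat_add (m + 1)).symm
  by_cases hSQ : S ⊆ Q
  · by_cases hd : Disjoint S Q
    -- The empty set is both contained in Q and disjoint from it; it carries no term of order at
    -- least one, so its missing tail is zero.
    · have hS : S = ∅ := (Finset.disjoint_self_iff_empty S).1 (hd.mono_right hSQ)
      have h2 : ∑' l, W (l + (m + 1)) S = 0 := by
        rw [hS]
        simp [hW.empty _ (Nat.le_add_left 1 _), ← add_assoc]
      rw [if_pos hSQ, if_pos hSQ, if_pos hd, h1, h2]
      abel
    · rw [if_pos hSQ, if_pos hSQ, if_neg hd, h1]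
      abel
  · by_cases hd : Disjoint S Q
    · rw [if_neg hSQ, if_neg hSQ, if_pos hd, if_pos hd]
      abel
    · rw [if_neg hSQ, if_neg hSQ, if_neg hd, if_neg hd, h1]
      abel

/-- An operator supported near `y` is hardly reached by an operator that acts outside a
non-resonant region around `y`. -/
theorem norm_lie_heisenberg_le_of_gap (hε : 0 < ε) (hε1 : ε ≤ 1) (hh : 0 < h)
    (hconn : G.Connected) {R Rp Γ Γ₂ : Finset Λ} {y : Λ} {r m e₁ d₂ : ℕ} {g N C₁ κ : ℝ}
    (hg : 0 < g) (hgap : GapGE J (Rp \ R) g)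
    (hout : ∀ z, z ∉ Rp → r < G.dist y z) (hΓR : Γ ⊆ Rp) (hΓ : ∀ z ∈ Γ, G.dist y z ≤ e₁)
    (hΓ₂ : ∀ z ∈ Γ₂, r < G.dist y z + d₂) (hr : e₁ + (2 * k + 3) * m + 2 * k + d₂ ≤ r)
    (hN1 : 1 ≤ N) (hN : (Rp \ R).card ≤ N) (hC₁ : 1 ≤ C₁)
    (hJ₁ : ∀ v, ∑ S ∈ Finset.univ.filter (fun S => v ∈ S), ‖W 0 S‖ ≤ C₁ * h)
    (hκ : 1 + 2 * (√spacingConst / g) * N * h ≤ κ) (hϑ : 8 * N ^ 2 * C₁ * κ * ε ≤ 1)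
    {X C : Op Λ} (hX : X ∈ supp Γ) (hC : C ∈ supp (Rpᶜ ∪ Γ₂)) {τ : ℝ} (hτ : 0 ≤ τ) :
    ‖⁅X, heisenberg (ham W R) τ C⁆‖ ≤
      2 * ‖X‖ * ‖C‖ * ((1 + (h * τ) ^ 2) * (8 * N ^ 2 * C₁ * κ * ε) ^ (m + 1)) := by
  have hκ1 : 1 ≤ κ := le_trans (by
    have : 0 ≤ 2 * (√spacingConst / g) * N * h := by positivity
    linarith) hκ
  have hN2 : 1 ≤ N ^ 2 * C₁ := one_le_mul_of_one_le_of_one_le (one_le_pow₀ hN1) hC₁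
  have hεκ0 : 0 ≤ ε * κ := by positivity
  have hεκ : ε * κ ≤ 1 := by nlinarith
  set Q := Rp \ R with hQ
  have hQR : Disjoint Q R := Finset.sdiff_disjoint
  -- Chosen so that B, which stays at distance more than ρ - (k + 1) m = e₁ from y, misses Γ.
  set ρ := e₁ + (k + 1) * m with hρ
  obtain ⟨A, B, hA, hB, hAB, hAs, hBs, hcomm⟩ := hW.exists_conserved (y := y) (ρ := ρ) (m := m)
    hε hh hg hgap hN hC₁ hJ₁ hκ hεκ hconn
  set rest := ∑ S ∈ Finset.univ.filter (fun S => Disjoint S R), (if S ⊆ Q then 0 else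
        if Disjoint S Q then term W S else ∑ l ∈ Finset.range (m + 1), W l S) with hrest
  set E := ∑ S ∈ Finset.univ.filter (fun S => Disjoint S R),
        (if Disjoint S Q then 0 else ∑' l, W (l + (m + 1)) S) with hE
  have hham : ham W R = A + (B + rest) + E := by
    rw [hW.ham_eq_truncation hε.le hε1 hQR m, ← hAB, ← add_assoc]
  -- The budget of distance: (k + 1) m twice, for the inward spreading of B and the outward
  -- spreading of A, and m for the reach of the crossing terms. This is why one order of
  -- perturbation theory consumes 2k + 3 sites.
  have hexp : ρ + k + (k + 1) * m + m + k + d₂ ≤ r := by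
    rw [hρ]
    have : (2 * k + 3) * m = (k + 1) * m + (k + 1) * m + m := by ring
    omega
  -- A term of `rest` that meets Q has a vertex outside Rp, hence farther than r from y, and has
  -- diameter at most max k m; it therefore stays near the edge of the region.
  have hrest_supp : ∀ T : Finset Λ, (∀ v ∈ T, v ∉ Rp → False) →
      (∀ v ∈ T, G.dist y v + m + k ≤ r) → rest ∈ supp Tᶜ := by
    intro T hT hT'
    refine sum_mem fun S hS => ?_
    have hSR := (Finset.mem_filter.1 hS).2
    split_ifs with h1 h2
    · exact zero_mem _
    · refine supp_mono (fun v hv => ?_) (hW.term_mem_supp hε.le hε1 S)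
      rw [Finset.mem_compl]
      intro hvT
      have hvQ := Finset.disjoint_left.1 h2 hv
      rw [hQ, Finset.mem_sdiff, not_and_or, not_not] at hvQ
      exact hvQ.elim (hT v hvT) (Finset.disjoint_left.1 hSR hv)
    · refine sum_mem fun l hl => ?_
      by_cases h0 : W l S = 0
      · rw [h0]; exact zero_mem _
      refine supp_mono (fun v hv => ?_) (hW.mem_supp l S)
      rw [Finset.mem_compl]
      intro hvT
      obtain ⟨u, huS, huQ⟩ := Finset.not_subset.1 h1
      have huR := Finset.disjoint_left.1 hSR huS
      have huRp : u ∉ Rp := fun hu => huQ (Finset.mem_sdiff.2 ⟨hu, huR⟩)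
      have h3 := hout u huRp
      have h4 := hW.diam_le l S h0 v hv u huS
      have h5 := hconn.dist_triangle (u := y) (v := v) (w := u)
      have h6 := hT' v hvT
      have h7 := Finset.mem_range.1 hl
      have h8 : max k l ≤ k + l := by omega
      omega
  have hrestA : rest ∈ supp (Q.filter fun v => G.dist y v ≤ ρ + k + (k + 1) * m)ᶜ := by
    refine hrest_supp _ (fun v hv hvR => ?_) (fun v hv => ?_)
    · exact hvR (Finset.mem_sdiff.1 (Finset.mem_filter.1 hv).1).1
    · have := (Finset.mem_filter.1 hv).2
      omega
  have hrestΓ : rest ∈ supp Γᶜ := by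
    refine hrest_supp _ (fun v hv hvR => hvR (hΓR hv)) (fun v hv => ?_)
    have := hΓ v hv
    omega
  have hBΓ : B ∈ supp Γᶜ := by
    refine supp_mono (fun v hv => ?_) hBs
    have := (Finset.mem_filter.1 hv).2
    rw [Finset.mem_compl]
    intro hvΓ
    have := hΓ v hvΓ
    omega
  have hCΓ : C ∈ supp Γᶜ := by
    refine supp_mono (fun v hv => ?_) hC
    rw [Finset.mem_compl]
    intro hvΓ
    rcases Finset.mem_union.1 hv with h1 | h1
    · exact Finset.mem_compl.1 h1 (hΓR hvΓ)
    · have := hΓ₂ v h1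
      have := hΓ v hvΓ
      omega
  have hAC : ⁅A, C⁆ = 0 := by
    refine lie_eq_zero_of_mem_supp (Finset.disjoint_left.2 fun v hv hv' => ?_) hAs hC
    obtain ⟨h1, h2⟩ := Finset.mem_filter.1 hv
    rcases Finset.mem_union.1 hv' with h3 | h3
    · exact Finset.mem_compl.1 h3 (Finset.mem_sdiff.1 h1).1
    · have := hΓ₂ v h3
      omega
  have hEherm : E.IsHermitian := by
    have h1 : E = ham W R - (∑ l ∈ Finset.range (m + 1), ∑ S ∈ Q.powerset, W l S + rest) := by
      rw [hham, ← hAB]; abel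
    have hrestherm : rest.IsHermitian := by
      rw [hrest, Matrix.IsHermitian, Matrix.conjTranspose_sum]
      refine Finset.sum_congr rfl fun S _ => ?_
      split_ifs
      · exact Matrix.conjTranspose_zero
      · exact hW.term_isHermitian hε.le hε1 S
      · rw [Matrix.conjTranspose_sum]
        exact Finset.sum_congr rfl fun l _ => hW.isHermitian l S
    rw [h1, ← hAB]
    exact (hW.ham_isHermitian hε.le hε1 R).sub ((hA.add hB).add hrestherm)
  have hrestherm : rest.IsHermitian := by
    have h1 : rest = ham W R - (A + B + E) := by rw [hham]; abel
    rw [h1]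
    exact (hW.ham_isHermitian hε.le hε1 R).sub ((hA.add hB).add hEherm)
  have hEn : ‖E‖ ≤ N * (ε ^ (m + 1) * h) := by
    calc ‖E‖ ≤ ∑ S ∈ Finset.univ.filter (fun S => Disjoint S R),
          ‖if Disjoint S Q then 0 else ∑' l, W (l + (m + 1)) S‖ := norm_sum_le _ _
      _ ≤ ∑ S : Finset Λ, ‖if Disjoint S Q then 0 else ∑' l, W (l + (m + 1)) S‖ :=
          Finset.sum_le_sum_of_subset_of_nonneg (Finset.subset_univ _)
            fun _ _ _ => norm_nonneg _
      _ = ∑ S ∈ Finset.univ.filter (fun S => ¬Disjoint S Q), ‖∑' l, W (l + (m + 1)) S‖ := by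
          rw [Finset.sum_filter]
          refine Finset.sum_congr rfl fun S _ => ?_
          split_ifs <;> simp
      _ ≤ Q.card * (ε ^ (m + 1) * h) := hW.sum_norm_tail_le hε.le hε1 m Q
      _ ≤ _ := by gcongr
  have hB' : (B + rest).IsHermitian := hB.add hrestherm
  -- A may be dropped from the generator: it commutes with C and with `rest` by supports, and with B
  -- up to the truncation error.
  have hd1 : ‖heisenberg (B + rest) τ C - heisenberg (A + (B + rest)) τ C‖ ≤
      2 * N * (N * C₁ * h) * h * ((m + 1) * (ε * κ) ^ (m + 1)) * ‖C‖ * τ ^ 2 := by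
    refine norm_heisenberg_add_sub_le hA hB' hAC hτ (le_trans (le_of_eq ?_) hcomm)
    have h1 := lie_eq_zero_of_mem_supp disjoint_compl_right hAs hrestA
    congr 1
    simp only [Ring.lie_def] at h1 ⊢
    rw [add_mul, mul_add, add_sub_add_comm, ← neg_sub (A * rest), h1, neg_zero, add_zero]
  have hd2 : ‖heisenberg (A + (B + rest)) τ C - heisenberg (ham W R) τ C‖ ≤
      2 * (N * (ε ^ (m + 1) * h)) * ‖C‖ * τ := by
    have h1 := norm_heisenberg_sub_heisenberg_le (H₁ := ham W R) (H₂ := A + (B + rest)) (C := C)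
      (c₀ := 2 * (N * (ε ^ (m + 1) * h)) * ‖C‖) (c₁ := 0)
      (hW.ham_isHermitian hε.le hε1 R) hτ (fun s _ => by
        rw [hham, add_sub_cancel_left, zero_mul, add_zero]
        refine (norm_lie_le _ _).trans ?_
        rw [norm_heisenberg (hA.add hB')]
        gcongr)
    simpa using h1
  -- Without A and the tails nothing acts on Γ, so the evolution of C never reaches X.
  have hX0 : ⁅X, heisenberg (B + rest) τ C⁆ = 0 :=
    lie_eq_zero_of_mem_supp disjoint_compl_right hX
      (heisenberg_mem_supp (add_mem hBΓ hrestΓ) hCΓ τ)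
  have hfin : ‖⁅X, heisenberg (ham W R) τ C⁆‖ ≤ 2 * ‖X‖ *
      (2 * N * (N * C₁ * h) * h * ((m + 1) * (ε * κ) ^ (m + 1)) * ‖C‖ * τ ^ 2 +
        2 * (N * (ε ^ (m + 1) * h)) * ‖C‖ * τ) := by
    have e : ⁅X, heisenberg (ham W R) τ C⁆ =
        ⁅X, heisenberg (ham W R) τ C - heisenberg (B + rest) τ C⁆ := by
      rw [← sub_zero ⁅X, heisenberg (ham W R) τ C⁆, ← hX0]
      simp only [Ring.lie_def]
      noncomm_ring
    rw [e]
    refine (norm_lie_le _ _).trans (mul_le_mul_of_nonneg_left ?_ (by positivity))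
    rw [norm_sub_rev]
    calc _ ≤ ‖heisenberg (B + rest) τ C - heisenberg (A + (B + rest)) τ C‖ +
          ‖heisenberg (A + (B + rest)) τ C - heisenberg (ham W R) τ C‖ :=
          norm_sub_le_norm_sub_add_norm_sub _ _ _
      _ ≤ _ := add_le_add hd1 hd2
  refine hfin.trans ?_
  rw [mul_assoc (2 * ‖X‖)]
  refine mul_le_mul_of_nonneg_left ?_ (by positivity)
  have hx : 0 ≤ h * τ := by positivity
  -- The 8 in the final rate is 4 · 2: the factor 2^(m+1) absorbs m + 1, and 4^(m+1) absorbs the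
  -- constant 3 from the two errors.
  have hm : ((m : ℝ) + 1) ≤ 2 ^ (m + 1) := by
    have : m + 1 < 2 ^ (m + 1) := Nat.lt_two_pow_self
    exact_mod_cast this.le
  have hεp : ε ^ (m + 1) ≤ (ε * κ) ^ (m + 1) := by
    gcongr
    exact le_mul_of_one_le_right hε.le hκ1
  have h8 : 3 * (N ^ 2 * C₁) * (2 ^ (m + 1) * (ε * κ) ^ (m + 1)) ≤
      (8 * N ^ 2 * C₁ * κ * ε) ^ (m + 1) := by
    have e1 : (8 * N ^ 2 * C₁ * κ * ε) ^ (m + 1) =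
        (4 * (N ^ 2 * C₁)) ^ (m + 1) * (2 ^ (m + 1) * (ε * κ) ^ (m + 1)) := by
      rw [← mul_pow, ← mul_pow]; congr 1; ring
    rw [e1]
    gcongr
    calc 3 * (N ^ 2 * C₁) ≤ 4 * (N ^ 2 * C₁) := by linarith
      _ = (4 * (N ^ 2 * C₁)) ^ 1 := (pow_one _).symm
      _ ≤ _ := pow_le_pow_right₀ (by linarith) (by omega)
  have hNN : N ≤ N ^ 2 * C₁ := by nlinarith
  calc _ = ‖C‖ * (2 * (N ^ 2 * C₁) * (((m : ℝ) + 1) * (ε * κ) ^ (m + 1)) * (h * τ) ^ 2 +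
        N * ε ^ (m + 1) * (2 * (h * τ))) := by ring
    _ ≤ ‖C‖ * (2 * (N ^ 2 * C₁) * (2 ^ (m + 1) * (ε * κ) ^ (m + 1)) * (1 + (h * τ) ^ 2) +
        (N ^ 2 * C₁) * (2 ^ (m + 1) * (ε * κ) ^ (m + 1)) * (1 + (h * τ) ^ 2)) := by
        have h1 : 2 * (h * τ) ≤ 1 + (h * τ) ^ 2 := by nlinarith [sq_nonneg (h * τ - 1)]
        have h2 : (h * τ) ^ 2 ≤ 1 + (h * τ) ^ 2 := by linarith
        have h3 : ε ^ (m + 1) ≤ 2 ^ (m + 1) * (ε * κ) ^ (m + 1) :=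
          hεp.trans (le_mul_of_one_le_left (by positivity) (one_le_pow₀ (by norm_num)))
        gcongr
    _ = ‖C‖ * ((1 + (h * τ) ^ 2) * (3 * (N ^ 2 * C₁) * (2 ^ (m + 1) * (ε * κ) ^ (m + 1)))) := by
        ring
    _ ≤ _ := by gcongr

/-- The operators `X` supported on `Rp` feel the evolution of `A` outside `R` only through the
terms that cross the boundary of `Rp`. -/
theorem norm_lie_heisenberg_le_sum (hε : 0 ≤ ε) (hε1 : ε ≤ 1) {R Rp : Finset Λ} (hR : R ⊆ Rp)
    {X A : Op Λ} (hX : X ∈ supp Rp) (hA : A ∈ supp Rpᶜ) {ν : ℝ} (hν : 0 < ν)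
    (b κ : Finset Λ → ℝ)
    (hb : ∀ Γ, Disjoint Γ R → ¬Disjoint Γ Rp → ¬Γ ⊆ Rp → ∀ s, 0 ≤ s →
      ‖⁅term W Γ, heisenberg (ham W Rp) s A⁆‖ ≤ b Γ * Real.exp (ν * s))
    (hκ : ∀ Γ, Disjoint Γ R → ¬Disjoint Γ Rp → ¬Γ ⊆ Rp → 0 ≤ κ Γ ∧
      ∀ C ∈ supp (Rpᶜ ∪ Γ), ∀ τ, 0 ≤ τ →
        ‖⁅X, heisenberg (ham W R) τ C⁆‖ ≤ κ Γ * Real.exp (ν / 2 * τ) * ‖C‖)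
    {t : ℝ} (ht : 0 ≤ t) :
    ‖⁅X, heisenberg (ham W R) t A⁆‖ ≤
      2 / ν * (Real.exp (ν * t) - 1) * ∑ Γ ∈ Finset.univ.filter
        (fun Γ => Disjoint Γ R ∧ ¬Disjoint Γ Rp ∧ ¬Γ ⊆ Rp), κ Γ * b Γ := by
  set P := Finset.univ.filter
        (fun Γ => Disjoint Γ R ∧ ¬Disjoint Γ Rp ∧ ¬Γ ⊆ Rp) with hP
  set c := ∑ Γ ∈ P, κ Γ * b Γ with hc
  have hdiff : ham W R - ham W Rp =
      ∑ S ∈ Finset.univ.filter (fun S => Disjoint S R ∧ ¬Disjoint S Rp), term W S := by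
    have h1 : Finset.univ.filter (fun S : Finset Λ => Disjoint S Rp) =
        (Finset.univ.filter (fun S => Disjoint S R)).filter fun S => Disjoint S Rp := by
      rw [Finset.filter_filter]
      ext S
      simp only [Finset.mem_filter, Finset.mem_univ, true_and]
      exact ⟨fun h => ⟨h.mono_right hR, h⟩, fun h => h.2⟩
    rw [ham, ham, h1, ← Finset.sum_filter_add_sum_filter_not
      (Finset.univ.filter fun S => Disjoint S R) (fun S => Disjoint S Rp), add_sub_cancel_left,
      Finset.filter_filter]
  have hev : ∀ s, heisenberg (ham W Rp) s A ∈ supp Rpᶜ := fun s =>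
    heisenberg_mem_supp (hW.ham_mem_supp hε hε1 Rp) hA s
  have hlie : ∀ s, ⁅ham W R - ham W Rp, heisenberg (ham W Rp) s A⁆ =
      ∑ Γ ∈ P, ⁅term W Γ, heisenberg (ham W Rp) s A⁆ := by
    intro s
    rw [hdiff]
    have e1 : ⁅∑ S ∈ Finset.univ.filter (fun S => Disjoint S R ∧ ¬Disjoint S Rp), term W S,
        heisenberg (ham W Rp) s A⁆ =
        ∑ S ∈ Finset.univ.filter (fun S => Disjoint S R ∧ ¬Disjoint S Rp),
          ⁅term W S, heisenberg (ham W Rp) s A⁆ := by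
      simp only [Ring.lie_def, Finset.sum_mul, Finset.mul_sum, Finset.sum_sub_distrib]
    rw [e1]
    refine (Finset.sum_subset (fun S hS => ?_) fun S hS hSP => ?_).symm
    · rw [hP, Finset.mem_filter] at hS
      exact Finset.mem_filter.2 ⟨hS.1, hS.2.1, hS.2.2.1⟩
    -- Terms contained in Rp commute with the evolution of A outside Rp, so only crossing terms
    -- survive.
    · have hSR : S ⊆ Rp := by
        by_contra hcon
        obtain ⟨h1, h2, h3⟩ := Finset.mem_filter.1 hS
        exact hSP (Finset.mem_filter.2 ⟨h1, h2, h3, hcon⟩)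
      exact lie_eq_zero_of_mem_supp (disjoint_compl_right)
        (supp_mono hSR (hW.term_mem_supp hε hε1 S)) (hev s)
  have hderiv : ∀ s, HasDerivAt
      (fun s => ⁅X, heisenberg (ham W R) (t - s) (heisenberg (ham W Rp) s A)⁆)
      (⁅X, -Complex.I • heisenberg (ham W R) (t - s)
        ⁅ham W R - ham W Rp, heisenberg (ham W Rp) s A⁆⁆) s := by
    intro s
    have h1 := hasDerivAt_heisenberg_heisenberg (ham W R) (ham W Rp) A t s
    simp only [Ring.lie_def X]
    exact (h1.const_mul X).sub (h1.mul_const X)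
  -- The screening factor grows only at rate ν/2, so the product of the two growth factors still
  -- depends on s through e^{νs/2}. Integration in s then gives one factor 2/ν and the total growth
  -- e^{νt}, which keeps the rate the same along the whole path.
  have hbound : ∀ s, 0 ≤ s → s ≤ t → ‖⁅X, -Complex.I • heisenberg (ham W R) (t - s)
        ⁅ham W R - ham W Rp, heisenberg (ham W Rp) s A⁆⁆‖ ≤
      c * Real.exp (ν / 2 * t) * Real.exp (ν / 2 * s) := by
    intro s hs hst
    have e1 : ⁅X, -Complex.I • heisenberg (ham W R) (t - s)
        ⁅ham W R - ham W Rp, heisenberg (ham W Rp) s A⁆⁆ =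
        -Complex.I • ∑ Γ ∈ P, ⁅X, heisenberg (ham W R) (t - s)
          ⁅term W Γ, heisenberg (ham W Rp) s A⁆⁆ := by
      rw [hlie s]
      simp only [Ring.lie_def X, mul_smul_comm, smul_mul_assoc, ← smul_sub,
        Finset.sum_sub_distrib, ← Finset.mul_sum, ← Finset.sum_mul]
      have : heisenberg (ham W R) (t - s) (∑ Γ ∈ P, ⁅term W Γ, heisenberg (ham W Rp) s A⁆) =
          ∑ Γ ∈ P, heisenberg (ham W R) (t - s) ⁅term W Γ, heisenberg (ham W Rp) s A⁆ := by
        simp only [heisenberg, Finset.mul_sum, Finset.sum_mul]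
      rw [this]
    rw [e1, norm_smul, norm_neg, Complex.norm_I, one_mul]
    calc _ ≤ ∑ Γ ∈ P, ‖⁅X, heisenberg (ham W R) (t - s)
          ⁅term W Γ, heisenberg (ham W Rp) s A⁆⁆‖ := norm_sum_le _ _
      _ ≤ ∑ Γ ∈ P, κ Γ * b Γ * (Real.exp (ν / 2 * t) * Real.exp (ν / 2 * s)) := by
          refine Finset.sum_le_sum fun Γ hΓ => ?_
          obtain ⟨_, h1, h2, h3⟩ := Finset.mem_filter.1 hΓ
          obtain ⟨hκ0, hκ1⟩ := hκ Γ h1 h2 h3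
          have hmem : ⁅term W Γ, heisenberg (ham W Rp) s A⁆ ∈ supp (Rpᶜ ∪ Γ) :=
            lie_mem_supp (supp_mono Finset.subset_union_right (hW.term_mem_supp hε hε1 Γ))
              (supp_mono Finset.subset_union_left (hev s))
          refine (hκ1 _ hmem _ (sub_nonneg.2 hst)).trans ?_
          calc _ ≤ κ Γ * Real.exp (ν / 2 * (t - s)) * (b Γ * Real.exp (ν * s)) := by
                have := hb Γ h1 h2 h3 s hs
                gcongr
            _ = κ Γ * b Γ * (Real.exp (ν / 2 * (t - s)) * Real.exp (ν * s)) := by ring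
            _ = _ := by rw [← Real.exp_add, ← Real.exp_add]; congr 2; ring
      _ = _ := by rw [← Finset.sum_mul, mul_assoc]
  -- The signs of the bounds `b` are not assumed; positivity of the sum follows from the norm
  -- estimate at s = 0.
  have hc0 : 0 ≤ c := by
    have h1 := (norm_nonneg _).trans (hbound 0 le_rfl ht)
    by_contra hneg
    push Not at hneg
    nlinarith [mul_pos (Real.exp_pos (ν / 2 * t)) (Real.exp_pos (ν / 2 * 0))]
  have hmain := norm_sub_le_of_norm_deriv_le_exp ht (half_pos hν) hderiv hbound
  have h0 : ⁅X, heisenberg (ham W Rp) t A⁆ = 0 :=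
    lie_eq_zero_of_mem_supp disjoint_compl_right hX (hev t)
  simp only [sub_self, heisenberg_zero, h0, zero_sub, norm_neg, sub_zero] at hmain
  refine hmain.trans ?_
  have hE : Real.exp (ν * t) = Real.exp (ν / 2 * t) * Real.exp (ν / 2 * t) := by
    rw [← Real.exp_add]; congr 1; ring
  have h1 : 1 ≤ Real.exp (ν / 2 * t) := Real.one_le_exp (by positivity)
  rw [hE]
  have e : c * Real.exp (ν / 2 * t) / (ν / 2) * (Real.exp (ν / 2 * t) - 1) =
      2 / ν * c * (Real.exp (ν / 2 * t) * Real.exp (ν / 2 * t) - Real.exp (ν / 2 * t)) := by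
    field_simp
  have e2 : 2 / ν * (Real.exp (ν / 2 * t) * Real.exp (ν / 2 * t) - 1) * c =
      2 / ν * c * (Real.exp (ν / 2 * t) * Real.exp (ν / 2 * t) - 1) := by ring
  rw [e, e2]
  refine mul_le_mul_of_nonneg_left (by linarith) (by positivity)

end LocalSeries

end GoodStep

/-! ### Diameters, crossings and weighted sums -/

section Diameter

variable {Λ : Type}

/-- The diameter of a finite set in the graph distance. -/
def setDiam (G : SimpleGraph Λ) (Γ : Finset Λ) : ℕ := Γ.sup fun x => Γ.sup fun y => G.dist x y

variable {G : SimpleGraph Λ}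

theorem dist_le_setDiam {Γ : Finset Λ} {x y : Λ} (hx : x ∈ Γ) (hy : y ∈ Γ) :
    G.dist x y ≤ setDiam G Γ :=
  (Finset.le_sup (f := fun y => G.dist x y) hy).trans
    (Finset.le_sup (f := fun x => Γ.sup fun y => G.dist x y) hx)

theorem DiamLE.setDiam_le [Fintype Λ] {Γ : Finset Λ} {r : ℕ} (h : DiamLE G Γ r) : setDiam G Γ ≤ r :=
  Finset.sup_le fun x hx => Finset.sup_le fun y hy => h x hx y hy

/-- A shortest path from a point of `R` to a point outside `R` leaves `R` through an edge. -/
theorem exists_adj_crossing (hconn : G.Connected) {R : Finset Λ} {p z : Λ} (hp : p ∈ R)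
    (hz : z ∉ R) :
    ∃ x ∈ R, ∃ y, y ∉ R ∧ G.Adj x y ∧ G.dist p x + 1 + G.dist y z ≤ G.dist p z := by
  obtain ⟨w, hw⟩ := (hconn p z).exists_walk_length_eq_dist
  rw [← hw]
  clear hw
  induction w with
  | nil => exact absurd hp hz
  | @cons u v z' huv w ih =>
    rw [SimpleGraph.Walk.length_cons]
    by_cases hv : v ∈ R
    · obtain ⟨x, hx, y, hy, hxy, hd⟩ := ih hv hz
      refine ⟨x, hx, y, hy, hxy, ?_⟩
      have h1 := hconn.dist_triangle (u := u) (v := v) (w := x)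
      rw [SimpleGraph.dist_eq_one_iff_adj.2 huv] at h1
      omega
    · refine ⟨u, hp, v, hv, huv, ?_⟩
      have := SimpleGraph.dist_le w
      rw [SimpleGraph.dist_self]
      omega

theorem mem_boundary [Fintype Λ] {S : Finset Λ} {x : Λ} :
    x ∈ boundary G S ↔ x ∈ S ∧ ∃ y, y ∉ S ∧ G.Adj x y := by
  classical
  simp [boundary]

/-- A shortest path from p to z leaves R through an edge xy. The constant 3/2 in the last estimate
comes from averaging two routes from x to u, through p and through z: their lengths sum to at most
three diameters. It lets x be the starting vertex of a path although x need not lie in Γ. -/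
theorem exists_crossing [Fintype Λ] [DecidableEq Λ] (hconn : G.Connected) {R Γ : Finset Λ}
    {p z : Λ} (hp : p ∈ R) (hpΓ : p ∈ Γ) (hz : z ∉ R) (hzΓ : z ∈ Γ) :
    ∃ x ∈ boundary G R, ∃ y ∈ boundary G Rᶜ, G.Adj x y ∧ G.dist p x + 1 ≤ setDiam G Γ ∧
      (∀ u ∈ Γ, G.dist y u + 1 ≤ 2 * setDiam G Γ) ∧
      ∀ u ∈ Γ, 2 * G.dist x u ≤ 3 * setDiam G Γ := by
  obtain ⟨x, hx, y, hy, hxy, hd⟩ := exists_adj_crossing hconn hp hz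
  have hpz : G.dist p z ≤ setDiam G Γ := dist_le_setDiam hpΓ hzΓ
  refine ⟨x, mem_boundary.2 ⟨hx, y, hy, hxy⟩, y,
    mem_boundary.2 ⟨Finset.mem_compl.2 hy, x, by simpa using hx, hxy.symm⟩, hxy, by omega,
    fun u hu => ?_, fun u hu => ?_⟩
  · have h1 := hconn.dist_triangle (u := y) (v := z) (w := u)
    have h2 : G.dist z u ≤ setDiam G Γ := dist_le_setDiam hzΓ hu
    omega
  · have h1 := hconn.dist_triangle (u := x) (v := p) (w := u)
    have h2 : G.dist p u ≤ setDiam G Γ := dist_le_setDiam hpΓ hu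
    have h3 := hconn.dist_triangle (u := x) (v := z) (w := u)
    have h4 : G.dist z u ≤ setDiam G Γ := dist_le_setDiam hzΓ hu
    have h5 := hconn.dist_triangle (u := x) (v := y) (w := z)
    rw [SimpleGraph.dist_eq_one_iff_adj.2 hxy] at h5
    rw [SimpleGraph.dist_comm] at h1
    have h6 := SimpleGraph.dist_comm (G := G) (u := x) (v := p)
    have h7 := SimpleGraph.dist_comm (G := G) (u := x) (v := u)
    omega

theorem card_le_of_isDimensional [Fintype Λ] {d : ℕ} {M : ℝ}
    (hdim : IsDimensional G d M) (x : Λ) (r : ℕ) :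
    ((ball G x r).card : ℝ) ≤ M * (max r 1 : ℕ) ^ d := by
  have h1 : ball G x r ⊆ ball G x (max r 1) := fun y hy => by
    rw [ball, Finset.mem_filter] at hy ⊢
    exact ⟨hy.1, hy.2.trans (le_max_left _ _)⟩
  exact (Nat.cast_le.2 (Finset.card_le_card h1)).trans (hdim x _ (le_max_right _ _))

theorem subset_ball_setDiam [Fintype Λ] {Γ : Finset Λ} {x : Λ} (hx : x ∈ Γ) :
    Γ ⊆ ball G x (setDiam G Γ) := fun y hy =>
  Finset.mem_filter.2 ⟨Finset.mem_univ y, dist_le_setDiam hx hy⟩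

/-- The lattice sum bounding `∑_v 2 ^ {-d(x, v)}` in dimension `d`. -/
def latticeSum (d : ℕ) (M : ℝ) : ℝ := ∑' r : ℕ, M * ((r : ℝ) + 1) ^ d * (1 / 2 : ℝ) ^ r

theorem summable_latticeSum (d : ℕ) (M : ℝ) :
    Summable fun r : ℕ => M * ((r : ℝ) + 1) ^ d * (1 / 2 : ℝ) ^ r := by
  have h1 := summable_pow_mul_geometric_of_norm_lt_one (R := ℝ) d (r := 1 / 2) (by norm_num)
  have h2 := ((summable_nat_add_iff 1).2 h1).mul_left (M * 2)
  refine h2.congr fun r => ?_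
  rw [pow_succ]
  push_cast
  ring

theorem sum_half_pow_dist_le [Fintype Λ] {d : ℕ} {M : ℝ} (hM : 1 ≤ M)
    (hdim : IsDimensional G d M) (x : Λ) :
    ∑ v : Λ, (1 / 2 : ℝ) ^ G.dist x v ≤ latticeSum d M := by
  classical
  set n := (Finset.univ.sup fun v => G.dist x v) + 1 with hn
  have hlt : ∀ v, G.dist x v < n := fun v =>
    Nat.lt_succ_of_le (Finset.le_sup (f := fun v => G.dist x v) (Finset.mem_univ v))
  calc _ = ∑ r ∈ Finset.range n, ∑ v ∈ Finset.univ.filter (fun v => G.dist x v = r),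
        (1 / 2 : ℝ) ^ G.dist x v :=
        (Finset.sum_fiberwise_of_maps_to (fun v _ => Finset.mem_range.2 (hlt v)) _).symm
    _ ≤ ∑ r ∈ Finset.range n, M * ((r : ℝ) + 1) ^ d * (1 / 2 : ℝ) ^ r := by
        refine Finset.sum_le_sum fun r _ => ?_
        rw [Finset.sum_congr rfl fun v hv => by rw [(Finset.mem_filter.1 hv).2],
          Finset.sum_const, nsmul_eq_mul]
        refine mul_le_mul_of_nonneg_right ?_ (by positivity)
        have h1 : (Finset.univ.filter fun v => G.dist x v = r) ⊆ ball G x r := fun v hv => by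
          rw [Finset.mem_filter] at hv
          exact Finset.mem_filter.2 ⟨hv.1, hv.2.le⟩
        refine (Nat.cast_le.2 (Finset.card_le_card h1)).trans
          ((card_le_of_isDimensional hdim x r).trans ?_)
        gcongr
        push_cast
        exact max_le (by linarith) (by have : (0 : ℝ) ≤ r := by positivity
                                       linarith)
    _ ≤ _ := (summable_latticeSum d M).sum_le_tsum _ fun r _ => by positivity

end Diameter

/-! ### Local norms of the interaction, weighted exponentially in the diameter -/

section Weights

set_option linter.unusedSectionVars false

variable {Λ : Type} [Fintype Λ] [DecidableEq Λ] {G : SimpleGraph Λ} {k : ℕ} {h ε : ℝ}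
  {J : Finset Λ → ℝ} {W : ℕ → Finset Λ → Op Λ} {w : ℕ → ℝ}

/-- The local norm of the interaction, weighted by `q ^ {-4 (diam - k)}`. -/
def WeightLE (G : SimpleGraph Λ) (W : ℕ → Finset Λ → Op Λ) (k : ℕ) (q c : ℝ) : Prop :=
  ∀ v, ∑ Γ ∈ Finset.univ.filter (fun Γ => v ∈ Γ),
    ‖term W Γ‖ * (q⁻¹) ^ (4 * (setDiam G Γ - k)) ≤ c

/-- The number of sets of diameter at most `k` containing a given vertex is at most this. -/
def localConst (d k : ℕ) (M : ℝ) : ℝ := 2 ^ (M * (max k 1 : ℕ) ^ d) + 1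

theorem one_le_localConst (d k : ℕ) (M : ℝ) : 1 ≤ localConst d k M := by
  have : (0 : ℝ) < 2 ^ (M * (max k 1 : ℕ) ^ d) := Real.rpow_pos_of_pos two_pos _
  rw [localConst]
  linarith

namespace LocalSeries

variable (hW : LocalSeries G k h ε J W w)

include hW

theorem sum_zero_le {d : ℕ} {M : ℝ} (hdim : IsDimensional G d M) (v : Λ) :
    ∑ S ∈ Finset.univ.filter (fun S => v ∈ S), ‖W 0 S‖ ≤ 2 ^ (M * (max k 1 : ℕ) ^ d) * h := by
  have hh := hW.h_nonneg
  have hle : ∀ S, ‖W 0 S‖ ≤ |J S| := fun S => by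
    rw [hW.zero, norm_smul, Complex.norm_real, Real.norm_eq_abs]
    exact mul_le_of_le_one_right (abs_nonneg _) (norm_pauliZ_le S)
  calc _ ≤ ∑ S ∈ (ball G v k).powerset, ‖W 0 S‖ := by
        rw [← Finset.sum_filter_ne_zero]
        refine Finset.sum_le_sum_of_subset_of_nonneg (fun S hS => ?_) fun _ _ _ => norm_nonneg _
        simp only [Finset.mem_filter, Finset.mem_univ, true_and] at hS
        have hJ : J S ≠ 0 := fun h0 => hS.2 (le_antisymm ((hle S).trans (by simp [h0]))
          (norm_nonneg _))
        rw [Finset.mem_powerset]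
        intro u hu
        exact Finset.mem_filter.2 ⟨Finset.mem_univ u, hW.diam_zero S hJ v hS.1 u hu⟩
    _ ≤ ∑ S ∈ (ball G v k).powerset, h :=
        Finset.sum_le_sum fun S _ => (hle S).trans (hW.abs_le S)
    _ = 2 ^ ((ball G v k).card : ℝ) * h := by
        rw [Finset.sum_const, Finset.card_powerset, nsmul_eq_mul, Real.rpow_natCast]
        push_cast
        rfl
    _ ≤ _ := by
        refine mul_le_mul_of_nonneg_right ?_ hh
        exact Real.rpow_le_rpow_of_exponent_le one_le_two (card_le_of_isDimensional hdim v k)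

/-- A term of order l ≥ 1 has diameter at most l and norm of order ε^l, so ε ≤ q⁴ pays for the
weight q^{-4l}. Order zero has diameter at most k and hence weight one. -/
theorem weightLE (hε : 0 < ε) (hε1 : ε ≤ 1) {d : ℕ} {M : ℝ}
    (hdim : IsDimensional G d M) {q : ℝ} (hq : 0 < q) (hq1 : q ≤ 1) (hεq : ε ≤ q ^ 4) :
    WeightLE G W k q (localConst d k M * h) := by
  intro v
  have hqi : 1 ≤ q⁻¹ := (one_le_inv₀ hq).2 hq1
  set F := Finset.univ.filter (fun Γ : Finset Λ => v ∈ Γ) with hF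
  set c : Finset Λ → ℝ := fun Γ => (q⁻¹) ^ (4 * (setDiam G Γ - k)) with hc
  have hc0 : ∀ Γ, 0 ≤ c Γ := fun Γ => by positivity
  have h0 : ∀ Γ, ‖W 0 Γ‖ * c Γ ≤ ‖W 0 Γ‖ := fun Γ => by
    by_cases hJ : J Γ = 0
    · rw [hW.zero, hJ]
      simp
    · have : setDiam G Γ - k = 0 := Nat.sub_eq_zero_of_le (hW.diam_zero Γ hJ).setDiam_le
      simp [hc, this]
  have h1 : ∀ l Γ, ‖W (l + 1) Γ‖ * c Γ ≤ ‖W (l + 1) Γ‖ * (q⁻¹) ^ (4 * (l + 1)) := fun l Γ => by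
    by_cases hz : W (l + 1) Γ = 0
    · rw [hz]
      simp
    · have := (hW.diam (l + 1) (by omega) Γ hz).setDiam_le
      refine mul_le_mul_of_nonneg_left ?_ (norm_nonneg _)
      exact pow_le_pow_right₀ hqi (by omega)
  have h2 : ∀ l, ∑ Γ ∈ F, ‖W (l + 1) Γ‖ * c Γ ≤ w (l + 1) := fun l => by
    refine (Finset.sum_le_sum fun Γ _ => h1 l Γ).trans ?_
    rw [← Finset.sum_mul]
    refine (mul_le_mul_of_nonneg_right (hW.norm_le (l + 1) (by omega) v) (by positivity)).trans ?_
    have h3 : ε ^ (l + 1) * (q⁻¹) ^ (4 * (l + 1)) ≤ 1 := by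
      rw [pow_mul, ← mul_pow]
      refine pow_le_one₀ (by positivity) ?_
      rw [inv_pow, ← div_eq_mul_inv]
      exact div_le_one_of_le₀ hεq (by positivity)
    calc ε ^ (l + 1) * w (l + 1) * (q⁻¹) ^ (4 * (l + 1))
        = ε ^ (l + 1) * (q⁻¹) ^ (4 * (l + 1)) * w (l + 1) := by ring
      _ ≤ w (l + 1) := mul_le_of_le_one_left (hW.w_nonneg _) h3
  have hs : ∀ Γ, Summable fun l => ‖W l Γ‖ * c Γ := fun Γ =>
    (hW.summable_norm hε.le hε1 Γ).mul_right _
  calc ∑ Γ ∈ F, ‖term W Γ‖ * c Γ ≤ ∑ Γ ∈ F, ∑' l, ‖W l Γ‖ * c Γ := by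
        refine Finset.sum_le_sum fun Γ _ => ?_
        rw [tsum_mul_right]
        exact mul_le_mul_of_nonneg_right
          (norm_tsum_le_tsum_norm (hW.summable_norm hε.le hε1 Γ)) (hc0 Γ)
    _ = ∑' l, ∑ Γ ∈ F, ‖W l Γ‖ * c Γ := (Summable.tsum_finsetSum fun Γ _ => hs Γ).symm
    _ = ∑ Γ ∈ F, ‖W 0 Γ‖ * c Γ + ∑' l, ∑ Γ ∈ F, ‖W (l + 1) Γ‖ * c Γ :=
        (summable_sum fun Γ _ => hs Γ).tsum_eq_zero_add
    _ ≤ 2 ^ (M * (max k 1 : ℕ) ^ d) * h + h := by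
        refine add_le_add ((Finset.sum_le_sum fun Γ _ => h0 Γ).trans
          (hW.sum_zero_le hdim v)) ?_
        refine (Summable.tsum_le_tsum h2
          ((summable_nat_add_iff (f := fun l => ∑ Γ ∈ F, ‖W l Γ‖ * c Γ) 1).2
            (summable_sum fun Γ _ => hs Γ))
          ((summable_nat_add_iff 1).2 hW.w_summable)).trans ?_
        refine le_trans ?_ hW.w_le
        rw [hW.w_summable.tsum_eq_zero_add]
        exact le_add_of_nonneg_left (hW.w_nonneg 0)
    _ = _ := by rw [localConst]; ring

end LocalSeries

theorem sum_biUnion_le {ι κ : Type*} [DecidableEq κ] {f : κ → ℝ} (hf : ∀ i, 0 ≤ f i)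
    (s : Finset ι) (t : ι → Finset κ) :
    ∑ i ∈ s.biUnion t, f i ≤ ∑ x ∈ s, ∑ i ∈ t x, f i := by
  classical
  induction s using Finset.induction_on with
  | empty => simp
  | insert a s ha ih =>
    rw [Finset.biUnion_insert, Finset.sum_insert ha]
    refine le_trans ?_ (add_le_add_right ih _)
    rw [← Finset.sum_union_inter]
    exact le_add_of_nonneg_right (Finset.sum_nonneg fun i _ => hf i)

/-- The sum over the terms that come close to the vertex `x` relative to their diameter. -/
theorem sum_near_le {d : ℕ} {M : ℝ} (hM : 1 ≤ M) (hdim : IsDimensional G d M) {q c : ℝ}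
    (hq : 0 < q) (hq2 : q ≤ 1 / 2) (hw : WeightLE G W k q c) (hc : 0 ≤ c) (x : Λ) :
    ∑ Γ ∈ Finset.univ.filter (fun Γ => ∃ v ∈ Γ, G.dist x v ≤ setDiam G Γ),
      ‖term W Γ‖ * (q⁻¹) ^ (3 * (setDiam G Γ - k)) ≤ 2 ^ k * latticeSum d M * c := by
  have hqi : 2 ≤ q⁻¹ := by
    rw [le_inv_comm₀ two_pos hq]
    simpa using hq2
  set f : Finset Λ → ℝ := fun Γ => ‖term W Γ‖ * (q⁻¹) ^ (3 * (setDiam G Γ - k)) with hf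
  have hf0 : ∀ Γ, 0 ≤ f Γ := fun Γ => by positivity
  calc _ ≤ ∑ Γ : Finset Λ, ∑ v : Λ, if v ∈ Γ ∧ G.dist x v ≤ setDiam G Γ then f Γ else 0 := by
        refine (Finset.sum_le_sum fun Γ hΓ => ?_).trans
          (Finset.sum_le_sum_of_subset_of_nonneg (Finset.subset_univ _) fun S _ _ => ?_)
        · obtain ⟨v, hv⟩ := (Finset.mem_filter.1 hΓ).2
          refine le_trans ?_ (Finset.single_le_sum
            (f := fun v => if v ∈ Γ ∧ G.dist x v ≤ setDiam G Γ then f Γ else 0)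
            (fun v _ => ?_) (Finset.mem_univ v))
          · rw [if_pos hv]
          · split_ifs
            exacts [hf0 Γ, le_rfl]
        · refine Finset.sum_nonneg fun v _ => ?_
          split_ifs
          exacts [hf0 S, le_rfl]
    _ = ∑ v : Λ, ∑ Γ ∈ Finset.univ.filter (fun Γ => v ∈ Γ),
          if G.dist x v ≤ setDiam G Γ then f Γ else 0 := by
        rw [Finset.sum_comm]
        refine Finset.sum_congr rfl fun v _ => ?_
        rw [Finset.sum_filter]
        refine Finset.sum_congr rfl fun Γ _ => ?_
        split_ifs <;> tauto
    _ ≤ ∑ v : Λ, 2 ^ k * (1 / 2 : ℝ) ^ G.dist x v * c := by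
        refine Finset.sum_le_sum fun v _ => ?_
        refine le_trans ?_ (mul_le_mul_of_nonneg_left (hw v) (by positivity))
        rw [Finset.mul_sum]
        refine Finset.sum_le_sum fun Γ _ => ?_
        split_ifs with hd
        -- One of the four powers of the weight is spent on 2^{-d(x,v)}, which makes the sum over v
        -- converge; three are kept for the path estimate.
        · have h1 : (1 : ℝ) ≤ 2 ^ k * (1 / 2 : ℝ) ^ G.dist x v * (q⁻¹) ^ (setDiam G Γ - k) := by
            have h2 : (2 : ℝ) ^ (setDiam G Γ - k) ≤ (q⁻¹) ^ (setDiam G Γ - k) :=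
              pow_le_pow_left₀ (by norm_num) hqi _
            have h3 : (2 : ℝ) ^ G.dist x v ≤ 2 ^ k * 2 ^ (setDiam G Γ - k) := by
              rw [← pow_add]
              exact pow_le_pow_right₀ (by norm_num) (by omega)
            rw [one_div, inv_pow]
            calc (1 : ℝ) = 2 ^ G.dist x v * (2 ^ G.dist x v)⁻¹ := by field_simp
              _ ≤ 2 ^ k * (q⁻¹) ^ (setDiam G Γ - k) * (2 ^ G.dist x v)⁻¹ := by
                  refine mul_le_mul_of_nonneg_right (h3.trans ?_) (by positivity)
                  exact mul_le_mul_of_nonneg_left h2 (by positivity)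
              _ = _ := by ring
          have e : 4 * (setDiam G Γ - k) = 3 * (setDiam G Γ - k) + (setDiam G Γ - k) := by ring
          rw [e, pow_add]
          calc f Γ ≤ f Γ * (2 ^ k * (1 / 2 : ℝ) ^ G.dist x v * (q⁻¹) ^ (setDiam G Γ - k)) :=
                le_mul_of_one_le_right (hf0 Γ) h1
            _ = _ := by rw [hf]; ring
        · positivity
    _ = 2 ^ k * (∑ v : Λ, (1 / 2 : ℝ) ^ G.dist x v) * c := by
        rw [Finset.mul_sum, Finset.sum_mul]
    _ ≤ _ := by
        have := sum_half_pow_dist_le hM hdim x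
        gcongr

/-- The sum over all the terms that cross the boundary of `S`. -/
theorem sum_crossing_le (hconn : G.Connected) {d : ℕ} {M : ℝ} (hM : 1 ≤ M)
    (hdim : IsDimensional G d M) {q c : ℝ} (hq : 0 < q) (hq2 : q ≤ 1 / 2)
    (hw : WeightLE G W k q c) (hc : 0 ≤ c) (S : Finset Λ) :
    ∑ Γ ∈ Finset.univ.filter (fun Γ => ¬Disjoint Γ S ∧ ¬Γ ⊆ S),
      ‖term W Γ‖ * (q⁻¹) ^ (3 * (setDiam G Γ - k)) ≤
        (boundary G S).card * (2 ^ k * latticeSum d M * c) := by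
  set f : Finset Λ → ℝ := fun Γ => ‖term W Γ‖ * (q⁻¹) ^ (3 * (setDiam G Γ - k)) with hf
  have hf0 : ∀ Γ, 0 ≤ f Γ := fun Γ => by positivity
  calc _ ≤ ∑ Γ ∈ (boundary G S).biUnion fun x =>
          Finset.univ.filter (fun Γ => ∃ v ∈ Γ, G.dist x v ≤ setDiam G Γ), f Γ := by
        refine Finset.sum_le_sum_of_subset_of_nonneg (fun Γ hΓ => ?_) fun Γ _ _ => hf0 Γ
        obtain ⟨_, h1, h2⟩ := Finset.mem_filter.1 hΓ
        obtain ⟨p, hpΓ, hp⟩ := Finset.not_disjoint_iff.1 h1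
        obtain ⟨z, hzΓ, hz⟩ := Finset.not_subset.1 h2
        obtain ⟨x, hx, y, -, -, hd, -⟩ := exists_crossing hconn hp hpΓ hz hzΓ
        rw [Finset.mem_biUnion]
        refine ⟨x, hx, Finset.mem_filter.2 ⟨Finset.mem_univ _, p, hpΓ, ?_⟩⟩
        rw [SimpleGraph.dist_comm]
        omega
    _ ≤ ∑ x ∈ boundary G S, ∑ Γ ∈
          Finset.univ.filter (fun Γ => ∃ v ∈ Γ, G.dist x v ≤ setDiam G Γ), f Γ :=
        sum_biUnion_le hf0 _ _
    _ ≤ ∑ x ∈ boundary G S, 2 ^ k * latticeSum d M * c :=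
        Finset.sum_le_sum fun x _ => sum_near_le hM hdim hq hq2 hw hc x
    _ = _ := by rw [Finset.sum_const, nsmul_eq_mul]

end Weights

/-! ### One step of the expansion -/

section Steps

set_option linter.unusedSectionVars false

variable {Λ : Type} [Fintype Λ] [DecidableEq Λ] {G : SimpleGraph Λ} {k : ℕ} {h ε : ℝ}
  {J : Finset Λ → ℝ} {W : ℕ → Finset Λ → Op Λ} {w : ℕ → ℝ}

namespace LocalSeries

variable (hW : LocalSeries G k h ε J W w)

include hW

theorem norm_lie_heisenberg_le_trivial (hε : 0 ≤ ε) (hε1 : ε ≤ 1) (R : Finset Λ) (X C : Op Λ)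
    (t : ℝ) : ‖⁅X, heisenberg (ham W R) t C⁆‖ ≤ 2 * ‖X‖ * ‖C‖ := by
  refine (norm_lie_le _ _).trans_eq ?_
  rw [norm_heisenberg (hW.ham_isHermitian hε hε1 R)]

/-- The contribution of the terms crossing the boundary of the support of `B`. -/
theorem norm_lie_heisenberg_le_boundary (hε : 0 ≤ ε) (hε1 : ε ≤ 1) (hconn : G.Connected)
    {d : ℕ} {M : ℝ} (hM : 1 ≤ M) (hdim : IsDimensional G d M) {q c : ℝ} (hq : 0 < q)
    (hq2 : q ≤ 1 / 2) (hw : WeightLE G W k q c) (hc : 0 ≤ c) {S₀ : Finset Λ} {A B : Op Λ}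
    (hB : B ∈ supp S₀) (hA : A ∈ supp S₀ᶜ) {ν K : ℝ} (hν : 0 < ν) (hK : 0 ≤ K)
    (hb : ∀ Γ, ¬Disjoint Γ S₀ → ¬Γ ⊆ S₀ → ∀ s, 0 ≤ s →
      ‖⁅term W Γ, heisenberg (ham W S₀) s A⁆‖ ≤
        ‖term W Γ‖ * (q⁻¹) ^ (3 * (setDiam G Γ - k)) * K * Real.exp (ν * s))
    {t : ℝ} (ht : 0 ≤ t) :
    ‖⁅B, heisenberg (ham W ∅) t A⁆‖ ≤
      4 * (2 ^ k * latticeSum d M * c) / ν * ‖B‖ * (boundary G S₀).card * K *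
        (Real.exp (ν * t) - 1) := by
  have h1 := hW.norm_lie_heisenberg_le_sum (R := ∅) (Rp := S₀) (X := B) (A := A) (ν := ν)
    (b := fun Γ => ‖term W Γ‖ * (q⁻¹) ^ (3 * (setDiam G Γ - k)) * K) (κ := fun _ => 2 * ‖B‖)
    hε hε1 (Finset.empty_subset _) hB hA hν
    (fun Γ _ h1 h2 s hs => hb Γ h1 h2 s hs)
    (fun Γ _ h1 h2 => ⟨by positivity, fun C _ τ hτ => by
      refine (hW.norm_lie_heisenberg_le_trivial hε hε1 ∅ B C τ).trans ?_
      refine mul_le_mul_of_nonneg_right ?_ (norm_nonneg _)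
      exact le_mul_of_one_le_right (by positivity) (Real.one_le_exp (by positivity))⟩) ht
  refine h1.trans ?_
  have he : 0 ≤ Real.exp (ν * t) - 1 := sub_nonneg.2 (Real.one_le_exp (by positivity))
  have h2 : ∑ Γ ∈ Finset.univ.filter
        (fun Γ : Finset Λ => Disjoint Γ ∅ ∧ ¬Disjoint Γ S₀ ∧ ¬Γ ⊆ S₀),
        2 * ‖B‖ * (‖term W Γ‖ * (q⁻¹) ^ (3 * (setDiam G Γ - k)) * K) ≤
      2 * ‖B‖ * ((boundary G S₀).card * (2 ^ k * latticeSum d M * c)) * K := by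
    simp only [Finset.disjoint_empty_right, true_and]
    rw [← Finset.mul_sum, ← Finset.sum_mul, ← mul_assoc]
    gcongr
    exact sum_crossing_le hconn hM hdim hq hq2 hw hc S₀
  refine (mul_le_mul_of_nonneg_left h2 (by positivity)).trans_eq ?_
  field_simp
  ring

/-- One step through `Rp ∖ R`, given that the operators far away are screened by `L`. -/
theorem norm_lie_heisenberg_le_step (hε : 0 ≤ ε) (hε1 : ε ≤ 1) {q c : ℝ} (hq : 0 < q)
    (hq1 : q ≤ 1) (hw : WeightLE G W k q c) (hc : 0 ≤ c) {R Rp : Finset Λ} (hR : R ⊆ Rp)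
    {N : ℝ} (hN : (Rp \ R).card ≤ N) {X A : Op Λ} (hX : X ∈ supp Rp) (hA : A ∈ supp Rpᶜ)
    {ν K L : ℝ} (hν : 0 < ν) (hK : 0 ≤ K) (hL : 0 ≤ L)
    (hb : ∀ Γ, Disjoint Γ R → ¬Disjoint Γ Rp → ¬Γ ⊆ Rp → ∀ s, 0 ≤ s →
      ‖⁅term W Γ, heisenberg (ham W Rp) s A⁆‖ ≤
        ‖term W Γ‖ * (q⁻¹) ^ (3 * (setDiam G Γ - k)) * K * Real.exp (ν * s))
    (hκ : ∀ Γ, ¬Γ ⊆ Rp → ∀ C ∈ supp (Rpᶜ ∪ Γ), ∀ τ, 0 ≤ τ →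
      ‖⁅X, heisenberg (ham W R) τ C⁆‖ ≤
        2 * ‖X‖ * L * (q⁻¹) ^ setDiam G Γ * Real.exp (ν / 2 * τ) * ‖C‖)
    {t : ℝ} (ht : 0 ≤ t) :
    ‖⁅X, heisenberg (ham W R) t A⁆‖ ≤
      4 * N * c / ν * (q⁻¹) ^ k * L * ‖X‖ * K * Real.exp (ν * t) := by
  have hqi : 1 ≤ q⁻¹ := (one_le_inv₀ hq).2 hq1
  have h1 := hW.norm_lie_heisenberg_le_sum (X := X) (A := A) (ν := ν)
    (b := fun Γ => ‖term W Γ‖ * (q⁻¹) ^ (3 * (setDiam G Γ - k)) * K)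
    (κ := fun Γ => 2 * ‖X‖ * L * (q⁻¹) ^ setDiam G Γ)
    hε hε1 hR hX hA hν hb
    (fun Γ _ h1 h2 => ⟨by positivity, fun C hC τ hτ => hκ Γ h2 C hC τ hτ⟩) ht
  refine h1.trans ?_
  have hN0 : 0 ≤ N := le_trans (by positivity) hN
  have h2 : ∑ Γ ∈ Finset.univ.filter (fun Γ => Disjoint Γ R ∧ ¬Disjoint Γ Rp ∧ ¬Γ ⊆ Rp),
        2 * ‖X‖ * L * (q⁻¹) ^ setDiam G Γ *
          (‖term W Γ‖ * (q⁻¹) ^ (3 * (setDiam G Γ - k)) * K) ≤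
      2 * ‖X‖ * L * (q⁻¹) ^ k * K * (N * c) := by
    calc _ ≤ ∑ Γ ∈ Finset.univ.filter (fun Γ => ¬Disjoint Γ (Rp \ R)),
          2 * ‖X‖ * L * (q⁻¹) ^ k * K * (‖term W Γ‖ * (q⁻¹) ^ (4 * (setDiam G Γ - k))) := by
          refine (Finset.sum_le_sum fun Γ _ => ?_).trans
            (Finset.sum_le_sum_of_subset_of_nonneg (fun Γ hΓ => ?_) fun Γ _ _ => by positivity)
          -- The fourth power of the weight pays for the loss q^{-diam Γ} in the screening, up to
          -- q^{-k}.
          · have h3 : (q⁻¹) ^ setDiam G Γ * (q⁻¹) ^ (3 * (setDiam G Γ - k)) ≤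
                (q⁻¹) ^ k * (q⁻¹) ^ (4 * (setDiam G Γ - k)) := by
              rw [← pow_add, ← pow_add]
              exact pow_le_pow_right₀ hqi (by omega)
            calc _ = 2 * ‖X‖ * L * K * ‖term W Γ‖ *
                  ((q⁻¹) ^ setDiam G Γ * (q⁻¹) ^ (3 * (setDiam G Γ - k))) := by ring
              _ ≤ 2 * ‖X‖ * L * K * ‖term W Γ‖ *
                  ((q⁻¹) ^ k * (q⁻¹) ^ (4 * (setDiam G Γ - k))) := by gcongr
              _ = _ := by ring
          · obtain ⟨-, hd, hm, -⟩ := Finset.mem_filter.1 hΓ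
            obtain ⟨v, hv, hvR⟩ := Finset.not_disjoint_iff.1 hm
            refine Finset.mem_filter.2 ⟨Finset.mem_univ _, Finset.not_disjoint_iff.2 ⟨v, hv, ?_⟩⟩
            exact Finset.mem_sdiff.2 ⟨hvR, Finset.disjoint_left.1 hd hv⟩
      _ ≤ 2 * ‖X‖ * L * (q⁻¹) ^ k * K * ((Rp \ R).card * c) := by
          rw [← Finset.mul_sum]
          refine mul_le_mul_of_nonneg_left ?_ (by positivity)
          exact sum_meeting_le _ (fun Γ => by positivity) _ fun v _ => hw v
      _ ≤ _ := by gcongr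
  have he : 2 / ν * (Real.exp (ν * t) - 1) ≤ 2 / ν * Real.exp (ν * t) := by
    gcongr
    linarith
  calc _ ≤ 2 / ν * (Real.exp (ν * t) - 1) * (2 * ‖X‖ * L * (q⁻¹) ^ k * K * (N * c)) :=
        mul_le_mul_of_nonneg_left h2 (mul_nonneg (by positivity)
          (sub_nonneg.2 (Real.one_le_exp (by positivity))))
    _ ≤ 2 / ν * Real.exp (ν * t) * (2 * ‖X‖ * L * (q⁻¹) ^ k * K * (N * c)) :=
        mul_le_mul_of_nonneg_right he (by positivity)
    _ = _ := by ring

/-- Screening by a non-resonant region, in terms of the decay rate `q`. -/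
theorem norm_lie_heisenberg_le_of_gap_pow (hε : 0 < ε) (hε1 : ε ≤ 1) (hh : 0 < h)
    (hconn : G.Connected) {R Rp Γ Γ₂ : Finset Λ} {y : Λ} {r e₁ d₂ : ℕ} {g N C₁ κ q ν : ℝ}
    (hg : 0 < g) (hgap : GapGE J (Rp \ R) g)
    (hout : ∀ z, z ∉ Rp → r < G.dist y z) (hΓR : Γ ⊆ Rp) (hΓ : ∀ z ∈ Γ, G.dist y z ≤ e₁)
    (hΓ₂ : ∀ z ∈ Γ₂, r < G.dist y z + d₂)
    (hN1 : 1 ≤ N) (hN : (Rp \ R).card ≤ N) (hC₁ : 1 ≤ C₁)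
    (hJ₁ : ∀ v, ∑ S ∈ Finset.univ.filter (fun S => v ∈ S), ‖W 0 S‖ ≤ C₁ * h)
    (hκ : 1 + 2 * (√spacingConst / g) * N * h ≤ κ) (hq : 0 < q) (hq1 : q ≤ 1) (hν : 0 < ν)
    (hϑ : 8 * N ^ 2 * C₁ * κ * ε ≤ q ^ (2 * k + 3))
    {X C : Op Λ} (hX : X ∈ supp Γ) (hC : C ∈ supp (Rpᶜ ∪ Γ₂)) {τ : ℝ} (hτ : 0 ≤ τ) :
    ‖⁅X, heisenberg (ham W R) τ C⁆‖ ≤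
      2 * ‖X‖ * ((1 + 8 * (h / ν) ^ 2) * q ^ r * (q⁻¹) ^ (2 * k + e₁)) * (q⁻¹) ^ d₂ *
        Real.exp (ν / 2 * τ) * ‖C‖ := by
  have hqi : 1 ≤ q⁻¹ := (one_le_inv₀ hq).2 hq1
  -- The quadratic growth in time is absorbed into e^{ντ/2}, at the price of the constant (h / ν)².
  have hexp : 1 + (h * τ) ^ 2 ≤ (1 + 8 * (h / ν) ^ 2) * Real.exp (ν / 2 * τ) := by
    have hx : 0 ≤ ν / 2 * τ := by positivity
    have h1 := Real.quadratic_le_exp_of_nonneg hx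
    have h2 : (h * τ) ^ 2 = 8 * (h / ν) ^ 2 * ((ν / 2 * τ) ^ 2 / 2) := by
      field_simp
      ring
    rw [h2, add_mul, one_mul]
    refine add_le_add (Real.one_le_exp hx) (mul_le_mul_of_nonneg_left ?_ (by positivity))
    linarith
  by_cases hr : 2 * k + e₁ + d₂ < r
  -- The perturbative order is the largest multiple of 2k + 3 that fits into the distance left after
  -- the two supports are accounted for. If no distance is left, the trivial bound is already
  -- stronger than the claim.
  · obtain ⟨m, hm1, hm2⟩ : ∃ m, e₁ + (2 * k + 3) * m + 2 * k + d₂ ≤ r ∧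
        r ≤ (2 * k + 3) * (m + 1) + (2 * k + e₁ + d₂) := by
      refine ⟨(r - (2 * k + e₁ + d₂)) / (2 * k + 3), ?_, ?_⟩
      · have := Nat.mul_div_le (r - (2 * k + e₁ + d₂)) (2 * k + 3)
        omega
      · have := Nat.lt_mul_div_succ (r - (2 * k + e₁ + d₂)) (b := 2 * k + 3) (by omega)
        omega
    have hC₁0 : 0 ≤ C₁ := by linarith
    have hκ0 : 0 ≤ κ := le_trans (by positivity) hκ
    have h1 := hW.norm_lie_heisenberg_le_of_gap hε hε1 hh hconn hg hgap hout hΓR hΓ hΓ₂ hm1 hN1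
      hN hC₁ hJ₁ hκ (hϑ.trans (pow_le_one₀ hq.le hq1)) hX hC hτ
    refine h1.trans ?_
    have h2 : (8 * N ^ 2 * C₁ * κ * ε) ^ (m + 1) ≤ q ^ r * (q⁻¹) ^ (2 * k + e₁ + d₂) := by
      refine (pow_le_pow_left₀ (by positivity) hϑ (m + 1)).trans ?_
      rw [← pow_mul, inv_pow, ← div_eq_mul_inv, le_div_iff₀ (by positivity), ← pow_add]
      exact pow_le_pow_of_le_one hq.le hq1 hm2
    calc _ ≤ 2 * ‖X‖ * ‖C‖ * (((1 + 8 * (h / ν) ^ 2) * Real.exp (ν / 2 * τ)) *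
          (q ^ r * (q⁻¹) ^ (2 * k + e₁ + d₂))) := by gcongr
      _ = _ := by rw [pow_add _ (2 * k + e₁)]; ring
  · refine (hW.norm_lie_heisenberg_le_trivial hε.le hε1 R X C τ).trans ?_
    have h1 : 1 ≤ q ^ r * (q⁻¹) ^ (2 * k + e₁ + d₂) := by
      rw [inv_pow, ← div_eq_mul_inv, one_le_div (by positivity)]
      exact pow_le_pow_of_le_one hq.le hq1 (by omega)
    have h2 : 1 ≤ (1 + 8 * (h / ν) ^ 2) * Real.exp (ν / 2 * τ) :=
      le_trans (by nlinarith [sq_nonneg (h * τ)]) hexp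
    calc 2 * ‖X‖ * ‖C‖ = 2 * ‖X‖ * ‖C‖ * (1 * 1) := by ring
      _ ≤ 2 * ‖X‖ * ‖C‖ * (((1 + 8 * (h / ν) ^ 2) * Real.exp (ν / 2 * τ)) *
          (q ^ r * (q⁻¹) ^ (2 * k + e₁ + d₂))) := by gcongr
      _ = _ := by rw [pow_add _ (2 * k + e₁)]; ring

/-- The Lieb–Robinson bound with velocity of order `h`. -/
theorem norm_lie_heisenberg_le_of_weight (hε : 0 ≤ ε) (hε1 : ε ≤ 1) (hconn : G.Connected)
    {S₀ S₁ : Finset Λ} {D : ℕ} (hD : ∀ x ∈ S₀, ∀ z ∈ S₁, D ≤ G.dist x z) {A : Op Λ}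
    (hA : A ∈ supp S₁) {ν μ c : ℝ} (hν : 0 < ν) (hμ : 0 ≤ μ)
    (hw : ∀ v, ∑ Γ ∈ Finset.univ.filter (fun Γ => v ∈ Γ),
      ‖term W Γ‖ * (Γ.card * Real.exp (μ * setDiam G Γ)) ≤ c) (hcν : 4 * c ≤ ν) (n : ℕ) :
    ∀ (R Γ : Finset Λ) (ρ : ℕ), Rᶜ.card ≤ n → (∀ z ∈ R, ∃ x ∈ S₀, G.dist x z ≤ ρ) →
      ¬Disjoint Γ R → ¬Γ ⊆ R → ∀ s, 0 ≤ s →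
      ‖⁅term W Γ, heisenberg (ham W R) s A⁆‖ ≤
        2 * ‖term W Γ‖ * (Γ.card * Real.exp (μ * setDiam G Γ)) *
          (‖A‖ * Real.exp (μ * ρ - μ * D)) * Real.exp (ν * s) := by
  -- Every crossing term absorbs a vertex outside R, so the number of remaining vertices bounds the
  -- number of Duhamel steps; ρ records how far R has grown from S₀.
  induction n with
  | zero =>
    intro R Γ ρ hn _ _ hΓ
    have h1 : Rᶜ = ∅ := Finset.card_eq_zero.1 (Nat.le_zero.1 hn)
    exact absurd (fun x _ => by simpa using Finset.eq_empty_iff_forall_notMem.1 h1 x) hΓ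
  | succ n ih =>
    intro R Γ ρ hn hρ hm hΓ s hs
    obtain ⟨p, hpΓ, hp⟩ := Finset.not_disjoint_iff.1 hm
    obtain ⟨z, hzΓ, hz⟩ := Finset.not_subset.1 hΓ
    have hρ' : ∀ u ∈ R ∪ Γ, ∃ x ∈ S₀, G.dist x u ≤ ρ + setDiam G Γ := fun u hu => by
      rcases Finset.mem_union.1 hu with hu | hu
      · obtain ⟨x, hx, hd⟩ := hρ u hu
        exact ⟨x, hx, by omega⟩
      · obtain ⟨x, hx, hd⟩ := hρ p hp
        have h1 := hconn.dist_triangle (u := x) (v := p) (w := u)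
        have h2 : G.dist p u ≤ setDiam G Γ := dist_le_setDiam hpΓ hu
        exact ⟨x, hx, by omega⟩
    have hcard : (1 : ℝ) ≤ Γ.card := by exact_mod_cast Finset.card_pos.2 ⟨p, hpΓ⟩
    by_cases hS : Disjoint (R ∪ Γ) S₁
    · have hAs : A ∈ supp (R ∪ Γ)ᶜ :=
        supp_mono (Finset.subset_compl_iff_disjoint_left.2 hS) hA
      have hcardR : (R ∪ Γ)ᶜ.card ≤ n := by
        have h1 : (R ∪ Γ)ᶜ ⊂ Rᶜ := by
          rw [Finset.ssubset_iff_of_subset (by simp)]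
          exact ⟨z, by simpa using hz, by simp [hzΓ]⟩
        have := Finset.card_lt_card h1
        omega
      set K := ‖A‖ * Real.exp (μ * (ρ + setDiam G Γ : ℕ) - μ * D) with hK
      have h1 := hW.norm_lie_heisenberg_le_sum (X := term W Γ) (A := A) (ν := ν)
        (R := R) (Rp := R ∪ Γ)
        (b := fun Γ₂ => 2 * ‖term W Γ₂‖ * (Γ₂.card * Real.exp (μ * setDiam G Γ₂)) * K)
        (κ := fun _ => 2 * ‖term W Γ‖) hε hε1 Finset.subset_union_left
        (supp_mono Finset.subset_union_right (hW.term_mem_supp hε hε1 Γ)) hAs hν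
        (fun Γ₂ _ h1 h2 s hs => ih (R ∪ Γ) Γ₂ _ hcardR hρ' h1 h2 s hs)
        (fun Γ _ h1 h2 => ⟨by positivity, fun C _ τ hτ => by
          refine (hW.norm_lie_heisenberg_le_trivial hε hε1 R _ C τ).trans ?_
          refine mul_le_mul_of_nonneg_right ?_ (norm_nonneg _)
          exact le_mul_of_one_le_right (by positivity) (Real.one_le_exp (by positivity))⟩) hs
      refine h1.trans ?_
      set F : Finset Λ → ℝ := fun Γ => ‖term W Γ‖ * (Γ.card * Real.exp (μ * setDiam G Γ))
        with hF
      have hF0 : ∀ Γ, 0 ≤ F Γ := fun Γ => by positivity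
      have h2 : ∑ Γ₂ ∈ Finset.univ.filter
            (fun Γ₂ => Disjoint Γ₂ R ∧ ¬Disjoint Γ₂ (R ∪ Γ) ∧ ¬Γ₂ ⊆ R ∪ Γ),
            2 * ‖term W Γ‖ * (2 * ‖term W Γ₂‖ *
              (Γ₂.card * Real.exp (μ * setDiam G Γ₂)) * K) ≤
          4 * ‖term W Γ‖ * K * (Γ.card * c) := by
        refine le_trans ?_ (mul_le_mul_of_nonneg_left
          (sum_meeting_le F hF0 Γ fun v _ => hw v) (by positivity))
        rw [Finset.mul_sum]
        refine (Finset.sum_le_sum_of_subset_of_nonneg (t := Finset.univ.filter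
          fun Γ₂ => ¬Disjoint Γ₂ Γ) (fun Γ₂ hΓ₂ => ?_) fun Γ₂ _ _ => by positivity).trans_eq
          (Finset.sum_congr rfl fun Γ₂ _ => by rw [hF]; ring)
        obtain ⟨-, hd, hm, -⟩ := Finset.mem_filter.1 hΓ₂
        refine Finset.mem_filter.2 ⟨Finset.mem_univ _, fun hd' => hm ?_⟩
        rw [Finset.disjoint_union_right]
        exact ⟨hd, hd'⟩
      have he0 : 0 ≤ Real.exp (ν * s) - 1 := sub_nonneg.2 (Real.one_le_exp (by positivity))
      have hK2 : K = Real.exp (μ * setDiam G Γ) * (‖A‖ * Real.exp (μ * ρ - μ * D)) := by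
        rw [hK, mul_left_comm, ← Real.exp_add]
        congr 2
        push_cast
        ring
      have hK0 : 0 ≤ K := by positivity
      -- The condition 4c ≤ ν makes the sum over the next term, including its time integral,
      -- reproduce the bound for Γ without loss; the factor |Γ| in the weight counts where the next
      -- term attaches.
      calc _ ≤ 2 / ν * (Real.exp (ν * s) - 1) * (4 * ‖term W Γ‖ * K * (Γ.card * c)) :=
            mul_le_mul_of_nonneg_left h2 (by positivity)
        _ = 2 * ‖term W Γ‖ * K * Γ.card * (4 * c / ν) * (Real.exp (ν * s) - 1) := by ring
        _ ≤ 2 * ‖term W Γ‖ * K * Γ.card * 1 * Real.exp (ν * s) := by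
            gcongr
            · exact div_le_one_of_le₀ hcν hν.le
            · linarith
        _ = _ := by rw [hK2]; ring
    -- If R ∪ Γ touches S₁, then ρ + diam Γ ≥ D, and the weight of Γ makes the claim weaker than the
    -- trivial bound.
    · obtain ⟨u, hu, huS⟩ := Finset.not_disjoint_iff.1 hS
      obtain ⟨x, hx, hd⟩ := hρ' u hu
      have h1 : (D : ℝ) ≤ ρ + setDiam G Γ := by exact_mod_cast (hD x hx u huS).trans hd
      refine (hW.norm_lie_heisenberg_le_trivial hε hε1 R _ A s).trans ?_
      have h2 : 1 ≤ Real.exp (μ * setDiam G Γ) * Real.exp (μ * ρ - μ * D) := by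
        rw [← Real.exp_add]
        refine Real.one_le_exp ?_
        have := mul_le_mul_of_nonneg_left h1 hμ
        linarith
      have h3 : 1 ≤ Real.exp (ν * s) := Real.one_le_exp (by positivity)
      calc 2 * ‖term W Γ‖ * ‖A‖ = 2 * ‖term W Γ‖ * ‖A‖ * (1 * 1 * 1) := by ring
        _ ≤ 2 * ‖term W Γ‖ * ‖A‖ * (Γ.card * (Real.exp (μ * setDiam G Γ) *
            Real.exp (μ * ρ - μ * D)) * Real.exp (ν * s)) := by gcongr
        _ = _ := by ring

end LocalSeries

end Steps

/-! ### Prefixes of paths -/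

section Prefixes

variable {Λ : Type} [Fintype Λ] [LinearOrder Λ] {G : SimpleGraph Λ}

theorem subset_absorb (r : ℕ) (R Γ : Finset Λ) : R ⊆ absorb G r R Γ := by
  rw [absorb]
  split_ifs
  exacts [Finset.subset_union_left, Finset.subset_union_left]

theorem step_subset_absorb (r : ℕ) (R Γ : Finset Λ) : Γ ⊆ absorb G r R Γ := by
  intro z hz
  by_cases hR : z ∈ R
  · exact subset_absorb r R Γ hR
  rw [absorb]
  split_ifs with hs
  · have := (Finset.mem_filter.1 ((centers G r R Γ).min'_mem hs)).2
    exact Finset.mem_union_right _ (this (Finset.mem_sdiff.2 ⟨hz, hR⟩))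
  · exact Finset.mem_union_right _ hz

theorem region_congr {r i : ℕ} {S : Finset Λ} {Γ Γ' : ℕ → Finset Λ}
    (h : ∀ j < i, Γ j = Γ' j) : region G r S Γ i = region G r S Γ' i := by
  induction i with
  | zero => rfl
  | succ i ih =>
    rw [region, region, ih fun j hj => h j (by omega), h i (by omega)]

theorem prevRegion_congr {r i : ℕ} {S : Finset Λ} {Γ Γ' : ℕ → Finset Λ}
    (h : ∀ j < i, Γ j = Γ' j) : prevRegion G r S Γ i = prevRegion G r S Γ' i := by
  cases i with
  | zero => rfl
  | succ i => exact region_congr fun j hj => h j (by omega)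

theorem BadStep.congr {J : Finset Λ → ℝ} {g : ℝ} {r i : ℕ} {S : Finset Λ}
    {Γ Γ' : ℕ → Finset Λ} (hb : BadStep G J r g S Γ i) (h : ∀ j ≤ i, Γ j = Γ' j) :
    BadStep G J r g S Γ' i := by
  have h1 : region G r S Γ i = region G r S Γ' i := region_congr fun j hj => h j hj.le
  rw [BadStep, h1, h i le_rfl] at hb
  exact hb

theorem region_mono (r : ℕ) (S : Finset Λ) (Γ : ℕ → Finset Λ) :
    Monotone (region G r S Γ) :=
  monotone_nat_of_le_succ fun i => subset_absorb r _ (Γ i)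

theorem prevRegion_subset (r : ℕ) (S : Finset Λ) (Γ : ℕ → Finset Λ) (i : ℕ) :
    prevRegion G r S Γ i ⊆ region G r S Γ i := by
  cases i with
  | zero => exact Finset.empty_subset _
  | succ i => exact region_mono r S Γ (Nat.le_succ i)

/-- `Γ` may be the `i`-th step of a path from `x`. -/
def ValidStep (G : SimpleGraph Λ) (r : ℕ) (x : Λ) (Γs : ℕ → Finset Λ) (i : ℕ)
    (Γ : Finset Λ) : Prop :=
  Disjoint Γ (prevRegion G r {x} Γs i) ∧ (Γ ∩ region G r {x} Γs i).Nonempty ∧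
    (Γ \ region G r {x} Γs i).Nonempty

/-- The first `i` sets of `Γs` are steps of a path from `x` with at least `b` bad steps, the
region of which has radius at most `(r + 1) U`. -/
structure PathPrefix (G : SimpleGraph Λ) (J : Finset Λ → ℝ) (r : ℕ) (g : ℝ) (x : Λ) (i : ℕ)
    (Γs : ℕ → Finset Λ) (U b : ℕ) : Prop where
  valid : ∀ j < i, ValidStep G r x Γs j (Γs j)
  bad : ∃ T ⊆ Finset.range i, T.card = b ∧ ∀ j ∈ T, BadStep G J r g {x} Γs j
  dist_le : ∀ z ∈ region G r {x} Γs i, G.dist x z ≤ (r + 1) * U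
  le : i ≤ U

variable {J : Finset Λ → ℝ} {r : ℕ} {g : ℝ} {x : Λ} {i : ℕ} {Γs : ℕ → Finset Λ} {U b : ℕ}

set_option linter.unusedSectionVars false in
theorem update_eq_of_lt (Γs : ℕ → Finset Λ) (i : ℕ) (Γ : Finset Λ) :
    ∀ j < i, Γs j = Function.update Γs i Γ j := fun j hj => by
  rw [Function.update_of_ne hj.ne]

theorem region_update (Γs : ℕ → Finset Λ) (i : ℕ) (Γ : Finset Λ) (S : Finset Λ) :
    region G r S (Function.update Γs i Γ) (i + 1) = absorb G r (region G r S Γs i) Γ := by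
  rw [region, Function.update_self, region_congr (update_eq_of_lt Γs i Γ)]

theorem prevRegion_update (Γs : ℕ → Finset Λ) (i : ℕ) (Γ : Finset Λ) (S : Finset Λ) :
    prevRegion G r S (Function.update Γs i Γ) (i + 1) = region G r S Γs i :=
  (region_congr (update_eq_of_lt Γs i Γ)).symm

theorem valid_update (hv : ∀ j < i, ValidStep G r x Γs j (Γs j)) {Γ : Finset Λ}
    (hΓ : ValidStep G r x Γs i Γ) :
    ∀ j < i + 1, ValidStep G r x (Function.update Γs i Γ) j (Function.update Γs i Γ j) := by
  have hlt := update_eq_of_lt Γs i Γ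
  intro j hj
  have h1 : region G r {x} (Function.update Γs i Γ) j = region G r {x} Γs j :=
    (region_congr fun l hl => hlt l (by omega)).symm
  have h2 : prevRegion G r {x} (Function.update Γs i Γ) j = prevRegion G r {x} Γs j :=
    (prevRegion_congr fun l hl => hlt l (by omega)).symm
  rw [ValidStep, h1, h2]
  rcases Nat.lt_succ_iff_lt_or_eq.1 hj with hj' | rfl
  · rw [← hlt j hj']
    exact hv j hj'
  · rw [Function.update_self]
    exact hΓ

theorem PathPrefix.extend (hp : PathPrefix G J r g x i Γs U b) {Γ : Finset Λ}
    (hΓ : ValidStep G r x Γs i Γ) {U' : ℕ} (hU : U + 1 ≤ U')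
    (hd : ∀ z ∈ absorb G r (region G r {x} Γs i) Γ, G.dist x z ≤ (r + 1) * U') :
    PathPrefix G J r g x (i + 1) (Function.update Γs i Γ) U' b where
  valid := valid_update hp.valid hΓ
  bad := by
    obtain ⟨T, hT, hb, hbad⟩ := hp.bad
    refine ⟨T, hT.trans (Finset.range_mono (Nat.le_succ i)), hb, fun j hj => ?_⟩
    have := Finset.mem_range.1 (hT hj)
    exact (hbad j hj).congr fun l hl => update_eq_of_lt Γs i Γ l (by omega)
  dist_le := by rw [region_update]; exact hd
  le := by have := hp.le; omega

theorem PathPrefix.extend_bad (hp : PathPrefix G J r g x i Γs U b) {Γ : Finset Λ}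
    (hΓ : ValidStep G r x Γs i Γ) {U' : ℕ} (hU : U + 1 ≤ U')
    (hd : ∀ z ∈ absorb G r (region G r {x} Γs i) Γ, G.dist x z ≤ (r + 1) * U')
    (hs : IsSmall G r (region G r {x} Γs i) Γ)
    (hb : ¬NonResonantAt G J r g ((centers G r (region G r {x} Γs i) Γ).min' hs)) :
    PathPrefix G J r g x (i + 1) (Function.update Γs i Γ) U' (b + 1) where
  valid := valid_update hp.valid hΓ
  bad := by
    obtain ⟨T, hT, hcard, hbad⟩ := hp.bad
    have hi : i ∉ T := fun hi => by simpa using hT hi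
    refine ⟨insert i T, ?_, by rw [Finset.card_insert_of_notMem hi, hcard], fun j hj => ?_⟩
    · rw [Finset.insert_subset_iff]
      exact ⟨by simp, hT.trans (Finset.range_mono (Nat.le_succ i))⟩
    · rcases Finset.mem_insert.1 hj with rfl | hj
      · have h1 : region G r {x} (Function.update Γs j Γ) j = region G r {x} Γs j :=
          (region_congr (update_eq_of_lt Γs j Γ)).symm
        rw [BadStep, h1, Function.update_self]
        exact ⟨hs, hb⟩
      · have := Finset.mem_range.1 (hT hj)
        exact (hbad j hj).congr fun l hl => update_eq_of_lt Γs i Γ l (by omega)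
  dist_le := by rw [region_update]; exact hd
  le := by have := hp.le; omega

/-- A prefix that stays close to `x` extends to a path, and so has few bad steps. -/
theorem PathPrefix.bad_le {n : ℕ} {ζ : ℝ} (hp : PathPrefix G J r g x (i + 1) Γs U b)
    (hNR : PartialNonResonantAt G J r g n ζ x) (hU : U ≤ n)
    (hreach : ∀ z ∈ region G r {x} Γs i, G.dist x z < n * r) {z : Λ}
    (hz : n * (r + 1) < G.dist x z) : (b : ℝ) ≤ (1 - ζ) * n := by
  by_contra hcon
  rw [not_le] at hcon
  obtain ⟨T, hT, hcard, hbad⟩ := hp.bad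
  have hin := hp.le
  have hstep : ∀ j < i, ¬Reaches G r n {x} (Γs j) := fun j hj hr => by
    obtain ⟨u, hu, hd⟩ := hr x (Finset.mem_singleton_self x)
    have h1 := region_mono (G := G) r {x} Γs (show j + 1 ≤ i by omega)
      (step_subset_absorb r _ _ hu)
    have := hreach u h1
    rw [SimpleGraph.dist_comm] at hd
    omega
  -- If the last step already reaches distance n r, the prefix is itself a path. Earlier steps
  -- cannot reach it, since they lie in the region before the last step.
  by_cases hr : Reaches G r n {x} (Γs i)
  · refine hNR (i + 1) Γs ⟨by omega, by omega, hp.valid, fun j hj => hstep j (by omega),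
      Or.inr hr⟩ ⟨T, hT, by rwa [hcard], hbad⟩
  obtain ⟨-, -, p, hp'⟩ := hp.valid i (by omega)
  rw [Finset.mem_sdiff] at hp'
  have hpR : p ∈ region G r {x} Γs (i + 1) := step_subset_absorb r _ _ hp'.1
  have hzR : z ∉ region G r {x} Γs (i + 1) := fun h => by
    have h1 := hp.dist_le z h
    have h2 : (r + 1) * U ≤ (r + 1) * n := Nat.mul_le_mul_left _ hU
    rw [mul_comm n] at hz
    omega
  have hzR' : z ∉ region G r {x} Γs i := fun h => hzR (region_mono r {x} Γs (Nat.le_succ i) h)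
  -- Otherwise the prefix is completed by one artificial step that jumps from a vertex p newly
  -- absorbed by the last step to the far vertex z. As p is new, the step avoids the region before
  -- the last one.
  have hv : ValidStep G r x Γs (i + 1) {p, z} := by
    refine ⟨?_, ⟨p, ?_⟩, ⟨z, ?_⟩⟩
    · rw [Finset.disjoint_left]
      intro u hu
      rcases Finset.mem_insert.1 hu with rfl | hu
      · exact hp'.2
      · rw [Finset.mem_singleton.1 hu]
        exact hzR'
    · simpa using hpR
    · simpa using hzR
  have hlt := update_eq_of_lt Γs (i + 1) {p, z}
  refine hNR (i + 2) (Function.update Γs (i + 1) {p, z})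
    ⟨by omega, by omega, valid_update hp.valid hv, fun j hj => ?_, Or.inr ?_⟩
    ⟨T, hT.trans (Finset.range_mono (by omega)), by rwa [hcard], fun j hj => ?_⟩
  · rw [← hlt j (by omega)]
    rcases Nat.lt_succ_iff_lt_or_eq.1 (show j < i + 1 by omega) with hj' | rfl
    exacts [hstep j hj', hr]
  · intro y hy
    rw [Finset.mem_singleton.1 hy]
    refine ⟨z, ?_, ?_⟩
    · simp
    · rw [mul_add] at hz
      rw [SimpleGraph.dist_comm]
      omega
  · have := Finset.mem_range.1 (hT hj)
    exact (hbad j hj).congr fun l hl => hlt l (by omega)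

end Prefixes

/-! ### The sum over paths -/

section PathSum

set_option linter.unusedSectionVars false

variable {Λ : Type} [Fintype Λ] [LinearOrder Λ] {G : SimpleGraph Λ} {k : ℕ} {h ε : ℝ}
  {J : Finset Λ → ℝ} {W : ℕ → Finset Λ → Op Λ} {w : ℕ → ℝ}

theorem mul_pow_sub_le {Q : ℝ} (hQ : 0 ≤ Q) (hQ1 : Q ≤ 1) {u a b : ℕ} (h : b ≤ a + u) :
    Q ^ u * Q ^ a ≤ Q ^ b := by
  rw [← pow_add]
  exact pow_le_pow_of_le_one hQ hQ1 (by omega)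

theorem card_union_sdiff_le (S R P : Finset Λ) :
    (((S ∪ (R ∪ P)) \ (S ∪ R)).card : ℝ) ≤ P.card := by
  refine Nat.cast_le.2 (Finset.card_le_card fun z hz => ?_)
  simp only [Finset.mem_sdiff, Finset.mem_union, not_or] at hz
  tauto

/-- The sum over all continuations of a path prefix, organised as a budget. Of `n'` units of length
r + 1, `U` are used up; of at most `B` bad steps, `b` are spent. The bound allows every remaining
bad step, with factor c_b, and charges Q for each remaining unit beyond these. A small step in a
non-resonant ball earns Q by screening; in a resonant ball it spends one bad step. A term of
diameter above r/2 is never screened: it crosses u units, and Q^u is covered by the factor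
q^{-3(diam - k)} that the claim grants it. The induction is on the number `m` of units still to be
crossed, and S₀ stays removed from the Hamiltonian together with the region of the path. -/
theorem LocalSeries.norm_lie_heisenberg_le_path (hW : LocalSeries G k h ε J W w) (hε : 0 < ε)
    (hε1 : ε ≤ 1) (hh : 0 < h) (hconn : G.Connected) {q c ν C₁ κ N g ζ : ℝ} {r n : ℕ} {x : Λ}
    (hq : 0 < q) (hq1 : q ≤ 1) (hw : WeightLE G W k q c) (hc : 0 ≤ c) (hν : 0 < ν)
    (hN1 : 1 ≤ N) (hN : ∀ y, ((ball G y r).card : ℝ) ≤ N) (hC₁ : 1 ≤ C₁)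
    (hJ₁ : ∀ v, ∑ S ∈ Finset.univ.filter (fun S => v ∈ S), ‖W 0 S‖ ≤ C₁ * h)
    (hg : 0 < g) (hNR : PartialNonResonantAt G J r g n ζ x)
    (hκ : 1 + 2 * (√spacingConst / g) * N * h ≤ κ)
    (hϑ : 8 * N ^ 2 * C₁ * κ * ε ≤ q ^ (2 * k + 3))
    {S₀ S₁ : Finset Λ} (hSS : Disjoint S₀ S₁) (hS₁ : S₁.Nonempty)
    (hD : ∀ z ∈ S₁, n * (r + 1) < G.dist x z) {A : Op Λ} (hA : A ∈ supp S₁)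
    {n' B : ℕ} (hn' : n' ≤ n) (hreach : ∀ U < n', (r + 1) * U < n * r)
    (hB : ∀ b : ℕ, (b : ℝ) ≤ (1 - ζ) * n → b ≤ B)
    {c_b Q : ℝ} (hcb1 : 1 ≤ c_b) (hQ : 0 < Q) (hQ1 : Q ≤ 1)
    (hcb : 4 * N * c / ν * (q⁻¹) ^ k ≤ c_b)
    (hgood : 4 * N * c / ν * (q⁻¹) ^ k *
      ((1 + 8 * (h / ν) ^ 2) * q ^ r * (q⁻¹) ^ (4 * k)) ≤ Q)
    {Nd : ℕ → ℝ} (hNd : ∀ δ, N ≤ Nd δ) (hNd' : ∀ Γ : Finset Λ, (Γ.card : ℝ) ≤ Nd (setDiam G Γ))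
    (hlong : ∀ δ u : ℕ, 1 ≤ u → r < 2 * δ → (u = 1 ∨ 2 * (r + 1) * (u - 1) < 3 * δ ∧ 3 * δ ≤ 2 * (r + 1) * u) →
      4 * Nd δ * c / ν * (q⁻¹) ^ k ≤ (q⁻¹) ^ (3 * (δ - k)) * Q ^ u ∧
        1 ≤ (q⁻¹) ^ (3 * (δ - k)) * Q ^ u) (m : ℕ) :
    ∀ (i : ℕ) (Γs : ℕ → Finset Λ) (U b : ℕ), PathPrefix G J r g x i Γs U b → b ≤ B →
      n' ≤ U + m → ∀ (Γ : Finset Λ) (p y : Λ), Disjoint Γ (prevRegion G r {x} Γs i) →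
      p ∈ region G r {x} Γs i → p ∉ prevRegion G r {x} Γs i →
      y ∈ boundary G (region G r {x} Γs i)ᶜ →
      (∀ u ∈ Γ, G.dist y u + 1 ≤ 2 * setDiam G Γ) →
      (∀ u ∈ Γ, 2 * G.dist x u ≤ 2 * ((r + 1) * U) + 3 * setDiam G Γ) →
      ¬Γ ⊆ S₀ ∪ region G r {x} Γs i → ∀ s, 0 ≤ s →
      ‖⁅term W Γ, heisenberg (ham W (S₀ ∪ region G r {x} Γs i)) s A⁆‖ ≤
        ‖term W Γ‖ * (q⁻¹) ^ (3 * (setDiam G Γ - k)) *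
          (2 * ‖A‖ * c_b ^ (B - b) * Q ^ (n' - U - (B - b))) * Real.exp (ν * s) := by
  have hqi : 1 ≤ q⁻¹ := (one_le_inv₀ hq).2 hq1
  induction m with
  | zero =>
    intro i Γs U b hp hb hnU Γ p y hΓ1 hpR hpP hy hΓy hΓx hΓS s hs
    refine (hW.norm_lie_heisenberg_le_trivial hε.le hε1 _ _ A s).trans ?_
    rw [show n' - U - (B - b) = 0 by omega, pow_zero, mul_one]
    have h1 : 1 ≤ (q⁻¹) ^ (3 * (setDiam G Γ - k)) := one_le_pow₀ hqi
    have h2 : 1 ≤ c_b ^ (B - b) := one_le_pow₀ hcb1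
    have h3 : 1 ≤ Real.exp (ν * s) := Real.one_le_exp (by positivity)
    calc 2 * ‖term W Γ‖ * ‖A‖ = ‖term W Γ‖ * 1 * (2 * ‖A‖ * 1) * 1 := by ring
      _ ≤ _ := by gcongr
  | succ m ih =>
    intro i Γs U b hp hb hnU Γ p y hΓ1 hpR hpP hy hΓy hΓx hΓS s hs
    set R := region G r {x} Γs i with hR
    set δ := setDiam G Γ with hδ
    have hes : 1 ≤ Real.exp (ν * s) := Real.one_le_exp (by positivity)
    have htriv : ∀ C τ, 0 ≤ τ → ‖⁅term W Γ, heisenberg (ham W (S₀ ∪ R)) τ C⁆‖ ≤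
        2 * ‖term W Γ‖ * ‖C‖ := fun C τ _ =>
      hW.norm_lie_heisenberg_le_trivial hε.le hε1 _ _ C τ
    have hp1 : 1 ≤ (q⁻¹) ^ (3 * (δ - k)) := one_le_pow₀ hqi
    have hcB : 1 ≤ c_b ^ (B - b) := one_le_pow₀ hcb1
    -- the trivial bound
    have hsmallQ : 1 ≤ (q⁻¹) ^ (3 * (δ - k)) * Q ^ (n' - U - (B - b)) →
        ‖⁅term W Γ, heisenberg (ham W (S₀ ∪ R)) s A⁆‖ ≤
          ‖term W Γ‖ * (q⁻¹) ^ (3 * (δ - k)) *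
          (2 * ‖A‖ * c_b ^ (B - b) * Q ^ (n' - U - (B - b))) * Real.exp (ν * s) := fun h1 => by
      calc _ ≤ 2 * ‖term W Γ‖ * ‖A‖ := htriv A s hs
        _ = ‖term W Γ‖ * 1 * (2 * ‖A‖ * 1) * 1 := by ring
        _ ≤ ‖term W Γ‖ * ((q⁻¹) ^ (3 * (δ - k)) * Q ^ (n' - U - (B - b))) *
            (2 * ‖A‖ * c_b ^ (B - b)) * Real.exp (ν * s) := by gcongr
        _ = _ := by ring
    by_cases hnU' : n' ≤ U
    · refine hsmallQ ?_
      rw [show n' - U - (B - b) = 0 by omega, pow_zero, mul_one]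
      exact hp1
    rw [not_le] at hnU'
    have hRd : ∀ z ∈ R, G.dist x z ≤ (r + 1) * U := hp.dist_le
    obtain ⟨hyR, x', hx', hyx'⟩ := mem_boundary.1 hy
    have hyR' : y ∉ R := by simpa using hyR
    -- continuing with one more step of the path
    have hrec : ∀ (Γ' : Finset Λ) (U' b' : ℕ),
        PathPrefix G J r g x (i + 1) (Function.update Γs i Γ') U' b' → b' ≤ B → U + 1 ≤ U' →
        U' ≤ n → Γ ⊆ S₀ ∪ absorb G r R Γ' → ∀ (N' L : ℝ), 0 ≤ L →
        (((S₀ ∪ absorb G r R Γ') \ (S₀ ∪ R)).card : ℝ) ≤ N' →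
        (∀ Γ₂, ¬Γ₂ ⊆ S₀ ∪ absorb G r R Γ' →
          ∀ C ∈ supp ((S₀ ∪ absorb G r R Γ')ᶜ ∪ Γ₂), ∀ τ, 0 ≤ τ →
          ‖⁅term W Γ, heisenberg (ham W (S₀ ∪ R)) τ C⁆‖ ≤
            2 * ‖term W Γ‖ * L * (q⁻¹) ^ setDiam G Γ₂ * Real.exp (ν / 2 * τ) * ‖C‖) →
        4 * N' * c / ν * (q⁻¹) ^ k * L * (c_b ^ (B - b') * Q ^ (n' - U' - (B - b'))) ≤
          (q⁻¹) ^ (3 * (δ - k)) * (c_b ^ (B - b) * Q ^ (n' - U - (B - b))) →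
        ‖⁅term W Γ, heisenberg (ham W (S₀ ∪ R)) s A⁆‖ ≤
          ‖term W Γ‖ * (q⁻¹) ^ (3 * (δ - k)) *
          (2 * ‖A‖ * c_b ^ (B - b) * Q ^ (n' - U - (B - b))) * Real.exp (ν * s) := by
      intro Γ' U' b' hp' hb' hUU' hU'n hΓR' N' L hL hN' hκ' hnum
      have hreg : region G r {x} (Function.update Γs i Γ') (i + 1) = absorb G r R Γ' :=
        region_update Γs i Γ' {x}
      have hprev : prevRegion G r {x} (Function.update Γs i Γ') (i + 1) = R :=
        prevRegion_update Γs i Γ' {x}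
      set R' := absorb G r R Γ' with hR'
      have hR'd : ∀ z ∈ R', G.dist x z ≤ (r + 1) * U' := fun z hz =>
        hp'.dist_le z (by rw [hreg]; exact hz)
      have hdisj : Disjoint (S₀ ∪ R') S₁ := by
        rw [Finset.disjoint_union_left]
        refine ⟨hSS, Finset.disjoint_left.2 fun z hz hz1 => ?_⟩
        have h1 := hR'd z hz
        have h2 := hD z hz1
        have h3 : (r + 1) * U' ≤ (r + 1) * n := Nat.mul_le_mul_left _ hU'n
        rw [mul_comm n] at h2
        omega
      have hstep := hW.norm_lie_heisenberg_le_step (R := S₀ ∪ R) (Rp := S₀ ∪ R')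
        (X := term W Γ) (A := A) (ν := ν) (L := L) (N := N') (t := s)
        (K := 2 * ‖A‖ * c_b ^ (B - b') * Q ^ (n' - U' - (B - b')))
        hε.le hε1 hq hq1 hw hc (Finset.union_subset_union_right (subset_absorb r R Γ')) hN'
        (supp_mono hΓR' (hW.term_mem_supp hε.le hε1 Γ))
        (supp_mono (Finset.subset_compl_iff_disjoint_left.2 hdisj) hA) hν (by positivity) hL
        (fun Γ₂ hd₂ hm₂ hs₂ τ hτ => by
          obtain ⟨p₂, hp₂Γ, hp₂⟩ := Finset.not_disjoint_iff.1 hm₂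
          obtain ⟨z, hzΓ, hz⟩ := Finset.not_subset.1 hs₂
          have hp₂' : p₂ ∉ S₀ ∪ R := Finset.disjoint_left.1 hd₂ hp₂Γ
          rw [Finset.mem_union, not_or] at hp₂' hz
          have hp₂R : p₂ ∈ R' := (Finset.mem_union.1 hp₂).resolve_left hp₂'.1
          obtain ⟨-, -, y₂, hy₂, -, -, hy₂Γ, -⟩ := exists_crossing hconn hp₂R hp₂Γ hz.2 hzΓ
          have := ih (i + 1) (Function.update Γs i Γ') U' b' hp' hb' (by omega) Γ₂ p₂ y₂
            (by rw [hprev]; exact hd₂.mono_right Finset.subset_union_right)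
            (by rw [hreg]; exact hp₂R) (by rw [hprev]; exact hp₂'.2)
            (by rw [hreg]; exact hy₂) hy₂Γ
            (fun u hu => by
              have h1 := hconn.dist_triangle (u := x) (v := p₂) (w := u)
              have h2 : G.dist p₂ u ≤ setDiam G Γ₂ := dist_le_setDiam hp₂Γ hu
              have h3 := hR'd p₂ hp₂R
              omega)
            (by rw [hreg]; exact hs₂) τ hτ
          rw [hreg] at this
          exact this)
        hκ' hs
      refine hstep.trans ?_
      calc _ = 4 * N' * c / ν * (q⁻¹) ^ k * L * (c_b ^ (B - b') * Q ^ (n' - U' - (B - b'))) *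
            (‖term W Γ‖ * (2 * ‖A‖)) * Real.exp (ν * s) := by ring
        _ ≤ (q⁻¹) ^ (3 * (δ - k)) * (c_b ^ (B - b) * Q ^ (n' - U - (B - b))) *
            (‖term W Γ‖ * (2 * ‖A‖)) * Real.exp (ν * s) := by gcongr
        _ = _ := by ring
    have hκtriv : ∀ Rp : Finset Λ, ∀ Γ₂, ¬Γ₂ ⊆ Rp → ∀ C ∈ supp (Rpᶜ ∪ Γ₂), ∀ τ, 0 ≤ τ →
        ‖⁅term W Γ, heisenberg (ham W (S₀ ∪ R)) τ C⁆‖ ≤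
          2 * ‖term W Γ‖ * 1 * (q⁻¹) ^ setDiam G Γ₂ * Real.exp (ν / 2 * τ) * ‖C‖ := by
      intro Rp Γ₂ _ C _ τ hτ
      have h1 : 1 ≤ (q⁻¹) ^ setDiam G Γ₂ := one_le_pow₀ hqi
      have h2 : 1 ≤ Real.exp (ν / 2 * τ) := Real.one_le_exp (by positivity)
      calc _ ≤ 2 * ‖term W Γ‖ * ‖C‖ := htriv C τ hτ
        _ = 2 * ‖term W Γ‖ * 1 * 1 * 1 * ‖C‖ := by ring
        _ ≤ _ := by gcongr
    -- small steps
    have hsmall : ∀ Γ' : Finset Λ, ValidStep G r x Γs i Γ' → Γ ⊆ S₀ ∪ absorb G r R Γ' →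
        ∀ hs : IsSmall G r R Γ', ∀ L : ℝ, 0 ≤ L →
        4 * N * c / ν * (q⁻¹) ^ k * L ≤ (q⁻¹) ^ (3 * (δ - k)) * Q →
        (NonResonantAt G J r g ((centers G r R Γ').min' hs) → ∀ Γ₂,
          ¬Γ₂ ⊆ S₀ ∪ absorb G r R Γ' →
          ∀ C ∈ supp ((S₀ ∪ absorb G r R Γ')ᶜ ∪ Γ₂), ∀ τ, 0 ≤ τ →
          ‖⁅term W Γ, heisenberg (ham W (S₀ ∪ R)) τ C⁆‖ ≤
            2 * ‖term W Γ‖ * L * (q⁻¹) ^ setDiam G Γ₂ * Real.exp (ν / 2 * τ) * ‖C‖) →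
        ‖⁅term W Γ, heisenberg (ham W (S₀ ∪ R)) s A⁆‖ ≤
          ‖term W Γ‖ * (q⁻¹) ^ (3 * (δ - k)) *
          (2 * ‖A‖ * c_b ^ (B - b) * Q ^ (n' - U - (B - b))) * Real.exp (ν * s) := by
      intro Γ' hv hΓR' hsm L hL hLQ hκ'
      have habs : absorb G r R Γ' = R ∪ ball G ((centers G r R Γ').min' hsm) r := by
        rw [absorb, dif_pos hsm]
      set y' := (centers G r R Γ').min' hsm with hy'
      have hy'c : y' ∈ boundary G Rᶜ :=
        (Finset.mem_filter.1 ((centers G r R Γ').min'_mem hsm)).1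
      obtain ⟨-, x₁, hx₁, hyx₁⟩ := mem_boundary.1 hy'c
      have hx₁R : x₁ ∈ R := by simpa using hx₁
      have hd : ∀ z ∈ absorb G r R Γ', G.dist x z ≤ (r + 1) * (U + 1) := by
        intro z hz
        rw [habs, Finset.mem_union] at hz
        rw [mul_add, mul_one]
        rcases hz with hz | hz
        · exact (hRd z hz).trans (Nat.le_add_right _ _)
        · have h1 := (Finset.mem_filter.1 hz).2
          have h2 := hRd x₁ hx₁R
          have h3 := hconn.dist_triangle (u := x) (v := x₁) (w := y')
          have h4 := hconn.dist_triangle (u := x) (v := y') (w := z)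
          rw [SimpleGraph.dist_eq_one_iff_adj.2 hyx₁.symm] at h3
          omega
      have hcard : (((S₀ ∪ absorb G r R Γ') \ (S₀ ∪ R)).card : ℝ) ≤ N := by
        rw [habs]
        exact (card_union_sdiff_le _ _ _).trans (hN y')
      -- The screening factor L is available only in the non-resonant case. In the resonant case
      -- partial non-resonance, applied to the extended prefix, guarantees that the number of bad
      -- steps does not exceed B.
      by_cases hnr : NonResonantAt G J r g y'
      · refine hrec Γ' (U + 1) b (hp.extend hv le_rfl hd) hb le_rfl (by omega) hΓR' N L hL hcard
          (hκ' hnr) ?_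
        have h1 := mul_pow_sub_le hQ.le hQ1
          (show n' - U - (B - b) ≤ n' - (U + 1) - (B - b) + 1 by omega)
        rw [pow_one] at h1
        calc _ ≤ (q⁻¹) ^ (3 * (δ - k)) * Q *
              (c_b ^ (B - b) * Q ^ (n' - (U + 1) - (B - b))) := by gcongr
          _ = (q⁻¹) ^ (3 * (δ - k)) *
              (c_b ^ (B - b) * (Q * Q ^ (n' - (U + 1) - (B - b)))) := by ring
          _ ≤ _ := by gcongr
      · have hp' := hp.extend_bad hv le_rfl hd hsm hnr
        obtain ⟨z, hz⟩ := hS₁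
        have hbB : b + 1 ≤ B := by
          refine hB _ (hp'.bad_le hNR (by omega) (fun u hu => ?_) (hD z hz))
          rw [← region_congr (update_eq_of_lt Γs i Γ')] at hu
          exact (hRd u hu).trans_lt (hreach U hnU')
        refine hrec Γ' (U + 1) (b + 1) hp' hbB le_rfl (by omega) hΓR' N 1 zero_le_one hcard
          (hκtriv _) ?_
        -- A bad step uses one unit and one bad step at once, so the exponent of Q does not change.
        rw [show n' - (U + 1) - (B - (b + 1)) = n' - U - (B - b) by omega,
          show B - b = B - (b + 1) + 1 by omega, pow_succ c_b]
        calc _ ≤ c_b * 1 * (c_b ^ (B - (b + 1)) * Q ^ (n' - U - (B - (b + 1) + 1))) := by gcongr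
          _ ≤ (q⁻¹) ^ (3 * (δ - k)) *
              (c_b * 1 * (c_b ^ (B - (b + 1)) * Q ^ (n' - U - (B - (b + 1) + 1)))) :=
              le_mul_of_one_le_left (by positivity) hp1
          _ = _ := by ring
    by_cases hshort : 2 * δ ≤ r
    · -- short terms
      -- The step recorded in the path is the whole ball around y and not Γ itself, with p added so
      -- that it meets R. Whatever centre is chosen, the absorbed region then contains B_r(y), which
      -- places Γ deep inside it.
      set Γ' := insert p (ball G y r \ R) with hΓ'
      have hdiff : Γ' \ R = ball G y r \ R := by
        rw [hΓ', Finset.insert_sdiff_of_mem _ hpR]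
        simp
      have hyb : y ∈ ball G y r \ R := by
        rw [Finset.mem_sdiff]
        exact ⟨Finset.mem_filter.2 ⟨Finset.mem_univ y, by simp⟩, hyR'⟩
      have hv : ValidStep G r x Γs i Γ' := by
        refine ⟨?_, ⟨p, by rw [Finset.mem_inter]; exact ⟨by simp [hΓ'], hpR⟩⟩,
          ⟨y, by rw [hdiff]; exact hyb⟩⟩
        rw [Finset.disjoint_left]
        intro u hu
        rcases Finset.mem_insert.1 hu with rfl | hu
        · exact hpP
        · exact fun h' => (Finset.mem_sdiff.1 hu).2 (prevRegion_subset r {x} Γs i h')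
      have hsm : IsSmall G r R Γ' :=
        ⟨y, Finset.mem_filter.2 ⟨hy, by rw [hdiff]; exact Finset.sdiff_subset⟩⟩
      have hball : ball G y r ⊆ absorb G r R Γ' := fun u hu => by
        by_cases huR : u ∈ R
        · exact subset_absorb r R Γ' huR
        · exact step_subset_absorb r R Γ'
            (Finset.mem_insert_of_mem (Finset.mem_sdiff.2 ⟨hu, huR⟩))
      have hΓR' : Γ ⊆ S₀ ∪ absorb G r R Γ' := fun u hu => by
        refine Finset.mem_union_right _ (hball (Finset.mem_filter.2 ⟨Finset.mem_univ u, ?_⟩))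
        have := hΓy u hu
        omega
      have hout : ∀ z, z ∉ S₀ ∪ absorb G r R Γ' → r < G.dist y z := fun z hz => by
        by_contra hcon
        exact hz (Finset.mem_union_right _
          (hball (Finset.mem_filter.2 ⟨Finset.mem_univ z, not_lt.1 hcon⟩)))
      refine hsmall Γ' hv hΓR' hsm
        ((1 + 8 * (h / ν) ^ 2) * q ^ r * (q⁻¹) ^ (2 * k + 2 * δ)) (by positivity) ?_ ?_
      · have h1 : (q⁻¹) ^ (2 * k + 2 * δ) ≤ (q⁻¹) ^ (4 * k) * (q⁻¹) ^ (3 * (δ - k)) := by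
          rw [← pow_add]
          exact pow_le_pow_right₀ hqi (by omega)
        have hN0 : 0 ≤ N := by linarith
        calc _ ≤ 4 * N * c / ν * (q⁻¹) ^ k * ((1 + 8 * (h / ν) ^ 2) * q ^ r *
              ((q⁻¹) ^ (4 * k) * (q⁻¹) ^ (3 * (δ - k)))) := by gcongr
          _ = 4 * N * c / ν * (q⁻¹) ^ k *
              ((1 + 8 * (h / ν) ^ 2) * q ^ r * (q⁻¹) ^ (4 * k)) *
              (q⁻¹) ^ (3 * (δ - k)) := by ring
          _ ≤ Q * (q⁻¹) ^ (3 * (δ - k)) := by gcongr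
          _ = _ := mul_comm _ _
      · intro hnr Γ₂ hΓ₂ C hC τ hτ
        have habs : absorb G r R Γ' = R ∪ ball G ((centers G r R Γ').min' hsm) r := by
          rw [absorb, dif_pos hsm]
        obtain ⟨z, hzΓ, hz⟩ := Finset.not_subset.1 hΓ₂
        have hzd := hout z hz
        refine hW.norm_lie_heisenberg_le_of_gap_pow (Γ := Γ) (Γ₂ := Γ₂) hε hε1 hh hconn hg
          (hnr _ fun u hu => ?_) hout hΓR' (fun u hu => ?_) (fun u hu => ?_) hN1 ?_ hC₁ hJ₁ hκ
          hq hq1 hν hϑ (hW.term_mem_supp hε.le hε1 Γ) hC hτ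
        · rw [habs] at hu
          simp only [Finset.mem_sdiff, Finset.mem_union, not_or] at hu
          tauto
        · have := hΓy u hu
          omega
        · have h1 := hconn.dist_triangle (u := y) (v := u) (w := z)
          have h2 : G.dist u z ≤ setDiam G Γ₂ := dist_le_setDiam hu hzΓ
          omega
        · rw [habs]
          exact (card_union_sdiff_le _ _ _).trans (hN _)
    · -- long terms
      rw [not_le] at hshort
      obtain ⟨z, hzΓ, hz⟩ := Finset.not_subset.1 hΓS
      rw [Finset.mem_union, not_or] at hz
      set Γ' := insert p Γ with hΓ'
      have hv : ValidStep G r x Γs i Γ' := by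
        refine ⟨?_, ⟨p, by rw [Finset.mem_inter]; exact ⟨by simp [hΓ'], hpR⟩⟩,
          ⟨z, Finset.mem_sdiff.2 ⟨Finset.mem_insert_of_mem hzΓ, hz.2⟩⟩⟩
        rw [hΓ', Finset.disjoint_insert_left]
        exact ⟨hpP, hΓ1⟩
      have hΓR' : Γ ⊆ S₀ ∪ absorb G r R Γ' := fun u hu =>
        Finset.mem_union_right _ (step_subset_absorb r R Γ' (Finset.mem_insert_of_mem hu))
      by_cases hsm : IsSmall G r R Γ'
      · refine hsmall Γ' hv hΓR' hsm 1 zero_le_one ?_ fun _ => hκtriv _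
        have h1 := (hlong δ 1 le_rfl hshort (Or.inl rfl)).1
        rw [pow_one] at h1
        refine le_trans ?_ h1
        rw [mul_one]
        have := hNd δ
        gcongr
      -- The least number of units covering the growth of the radius, which is at most 3/2 of the
      -- diameter.
      · obtain ⟨u, hu1, hu2, hu3⟩ : ∃ u, 1 ≤ u ∧ (u = 1 ∨ 2 * (r + 1) * (u - 1) < 3 * δ) ∧
            3 * δ ≤ 2 * (r + 1) * u := by
          have hex : ∃ u, 1 ≤ u ∧ 3 * δ ≤ 2 * (r + 1) * u := by
            refine ⟨3 * δ + 1, by omega, ?_⟩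
            calc 3 * δ ≤ 1 * (3 * δ + 1) := by omega
              _ ≤ 2 * (r + 1) * (3 * δ + 1) := Nat.mul_le_mul_right _ (by omega)
          classical
          refine ⟨Nat.find hex, (Nat.find_spec hex).1, ?_, (Nat.find_spec hex).2⟩
          by_contra hcon
          rw [not_or, not_lt] at hcon
          have := (Nat.find_spec hex).1
          exact Nat.find_min hex (show Nat.find hex - 1 < Nat.find hex by omega)
            ⟨by omega, hcon.2⟩
        obtain ⟨hl1, hl2⟩ := hlong δ u hu1 hshort (hu2.imp id fun h => ⟨h, hu3⟩)
        -- If this term uses up all remaining units, its weight alone covers them and the trivial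
        -- bound suffices.
        by_cases hUu : n' ≤ U + u
        · refine hsmallQ (hl2.trans ?_)
          refine mul_le_mul_of_nonneg_left ?_ (by positivity)
          exact pow_le_pow_of_le_one hQ.le hQ1 (by omega)
        · have habs : absorb G r R Γ' = R ∪ Γ := by
            rw [absorb, dif_neg hsm, hΓ', Finset.union_insert, Finset.insert_eq_of_mem]
            exact Finset.mem_union_left _ hpR
          have hd : ∀ z ∈ absorb G r R Γ', G.dist x z ≤ (r + 1) * (U + u) := by
            intro z hz
            rw [habs, Finset.mem_union] at hz
            rw [mul_add]
            rcases hz with hz | hz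
            · exact (hRd z hz).trans (Nat.le_add_right _ _)
            · have h1 := hΓx z hz
              rw [mul_assoc] at hu3
              omega
          refine hrec Γ' (U + u) b (hp.extend hv (by omega) hd) hb (by omega) (by omega) hΓR'
            (Nd δ) 1 zero_le_one ?_ (hκtriv _) ?_
          · rw [habs]
            exact (card_union_sdiff_le _ _ _).trans (hNd' Γ)
          · have h1 := mul_pow_sub_le hQ.le hQ1
              (show n' - U - (B - b) ≤ n' - (U + u) - (B - b) + u by omega)
            rw [mul_one]
            calc _ ≤ (q⁻¹) ^ (3 * (δ - k)) * Q ^ u *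
                  (c_b ^ (B - b) * Q ^ (n' - (U + u) - (B - b))) := by gcongr
              _ = (q⁻¹) ^ (3 * (δ - k)) *
                  (c_b ^ (B - b) * (Q ^ u * Q ^ (n' - (U + u) - (B - b)))) := by ring
              _ ≤ _ := by gcongr

end PathSum

/-! ### Terms crossing the boundary of the initial region -/

section Crossing

set_option linter.unusedSectionVars false

variable {Λ : Type} [Fintype Λ] [LinearOrder Λ] {G : SimpleGraph Λ} {k : ℕ} {h ε : ℝ}
  {J : Finset Λ → ℝ} {W : ℕ → Finset Λ → Op Λ} {w : ℕ → ℝ}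

theorem isSmall_singleton {r : ℕ} {x y : Λ} (hxy : G.Adj x y) (P : Finset Λ)
    (hP : P ⊆ ball G y r) : IsSmall G r {x} (insert x P) := by
  refine ⟨y, Finset.mem_filter.2 ⟨mem_boundary.2 ⟨?_, x, by simp, hxy.symm⟩, ?_⟩⟩
  · simpa using hxy.ne'
  · rw [Finset.insert_sdiff_of_mem _ (Finset.mem_singleton_self x)]
    exact Finset.sdiff_subset.trans hP

/-- With path parameter zero, partial non-resonance gives a non-resonant ball next to `x`. -/
theorem PartialNonResonantAt.exists_nonResonantAt {r : ℕ} {g ζ : ℝ} {x y : Λ}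
    (hNR : PartialNonResonantAt G J r g 0 ζ x) (hxy : G.Adj x y) :
    ∃ y', ball G y r \ {x} ⊆ ball G y' r ∧ NonResonantAt G J r g y' := by
  set Γ := insert x (ball G y r) with hΓ
  have hsm : IsSmall G r {x} Γ := isSmall_singleton hxy _ subset_rfl
  refine ⟨(centers G r {x} Γ).min' hsm, ?_, ?_⟩
  · have := (Finset.mem_filter.1 ((centers G r {x} Γ).min'_mem hsm)).2
    exact (Finset.sdiff_subset_sdiff (Finset.subset_insert _ _) subset_rfl).trans this
  · by_contra hcon
    -- With n = 0 every path has a single step, and (1 - ζ) · 0 < 1 forbids that step to be bad.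
    refine hNR 1 (fun _ => Γ) ⟨le_rfl, le_rfl, fun i hi => ?_, fun i hi => absurd hi (by omega),
      Or.inl rfl⟩ ⟨{0}, by simp, by simp, fun i hi => ?_⟩
    · obtain rfl : i = 0 := by omega
      refine ⟨Finset.disjoint_empty_right _, ⟨x, ?_⟩, ⟨y, ?_⟩⟩
      · simp [hΓ, region]
      · simp [hΓ, region, hxy.ne', ball]
    · rw [Finset.mem_singleton.1 hi]
      exact ⟨hsm, hcon⟩

namespace LocalSeries

variable (hW : LocalSeries G k h ε J W w)

include hW

/-- Crossing terms when a single non-resonant ball reaches from `S₀` to `S₁`. -/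
theorem norm_lie_heisenberg_le_single (hε : 0 < ε)
    (hε1 : ε ≤ 1) (hh : 0 < h) (hconn : G.Connected) {q ν C₁ κ N g ζ : ℝ} {D : ℕ}
    (hq : 0 < q) (hq1 : q ≤ 1) (hν : 0 < ν)
    (hN1 : 1 ≤ N) (hN : ∀ y, ((ball G y (D - 1)).card : ℝ) ≤ N) (hC₁ : 1 ≤ C₁)
    (hJ₁ : ∀ v, ∑ S ∈ Finset.univ.filter (fun S => v ∈ S), ‖W 0 S‖ ≤ C₁ * h)
    (hg : 0 < g) {S₀ S₁ : Finset Λ}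
    (hNR : 2 ≤ D → ∀ x ∈ boundary G S₀, PartialNonResonantAt G J (D - 1) g 0 ζ x)
    (hκ : 1 + 2 * (√spacingConst / g) * N * h ≤ κ)
    (hϑ : 2 ≤ D → 8 * N ^ 2 * C₁ * κ * ε ≤ q ^ (2 * k + 3)) (hSS : Disjoint S₀ S₁)
    (hD : ∀ x ∈ S₀, ∀ z ∈ S₁, D ≤ G.dist x z) {A : Op Λ} (hA : A ∈ supp S₁)
    {Γ : Finset Λ} (hΓ₁ : ¬Disjoint Γ S₀) (hΓ₂ : ¬Γ ⊆ S₀) {s : ℝ} (hs : 0 ≤ s) :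
    ‖⁅term W Γ, heisenberg (ham W S₀) s A⁆‖ ≤
      ‖term W Γ‖ * (q⁻¹) ^ (3 * (setDiam G Γ - k)) *
        (2 * ‖A‖ * (1 + 8 * (h / ν) ^ 2) * (q ^ D * (q⁻¹) ^ (5 * k))) * Real.exp (ν * s) := by
  have hqi : 1 ≤ q⁻¹ := (one_le_inv₀ hq).2 hq1
  obtain ⟨p, hpΓ, hp⟩ := Finset.not_disjoint_iff.1 hΓ₁
  obtain ⟨z, hzΓ, hz⟩ := Finset.not_subset.1 hΓ₂
  obtain ⟨x, hx, y, hy, hxy, -, hyΓ, -⟩ := exists_crossing hconn hp hpΓ hz hzΓ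
  set δ := setDiam G Γ with hδ
  have hδ1 := hyΓ z hzΓ
  have hes : 1 ≤ Real.exp (ν * s) := Real.one_le_exp (by positivity)
  have hpow : ∀ e, e ≤ 5 * k + 3 * (δ - k) →
      q ^ D * (q⁻¹) ^ e ≤ (q⁻¹) ^ (3 * (δ - k)) * (q ^ D * (q⁻¹) ^ (5 * k)) := fun e he => by
    have : (q⁻¹) ^ e ≤ (q⁻¹) ^ (5 * k) * (q⁻¹) ^ (3 * (δ - k)) := by
      rw [← pow_add]
      exact pow_le_pow_right₀ hqi he
    calc _ ≤ q ^ D * ((q⁻¹) ^ (5 * k) * (q⁻¹) ^ (3 * (δ - k))) := by gcongr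
      _ = _ := by ring
  have hh1 : 1 ≤ 1 + 8 * (h / ν) ^ 2 := le_add_of_nonneg_right (by positivity)
  by_cases hDδ : D ≤ 2 * δ + 1
  -- A term whose diameter is comparable with half of D is paid for by its own weight.
  · refine (hW.norm_lie_heisenberg_le_trivial hε.le hε1 _ _ A s).trans ?_
    have h1 := hpow D (by omega)
    rw [inv_pow, mul_inv_cancel₀ (by positivity)] at h1
    calc 2 * ‖term W Γ‖ * ‖A‖ = ‖term W Γ‖ * (2 * ‖A‖ * 1) * 1 * 1 := by ring
      _ ≤ ‖term W Γ‖ * (2 * ‖A‖ * (1 + 8 * (h / ν) ^ 2)) *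
          ((q⁻¹) ^ (3 * (δ - k)) * (q ^ D * (q⁻¹) ^ (5 * k))) * Real.exp (ν * s) := by gcongr
      _ = _ := by ring
  rw [not_le] at hDδ
  have hxS : x ∈ S₀ := (mem_boundary.1 hx).1
  obtain ⟨y', hy', hnr⟩ := (hNR (by omega) x hx).exists_nonResonantAt hxy
  have hyS : ∀ z ∈ S₁, D ≤ G.dist y z + 1 := fun z hz => by
    have h1 := hD x hxS z hz
    have h2 := hconn.dist_triangle (u := x) (v := y) (w := z)
    rw [SimpleGraph.dist_eq_one_iff_adj.2 hxy] at h2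
    omega
  -- S₁ is cut out so that A stays outside. As y is adjacent to S₀, its distance to S₁ is at least D
  -- - 1, so cutting reduces the usable radius only from D - 1 to D - 2.
  set Rp := S₀ ∪ (ball G y (D - 1) \ S₁) with hRp
  have hsub : Rp \ S₀ ⊆ ball G y (D - 1) := fun u hu => by
    simp only [hRp, Finset.mem_sdiff, Finset.mem_union] at hu
    tauto
  have hout : ∀ z, z ∉ Rp → D - 2 < G.dist y z := fun z hz => by
    by_cases hzS : z ∈ S₁
    · have := hyS z hzS
      omega
    · by_contra hcon
      refine hz (Finset.mem_union_right _ (Finset.mem_sdiff.2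
        ⟨Finset.mem_filter.2 ⟨Finset.mem_univ z, by omega⟩, hzS⟩))
  have hAs : A ∈ supp (Rpᶜ ∪ ∅) := by
    rw [Finset.union_empty]
    refine supp_mono (Finset.subset_compl_iff_disjoint_left.2 ?_) hA
    rw [hRp, Finset.disjoint_union_left]
    exact ⟨hSS, Finset.sdiff_disjoint⟩
  have hΓR : Γ ⊆ Rp := fun u hu => by
    have h1 := hyΓ u hu
    by_contra hcon
    have := hout u hcon
    omega
  have h1 := hW.norm_lie_heisenberg_le_of_gap_pow (R := S₀) (Rp := Rp) (Γ := Γ) (Γ₂ := ∅)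
    (e₁ := 2 * δ - 1) (d₂ := 0) (X := term W Γ) (C := A) hε hε1 hh hconn hg
    (hnr _ fun u hu => hy' (Finset.mem_sdiff.2 ⟨hsub hu, fun hux => ?_⟩)) hout hΓR
    (fun u hu => by have := hyΓ u hu; omega) (fun u hu => absurd hu (Finset.notMem_empty u)) hN1
    ((Nat.cast_le.2 (Finset.card_le_card hsub)).trans (hN y)) hC₁ hJ₁ hκ hq hq1 hν (hϑ (by omega))
    (hW.term_mem_supp hε.le hε1 Γ) hAs hs
  · refine h1.trans ?_
    have h2 : q ^ (D - 2) * (q⁻¹) ^ (2 * k + (2 * δ - 1)) =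
        q ^ D * (q⁻¹) ^ (2 * k + 2 * δ + 1) := by
      rw [show D = D - 2 + 2 by omega, show 2 * k + 2 * δ + 1 = 2 * k + (2 * δ - 1) + 2 by omega,
        pow_add q, pow_add q⁻¹ _ 2]
      simp only [Nat.add_sub_cancel]
      field_simp
    have h3 : Real.exp (ν / 2 * s) ≤ Real.exp (ν * s) := by
      apply Real.exp_le_exp.2
      have : 0 ≤ ν * s := by positivity
      linarith
    calc _ = 2 * ‖term W Γ‖ * ‖A‖ * (1 + 8 * (h / ν) ^ 2) *
          (q ^ (D - 2) * (q⁻¹) ^ (2 * k + (2 * δ - 1))) * Real.exp (ν / 2 * s) := by ring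
      _ ≤ 2 * ‖term W Γ‖ * ‖A‖ * (1 + 8 * (h / ν) ^ 2) *
          ((q⁻¹) ^ (3 * (δ - k)) * (q ^ D * (q⁻¹) ^ (5 * k))) * Real.exp (ν * s) := by
          rw [h2]
          have := hpow (2 * k + 2 * δ + 1) (by omega)
          gcongr
      _ = _ := by ring
  · rw [Finset.mem_singleton.1 hux] at hu
    exact (Finset.mem_sdiff.1 hu).2 hxS

/-- Crossing terms when many balls fit between `S₀` and `S₁`. -/
theorem norm_lie_heisenberg_le_many (hε : 0 < ε)
    (hε1 : ε ≤ 1) (hh : 0 < h) (hconn : G.Connected) {q c ν C₁ κ N g ζ : ℝ} {r n : ℕ}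
    (hq : 0 < q) (hq1 : q ≤ 1) (hw : WeightLE G W k q c) (hc : 0 ≤ c) (hν : 0 < ν)
    (hN1 : 1 ≤ N) (hN : ∀ y, ((ball G y r).card : ℝ) ≤ N) (hC₁ : 1 ≤ C₁)
    (hJ₁ : ∀ v, ∑ S ∈ Finset.univ.filter (fun S => v ∈ S), ‖W 0 S‖ ≤ C₁ * h)
    (hg : 0 < g) {S₀ S₁ : Finset Λ}
    (hNR : ∀ x ∈ boundary G S₀, PartialNonResonantAt G J r g n ζ x)
    (hκ : 1 + 2 * (√spacingConst / g) * N * h ≤ κ)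
    (hϑ : 8 * N ^ 2 * C₁ * κ * ε ≤ q ^ (2 * k + 3)) (hSS : Disjoint S₀ S₁) (hS₁ : S₁.Nonempty)
    (hD : ∀ x ∈ S₀, ∀ z ∈ S₁, n * (r + 1) < G.dist x z) {A : Op Λ} (hA : A ∈ supp S₁)
    {n' B : ℕ} (hn' : n' ≤ n) (hreach : ∀ U < n', (r + 1) * U < n * r)
    (hB : ∀ b : ℕ, (b : ℝ) ≤ (1 - ζ) * n → b ≤ B)
    {c_b Q : ℝ} (hcb1 : 1 ≤ c_b) (hQ : 0 < Q) (hQ1 : Q ≤ 1)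
    (hcb : 4 * N * c / ν * (q⁻¹) ^ k ≤ c_b)
    (hgood : 4 * N * c / ν * (q⁻¹) ^ k *
      ((1 + 8 * (h / ν) ^ 2) * q ^ r * (q⁻¹) ^ (4 * k)) ≤ Q)
    {Nd : ℕ → ℝ} (hNd : ∀ δ, N ≤ Nd δ) (hNd' : ∀ Γ : Finset Λ, (Γ.card : ℝ) ≤ Nd (setDiam G Γ))
    (hlong : ∀ δ u : ℕ, 1 ≤ u → r < 2 * δ → (u = 1 ∨ 2 * (r + 1) * (u - 1) < 3 * δ ∧ 3 * δ ≤ 2 * (r + 1) * u) →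
      4 * Nd δ * c / ν * (q⁻¹) ^ k ≤ (q⁻¹) ^ (3 * (δ - k)) * Q ^ u ∧
        1 ≤ (q⁻¹) ^ (3 * (δ - k)) * Q ^ u)
    {Γ : Finset Λ} (hΓ₁ : ¬Disjoint Γ S₀) (hΓ₂ : ¬Γ ⊆ S₀) {s : ℝ} (hs : 0 ≤ s) :
    ‖⁅term W Γ, heisenberg (ham W S₀) s A⁆‖ ≤
      ‖term W Γ‖ * (q⁻¹) ^ (3 * (setDiam G Γ - k)) *
        (2 * ‖A‖ * (c_b ^ B * Q ^ (n' - B))) * Real.exp (ν * s) := by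
  obtain ⟨p, hpΓ, hp⟩ := Finset.not_disjoint_iff.1 hΓ₁
  obtain ⟨z, hzΓ, hz⟩ := Finset.not_subset.1 hΓ₂
  obtain ⟨x, hx, y, hy, hxy, -, hyΓ, hxΓ⟩ := exists_crossing hconn hp hpΓ hz hzΓ
  have hxS : x ∈ S₀ := (mem_boundary.1 hx).1
  have hyS : y ∉ S₀ := by simpa using (mem_boundary.1 hy).1
  have hun : S₀ ∪ region G r {x} (fun _ => ∅) 0 = S₀ := by
    rw [region, Finset.union_singleton, Finset.insert_eq_of_mem hxS]
  -- The empty prefix at x: no unit and no bad step used; its region {x} is contained in S₀.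
  have h0 : PathPrefix G J r g x 0 (fun _ => ∅) 0 0 :=
    ⟨fun j hj => absurd hj (Nat.not_lt_zero j), ⟨∅, by simp, rfl, by simp⟩,
      fun z hz => by rw [region, Finset.mem_singleton] at hz; simp [hz], le_rfl⟩
  have h1 := hW.norm_lie_heisenberg_le_path hε hε1 hh hconn hq hq1 hw hc hν hN1 hN hC₁ hJ₁ hg
    (hNR x hx) hκ hϑ hSS hS₁ (hD x hxS) hA hn' hreach hB hcb1 hQ hQ1 hcb hgood hNd hNd' hlong n'
    0 (fun _ => ∅) 0 0 h0 (Nat.zero_le B) (by omega) Γ x y (Finset.disjoint_empty_right _)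
    (by simp [region]) (by simp [prevRegion])
    (mem_boundary.2 ⟨by simpa [region] using hxy.ne', x, by simp [region], hxy.symm⟩)
    hyΓ (fun u hu => by have := hxΓ u hu; omega) (by rw [hun]; exact hΓ₂) s hs
  rw [hun] at h1
  simpa [mul_assoc] using h1

end LocalSeries

end Crossing

/-! ### Numerical estimates -/

section Numerics

/-- The exponent `γ` in the decay rate `q = (b ε) ^ γ e ^ {-L}`. -/
def decayExp (k : ℕ) : ℝ := 3 / (4 * (2 * k + 3))

theorem decayExp_pos (k : ℕ) : 0 < decayExp k := by
  rw [decayExp]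
  positivity

/-- This is where α < 1/(5k+1) enters, through 1/(5k+1) ≤ 3/(2k+3). -/
theorem lt_decayExp {k : ℕ} {α : ℝ} (hα1 : α < 1 / (5 * (k : ℝ) + 1)) :
    α / 4 < decayExp k := by
  have h1 : 1 / (5 * (k : ℝ) + 1) ≤ 3 / (2 * k + 3) := by
    rw [div_le_div_iff₀ (by positivity) (by positivity)]
    have : (0 : ℝ) ≤ k := by positivity
    linarith
  have h2 : decayExp k = 3 / (2 * k + 3) / 4 := by
    rw [decayExp]
    field_simp
  rw [h2]
  linarith

/-- All three inequalities hold for large r by comparison of leading terms. In the second, moving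
3ζα/16 to the left gives (2 + 2ζ)α/16 ≤ α/4 < γ. The number η, half of the relative slack, is the
fraction of the good steps that may be lost to rounding. -/
theorem exists_scale {γ α ζ : ℝ} (k : ℕ) (hα : 0 < α) (hζ : 0 < ζ) (hζ1 : ζ ≤ 1)
    (hγ : α / 4 < γ) :
    ∃ η r₀ : ℝ, 0 < η ∧ η ≤ 1 / 2 ∧ 3 ≤ r₀ ∧ 5 * k ≤ r₀ ∧ ∀ r, r₀ ≤ r →
      1 ≤ η * ζ * (r + 1) ∧
      (2 - ζ) * (α * (r + 1) / 16) + (1 - ζ) * (k * γ) / ζ ≤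
        (1 - η) * (γ * (r - 5 * k) - 3 * (ζ * (α * (r + 1) / 16))) ∧
      k + ζ * r / 8 ≤ (1 - η) * ζ * (r - 5 * k) := by
  have hγ0 : 0 < γ := by linarith
  set δ := γ - α / 4 with hδ
  have hδ0 : 0 < δ := by linarith
  set η := δ / (2 * γ) with hη
  have hη0 : 0 < η := by positivity
  have hηγ : η * γ = δ / 2 := by
    rw [hη]
    field_simp
  have hη2 : η ≤ 1 / 2 := by
    rw [hη, div_le_div_iff₀ (by positivity) (by norm_num)]
    linarith
  have hk : (0 : ℝ) ≤ k := by positivity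
  set K := (2 - ζ) * (α / 16) + (1 - ζ) * (k * γ) / ζ + 5 * k * γ + 3 * (ζ * (α / 16)) with hK
  have h1ζ : 0 ≤ 1 - ζ := by linarith
  have hK0 : 0 ≤ K := by
    have : 0 ≤ 2 - ζ := by linarith
    positivity
  have hA : 0 ≤ 1 / (η * ζ) := by positivity
  have hB : 0 ≤ 2 / δ * K := by positivity
  have hC : 0 ≤ 8 / (3 * ζ) * (k + 5 * k) := by positivity
  refine ⟨η, 3 + 5 * k + 1 / (η * ζ) + 2 / δ * K + 8 / (3 * ζ) * (k + 5 * k), hη0, hη2,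
    by linarith, by linarith, fun r hr => ⟨?_, ?_, ?_⟩⟩
  · have h1 : 1 / (η * ζ) ≤ r + 1 := by linarith
    rw [div_le_iff₀ (by positivity)] at h1
    linarith
  · have h1 : 2 / δ * K ≤ r := by linarith
    have h2 : K ≤ δ / 2 * r := by
      calc K = δ / 2 * (2 / δ * K) := by field_simp
        _ ≤ _ := by gcongr
    have hr0 : 0 ≤ r := by linarith
    have h3 : η * (γ * (r - 5 * k) - 3 * (ζ * (α * (r + 1) / 16))) ≤ δ / 2 * r := by
      rw [← hηγ, mul_assoc]
      refine mul_le_mul_of_nonneg_left ?_ hη0.le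
      have h4 : 0 ≤ 3 * (ζ * (α * (r + 1) / 16)) := by positivity
      have h5 : 0 ≤ γ * (5 * k) := by positivity
      rw [mul_sub]
      linarith
    have h6 : (2 + 2 * ζ) * (α / 16) * r ≤ α / 4 * r := by
      refine mul_le_mul_of_nonneg_right ?_ hr0
      nlinarith
    have h7 : γ * r = α / 4 * r + δ * r := by rw [hδ]; ring
    have e3 : ∀ z : ℝ, (1 - η) * z = z - η * z := fun z => by ring
    rw [e3]
    have e1 : (2 - ζ) * (α * (r + 1) / 16) = (2 - ζ) * (α / 16) * r + (2 - ζ) * (α / 16) := by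
      ring
    have e2 : γ * (r - 5 * k) - 3 * (ζ * (α * (r + 1) / 16)) =
        γ * r - 5 * k * γ - 3 * ζ * (α / 16) * r - 3 * (ζ * (α / 16)) := by ring
    rw [e1]
    rw [e2] at h3 ⊢
    linarith
  · have h1 : 8 / (3 * ζ) * (k + 5 * k) ≤ r := by linarith
    have h2 : k + 5 * k ≤ 3 * ζ / 8 * r := by
      calc (k : ℝ) + 5 * k = 3 * ζ / 8 * (8 / (3 * ζ) * (k + 5 * k)) := by field_simp
        _ ≤ _ := by gcongr
    have h3 : 0 ≤ r - 5 * k := by linarith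
    have h4 : 1 / 2 * ζ * (r - 5 * k) ≤ (1 - η) * ζ * (r - 5 * k) := by
      gcongr
      linarith
    nlinarith

/-- The logarithms of Q and of e^x c_b^B Q^θ. The terms proportional to l = log(1/(bε)) balance by
the choice of α and of the scale (`T1`); those independent of l are made negative by a large L,
which also produces the decay e^{-μD} (`T2`). -/
theorem exponent_many_le {γ α ζ η μ x l L Λ r n B θ D k : ℝ} (hα : 0 ≤ α) (hζ : 0 < ζ)
    (hk : 0 ≤ k) (hγ : 0 ≤ γ) (hμ : 0 ≤ μ) (hΛ : 0 ≤ Λ) (hL : 0 ≤ L) (hl : 0 ≤ l)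
    (hx : x ≤ ζ * (α * (r + 1) / 16) * l) (hr1 : 1 ≤ r) (hkr : 5 * k ≤ r)
    (hζ1 : ζ ≤ 1) (hη0 : 0 ≤ η) (hη : η ≤ 1 / 2)
    (hG : (2 - ζ) * (α * (r + 1) / 16) + (1 - ζ) * (k * γ) / ζ ≤
        (1 - η) * (γ * (r - 5 * k) - 3 * (ζ * (α * (r + 1) / 16))))
    (hr : k + ζ * r / 8 ≤ (1 - η) * ζ * (r - 5 * k)) (hn : 1 ≤ n) (hB0 : 0 ≤ B)
    (hB : B ≤ (1 - ζ) * n) (hθ : (1 - η) * ζ * n ≤ θ) (hθn : θ ≤ n)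
    (hD : D ≤ 2 * n * (r + 1)) (hLΛ : 8 / ζ * (2 * Λ + 4 * μ) ≤ L) :
    Λ * r + 3 * x - (r - 5 * k) * (γ * l + L) ≤ 0 ∧ x + B * (Λ * r + x + k * (γ * l + L)) +
      θ * (Λ * r + 3 * x - (r - 5 * k) * (γ * l + L)) ≤ -(μ * D) := by
  set σ := ζ * (α * (r + 1) / 16) with hσ
  have hσ0 : 0 ≤ σ := by positivity
  set F := γ * (r - 5 * k) - 3 * σ with hF
  have hη1 : 0 ≤ 1 - η := by linarith
  have hn0 : 0 ≤ n := by linarith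
  have hθ0 : 0 ≤ θ := le_trans (by positivity) hθ
  have h1ζ : 0 ≤ 1 - ζ := by linarith
  have hG' : (2 - ζ) * σ + (1 - ζ) * (k * γ) ≤ (1 - η) * ζ * F := by
    have := mul_le_mul_of_nonneg_left hG hζ.le
    calc (2 - ζ) * σ + (1 - ζ) * (k * γ) =
          ζ * ((2 - ζ) * (α * (r + 1) / 16) + (1 - ζ) * (k * γ) / ζ) := by
          rw [hσ]; field_simp
      _ ≤ _ := this
      _ = _ := by ring
  have hF0 : 0 ≤ F := by
    have h1 : 0 ≤ (2 - ζ) * σ + (1 - ζ) * (k * γ) := by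
      have : 0 ≤ 2 - ζ := by linarith
      positivity
    have h2 : 0 < (1 - η) * ζ := by
      have : 0 < 1 - η := by linarith
      positivity
    by_contra hcon
    rw [not_le] at hcon
    nlinarith
  have hBn : B ≤ n := by nlinarith
  have T1 : x * (1 + B + 3 * θ) + B * k * (γ * l) - θ * (r - 5 * k) * (γ * l) ≤ 0 := by
    have h1 : x * (1 + B + 3 * θ) ≤ σ * l * (1 + B + 3 * θ) := by gcongr
    have h2 : σ * (1 + B) + B * (k * γ) ≤ θ * F := by
      have h3 : σ * (1 + B) ≤ σ * ((2 - ζ) * n) := by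
        gcongr
        nlinarith
      have h4 : B * (k * γ) ≤ (1 - ζ) * n * (k * γ) := by gcongr
      have h5 : (1 - η) * ζ * n * F ≤ θ * F := by gcongr
      have h6 := mul_le_mul_of_nonneg_left hG' hn0
      linarith
    have h7 := mul_le_mul_of_nonneg_right h2 hl
    have h8 : θ * F * l = θ * (r - 5 * k) * (γ * l) - 3 * θ * σ * l := by rw [hF]; ring
    linarith
  have T2 : B * (Λ * r) + B * k * L + θ * (Λ * r) - θ * (r - 5 * k) * L ≤ -(μ * D) := by
    have hΛr : 0 ≤ Λ * r := by positivity
    have h1 : B * (Λ * r) ≤ n * (Λ * r) := by gcongr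
    have h2 : B * k * L ≤ n * k * L := by gcongr
    have h3 : θ * (Λ * r) ≤ n * (Λ * r) := by gcongr
    have hr5 : 0 ≤ r - 5 * k := by linarith
    have h4 : n * (k + ζ * r / 8) * L ≤ θ * (r - 5 * k) * L := by
      refine mul_le_mul_of_nonneg_right ?_ hL
      calc n * (k + ζ * r / 8) ≤ n * ((1 - η) * ζ * (r - 5 * k)) := by gcongr
        _ = (1 - η) * ζ * n * (r - 5 * k) := by ring
        _ ≤ _ := by gcongr
    have h5 : 2 * Λ + 4 * μ ≤ ζ / 8 * L := by
      calc 2 * Λ + 4 * μ = ζ / 8 * (8 / ζ * (2 * Λ + 4 * μ)) := by field_simp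
        _ ≤ _ := by gcongr
    have h6 := mul_le_mul_of_nonneg_left h5 (show 0 ≤ n * r by positivity)
    have h7 : μ * D ≤ μ * (n * (4 * r)) := by
      refine mul_le_mul_of_nonneg_left (hD.trans ?_) hμ
      calc 2 * n * (r + 1) ≤ 2 * n * (r + r) := by gcongr
        _ = n * (4 * r) := by ring
    linarith
  refine ⟨?_, by linarith⟩
  have h1 : Λ * r ≤ (r - 5 * k) * L := by
    have h2 : Λ ≤ ζ / 8 * L := by
      calc Λ ≤ 2 * Λ + 4 * μ := by linarith
        _ = ζ / 8 * (8 / ζ * (2 * Λ + 4 * μ)) := by field_simp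
        _ ≤ _ := by gcongr
    have h3 : k + ζ * r / 8 ≤ r - 5 * k := by
      refine hr.trans (mul_le_of_le_one_left (by linarith) ?_)
      exact mul_le_one₀ (by linarith) hζ.le hζ1
    calc Λ * r ≤ ζ / 8 * L * r := by gcongr
      _ = (ζ * r / 8) * L := by ring
      _ ≤ (r - 5 * k) * L := by
          gcongr
          linarith
  have h2 : 0 ≤ F * l := mul_nonneg hF0 hl
  have h3 : F * l = γ * (r - 5 * k) * l - 3 * (σ * l) := by rw [hF]; ring
  linarith

theorem pow_le_exp_mul {M : ℝ} (hM : 1 ≤ M) (d : ℕ) {r : ℕ} (hr : 1 ≤ r) :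
    M * (r : ℝ) ^ d ≤ Real.exp ((Real.log M + d) * r) := by
  have hr' : (1 : ℝ) ≤ r := by exact_mod_cast hr
  have h1 : M ≤ Real.exp (Real.log M * r) := by
    conv_lhs => rw [← Real.exp_log (by linarith : 0 < M)]
    exact Real.exp_le_exp.2 (le_mul_of_one_le_right (Real.log_nonneg hM) hr')
  have h2 : (r : ℝ) ^ d ≤ Real.exp (d * r) := by
    rw [Real.exp_nat_mul]
    refine pow_le_pow_left₀ (by positivity) ?_ d
    have := Real.add_one_le_exp (r : ℝ)
    linarith
  rw [add_mul, Real.exp_add]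
  gcongr

theorem exists_bdd_stretched {ξ κ : ℝ} (hξ : 0 < ξ) (hκ : 0 < κ) (d : ℕ) :
    ∃ K : ℝ, 0 < K ∧ ∀ r : ℕ, (r : ℝ) ^ d * Real.exp (-κ * (r : ℝ) ^ ξ) ≤ K := by
  have h1 : Filter.Tendsto (fun r : ℕ => (r : ℝ) ^ d * Real.exp (-κ * (r : ℝ) ^ ξ))
      Filter.atTop (nhds 0) := by
    have h2 := (tendsto_rpow_mul_exp_neg_mul_atTop_nhds_zero (d / ξ) κ hκ).comp
      ((tendsto_rpow_atTop hξ).comp tendsto_natCast_atTop_atTop)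
    refine h2.congr fun r => ?_
    simp only [Function.comp]
    rw [← Real.rpow_mul (by positivity), mul_div_cancel₀ _ hξ.ne', Real.rpow_natCast]
  obtain ⟨K, hK⟩ := h1.bddAbove_range
  refine ⟨max K 1, by positivity, fun r => (hK ⟨r, rfl⟩).trans (le_max_left _ _)⟩

/-- By the choice of `decayExp`, q^{2k+3} is (bε)^{3/4} up to a constant. The remaining (bε)^{1/4}
pays for the inverse gap: up to r_*(ε) it is at most e^{-c' r^ξ}, which beats e^{c r^ξ} times the
volume factors because c < c'. -/
theorem exists_coupling {ξ a c c' M C₁ s L : ℝ} (k d : ℕ) (hξ : 0 < ξ) (ha : 0 < a)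
    (hc : 0 < c) (hc' : c < c') (hM : 1 ≤ M) (hC₁ : 1 ≤ C₁) (hs : 0 ≤ s) (hL : 0 ≤ L) (r₀ : ℕ) :
    ∃ b : ℝ, 1 ≤ b ∧ ∀ ε : ℝ, 0 < ε → b * ε ≤ 1 →
      ε ≤ Real.exp (-(decayExp k * Real.log ((b * ε)⁻¹) + L)) ^ 4 ∧
      ∀ r : ℕ, 1 ≤ r → (r ≤ r₀ ∨ (r : ℝ) ≤ (Real.log ((b * ε)⁻¹) / (4 * c')) ^ (1 / ξ)) →
        8 * (M * (r : ℝ) ^ d) ^ 2 * C₁ *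
          (1 + 2 * (s / (a * Real.exp (-c * (r : ℝ) ^ ξ))) * (M * (r : ℝ) ^ d)) * ε ≤
        Real.exp (-(decayExp k * Real.log ((b * ε)⁻¹) + L)) ^ (2 * k + 3) := by
  obtain ⟨K, hK0, hK⟩ := exists_bdd_stretched hξ (sub_pos.2 hc') (3 * d)
  set K₀ := 8 * M ^ 2 * C₁ * (1 + 2 * (s / a) * M) * Real.exp ((2 * k + 3) * L) with hK₀
  have hM0 : 0 < M := by linarith
  have hC0 : 0 < C₁ := by linarith
  have hK₀0 : 0 ≤ K₀ := by positivity
  set P := (r₀ : ℝ) ^ (3 * d) * Real.exp (c * (r₀ : ℝ) ^ ξ) with hP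
  have hP0 : 0 ≤ P := by positivity
  -- The first summand gives ε ≤ q⁴. In the second, K serves the scales up to r_*(ε) and P the
  -- finitely many scales up to r₀, which may exceed r_*(ε).
  set b := Real.exp (4 * L) + K₀ * (K + P) with hb
  have hb1 : 1 ≤ b := by
    have h1 : 1 ≤ Real.exp (4 * L) := Real.one_le_exp (by positivity)
    have h2 : 0 ≤ K₀ * (K + P) := by positivity
    linarith
  have hb0 : 0 < b := by linarith
  refine ⟨b, hb1, fun ε hε hbε => ?_⟩
  set l := Real.log ((b * ε)⁻¹) with hl
  have hl0 : 0 ≤ l := Real.log_nonneg ((one_le_inv₀ (by positivity)).2 hbε)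
  have hεl : ε = Real.exp (-l) / b := by
    rw [hl, Real.log_inv, neg_neg, Real.exp_log (by positivity)]
    field_simp
  constructor
  · rw [← Real.exp_nat_mul, hεl, div_le_iff₀ hb0]
    have h1 : Real.exp (4 * L) ≤ b := by
      have h2 : 0 ≤ K₀ * (K + P) := by positivity
      linarith
    refine le_trans ?_ (mul_le_mul_of_nonneg_left h1 (Real.exp_pos _).le)
    rw [← Real.exp_add]
    apply Real.exp_le_exp.2
    have h3 : 4 * decayExp k ≤ 1 := by
      rw [decayExp, ← mul_div_assoc, div_le_one (by positivity)]
      have : (0 : ℝ) ≤ k := by positivity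
      linarith
    have h4 := mul_le_mul_of_nonneg_right h3 hl0
    push_cast
    linarith
  · intro r hr1 hr
    have hr1' : (1 : ℝ) ≤ r := by exact_mod_cast hr1
    set X := c * (r : ℝ) ^ ξ with hX
    have hX0 : 0 ≤ X := by positivity
    have hmain : (r : ℝ) ^ (3 * d) * Real.exp X * Real.exp (-(l / 4)) ≤ K + P := by
      rcases hr with hr | hr
      · have h1 : (r : ℝ) ^ (3 * d) * Real.exp X ≤ P := by
          have : (r : ℝ) ≤ r₀ := by exact_mod_cast hr
          rw [hP, hX]
          gcongr
        have h2 : Real.exp (-(l / 4)) ≤ 1 := Real.exp_le_one_iff.2 (by linarith)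
        calc _ ≤ P * 1 := by gcongr
          _ ≤ _ := by linarith
      · have hc'0 : 0 < c' := by linarith
        have h1 : (r : ℝ) ^ ξ ≤ l / (4 * c') := by
          have h2 := Real.rpow_le_rpow (by positivity) hr hξ.le
          rwa [← Real.rpow_mul (by positivity), one_div_mul_cancel hξ.ne', Real.rpow_one] at h2
        rw [le_div_iff₀ (by positivity)] at h1
        have h3 : Real.exp X * Real.exp (-(l / 4)) ≤
            Real.exp (-(c' - c) * (r : ℝ) ^ ξ) := by
          rw [← Real.exp_add]
          apply Real.exp_le_exp.2
          rw [hX]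
          linarith
        calc _ = (r : ℝ) ^ (3 * d) * (Real.exp X * Real.exp (-(l / 4))) := by ring
          _ ≤ (r : ℝ) ^ (3 * d) * Real.exp (-(c' - c) * (r : ℝ) ^ ξ) := by gcongr
          _ ≤ K := hK r
          _ ≤ _ := by linarith
    have hκ : 1 + 2 * (s / (a * Real.exp (-c * (r : ℝ) ^ ξ))) * (M * (r : ℝ) ^ d) ≤
        (1 + 2 * (s / a) * M) * ((r : ℝ) ^ d * Real.exp X) := by
      have e : s / (a * Real.exp (-c * (r : ℝ) ^ ξ)) = s / a * Real.exp X := by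
        rw [neg_mul, ← hX, Real.exp_neg]
        field_simp
      have h1 : 1 ≤ (r : ℝ) ^ d * Real.exp X :=
        one_le_mul_of_one_le_of_one_le (one_le_pow₀ hr1') (Real.one_le_exp hX0)
      rw [e]
      nlinarith
    have hexp : Real.exp (-(decayExp k * l + L)) ^ (2 * k + 3) =
        Real.exp (-(3 / 4 * l)) * Real.exp (-((2 * k + 3) * L)) := by
      rw [← Real.exp_nat_mul, ← Real.exp_add]
      congr 1
      rw [decayExp]
      push_cast
      field_simp
      ring
    have hεl' : ε = Real.exp (-(3 / 4 * l)) * Real.exp (-(l / 4)) / b := by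
      rw [← Real.exp_add, hεl]
      congr 2
      ring
    rw [hexp]
    calc _ ≤ 8 * (M * (r : ℝ) ^ d) ^ 2 * C₁ *
          ((1 + 2 * (s / a) * M) * ((r : ℝ) ^ d * Real.exp X)) * ε := by gcongr
      _ = 8 * M ^ 2 * C₁ * (1 + 2 * (s / a) * M) * ((r : ℝ) ^ (3 * d) * Real.exp X) * ε := by
          ring
      _ = Real.exp (-(3 / 4 * l)) * (8 * M ^ 2 * C₁ * (1 + 2 * (s / a) * M) *
          ((r : ℝ) ^ (3 * d) * Real.exp X * Real.exp (-(l / 4)))) / b := by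
          rw [hεl']; ring
      _ ≤ Real.exp (-(3 / 4 * l)) * (8 * M ^ 2 * C₁ * (1 + 2 * (s / a) * M) * (K + P)) / b := by
          gcongr
      _ = Real.exp (-(3 / 4 * l)) * (K₀ * Real.exp (-((2 * k + 3) * L)) * (K + P)) / b := by
          rw [hK₀, mul_assoc _ (Real.exp _) (Real.exp _), ← Real.exp_add, add_neg_cancel,
            Real.exp_zero, mul_one]
      _ = Real.exp (-(3 / 4 * l)) * Real.exp (-((2 * k + 3) * L)) * (K₀ * (K + P) / b) := by
          ring
      _ ≤ Real.exp (-(3 / 4 * l)) * Real.exp (-((2 * k + 3) * L)) * 1 := by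
          refine mul_le_mul_of_nonneg_left ?_ (by positivity)
          refine div_le_one_of_le₀ ?_ hb0.le
          have := Real.exp_pos (4 * L)
          linarith
      _ = _ := mul_one _

end Numerics

/-! ### The three regimes -/

section Regimes

set_option linter.unusedSectionVars false

variable {Λ : Type} [Fintype Λ] [LinearOrder Λ] {G : SimpleGraph Λ} {k d : ℕ} {h ε M : ℝ}
  {J : Finset Λ → ℝ} {W : ℕ → Finset Λ → Op Λ} {w : ℕ → ℝ}

theorem PartialNonResonantAt.mono {r n : ℕ} {g g' ζ : ℝ} {x : Λ}
    (hNR : PartialNonResonantAt G J r g n ζ x) (hg : g' ≤ g) :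
    PartialNonResonantAt G J r g' n ζ x := by
  rintro l Γ hΓ ⟨T, hT, hcard, hbad⟩
  refine hNR l Γ hΓ ⟨T, hT, hcard, fun i hi => ?_⟩
  obtain ⟨hs, hb⟩ := hbad i hi
  exact ⟨hs, fun hn => hb fun S hS σ τ hστ => hg.trans (hn S hS σ τ hστ)⟩

/-- The bound on the terms crossing the boundary of `S₀` that gives the Lieb–Robinson bound. -/
def CrossingBound (G : SimpleGraph Λ) (W : ℕ → Finset Λ → Op Λ) (k : ℕ) (q ν K₀ : ℝ)
    (S₀ : Finset Λ) (A : Op Λ) : Prop :=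
  ∃ K, 0 ≤ K ∧ K ≤ K₀ * ‖A‖ ∧ ∀ Γ, ¬Disjoint Γ S₀ → ¬Γ ⊆ S₀ → ∀ s, 0 ≤ s →
    ‖⁅term W Γ, heisenberg (ham W S₀) s A⁆‖ ≤
      ‖term W Γ‖ * (q⁻¹) ^ (3 * (setDiam G Γ - k)) * K * Real.exp (ν * s)

theorem card_le_setDiam (hdim : IsDimensional G d M) (hM : 1 ≤ M) (Γ : Finset Λ) :
    (Γ.card : ℝ) ≤ M * (max (setDiam G Γ) 1 : ℕ) ^ d := by
  rcases Γ.eq_empty_or_nonempty with rfl | ⟨x, hx⟩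
  · rw [Finset.card_empty, Nat.cast_zero]
    positivity
  · exact (Nat.cast_le.2 (Finset.card_le_card (subset_ball_setDiam hx))).trans
      (card_le_of_isDimensional hdim x _)

theorem card_mul_exp_le (hdim : IsDimensional G d M) (hM : 1 ≤ M) {μ Y : ℝ} (hμ : 0 ≤ μ)
    (hY : μ + (Real.log M + d) ≤ Y) (Γ : Finset Λ) :
    Γ.card * Real.exp (μ * setDiam G Γ) ≤
      Real.exp ((μ + (Real.log M + d)) * (k + 1)) *
        ((Real.exp (-Y))⁻¹) ^ (3 * (setDiam G Γ - k)) := by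
  set δ := setDiam G Γ
  have hΛ : 0 ≤ Real.log M + d := add_nonneg (Real.log_nonneg hM) (by positivity)
  have h1 := (card_le_setDiam hdim hM Γ).trans (pow_le_exp_mul hM d (le_max_right δ 1))
  rw [← Real.exp_neg, neg_neg, ← Real.exp_nat_mul, ← Real.exp_add]
  calc _ ≤ Real.exp ((Real.log M + d) * (max δ 1 : ℕ)) * Real.exp (μ * δ) := by gcongr
    _ = Real.exp ((Real.log M + d) * (max δ 1 : ℕ) + μ * δ) := (Real.exp_add _ _).symm
    _ ≤ _ := by
        apply Real.exp_le_exp.2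
        have h2 : ((max δ 1 : ℕ) : ℝ) ≤ (k + 1) + (3 * (δ - k) : ℕ) := by
          exact_mod_cast (by omega : max δ 1 ≤ (k + 1) + 3 * (δ - k))
        have h3 : (δ : ℝ) ≤ (k + 1) + (3 * (δ - k) : ℕ) := by
          exact_mod_cast (by omega : δ ≤ (k + 1) + 3 * (δ - k))
        have h4 := mul_le_mul_of_nonneg_left h2 hΛ
        have h5 := mul_le_mul_of_nonneg_left h3 hμ
        have h6 := mul_le_mul_of_nonneg_right hY
          (show (0 : ℝ) ≤ (3 * (δ - k) : ℕ) by positivity)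
        linarith

theorem one_add_sq_le {h x C' : ℝ} (hh : 0 < h) (hC' : 8 ≤ C') (hx : 0 ≤ x) :
    1 + 8 * (h / (C' * h * Real.exp (-x))) ^ 2 ≤ 2 * Real.exp (2 * x) := by
  have h1 : h / (C' * h * Real.exp (-x)) = Real.exp x / C' := by
    rw [Real.exp_neg]
    field_simp
  have h2 : Real.exp (2 * x) = Real.exp x ^ 2 := by
    rw [← Real.exp_nat_mul]
    norm_num
  have h3 : 1 ≤ Real.exp (2 * x) := Real.one_le_exp (by linarith)
  rw [h1, div_pow, ← h2]
  have h4 : 8 * (Real.exp (2 * x) / C' ^ 2) ≤ Real.exp (2 * x) := by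
    rw [mul_div_assoc', div_le_iff₀ (by positivity)]
    have h5 : 8 ≤ C' ^ 2 := by nlinarith
    rw [mul_comm]
    gcongr
  linarith

/-- In logarithms: the weight of a term of diameter δ offers 3(δ - k)Y, while crossing u units asks
for about u r Y. For u = 1 this is r < 2δ. For u ≥ 2, minimality of u gives (r + 1)u ≤ 3δ because u
≤ 2(u - 1), and the extra u Y covers the volume factor. -/
theorem long_estimate {r k δ u : ℕ} {Y x Λ : ℝ} (hΛ : 0 ≤ Λ) (hΛY : Λ ≤ Y)
    (hx : 0 ≤ x) (hr : 3 ≤ r) (hu : 1 ≤ u) (hδ : r < 2 * δ)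
    (hδu : u = 1 ∨ 2 * (r + 1) * (u - 1) < 3 * δ ∧ 3 * δ ≤ 2 * (r + 1) * u) :
    Λ * (max r δ : ℕ) + x + k * Y ≤
        (3 * (δ - k) : ℕ) * Y + u * (Λ * r + 3 * x - (r - 5 * k) * Y) ∧
      0 ≤ (3 * (δ - k) : ℕ) * Y + u * (Λ * r + 3 * x - (r - 5 * k) * Y) := by
  have hY : 0 ≤ Y := hΛ.trans hΛY
  have hu' : (1 : ℝ) ≤ u := by exact_mod_cast hu
  have hk : (0 : ℝ) ≤ k := by positivity
  have h3 : (3 * δ - 3 * k : ℝ) ≤ (3 * (δ - k) : ℕ) := by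
    have : 3 * δ ≤ 3 * (δ - k) + 3 * k := by omega
    have : (3 * δ : ℝ) ≤ (3 * (δ - k) : ℕ) + 3 * k := by exact_mod_cast this
    linarith
  have h3Y := mul_le_mul_of_nonneg_right h3 hY
  have hux : x ≤ u * (3 * x) := by nlinarith
  have key : Λ * (max r δ : ℕ) + x + k * Y ≤
        (3 * (δ - k) : ℕ) * Y + u * (Λ * r + 3 * x - (r - 5 * k) * Y) := by
    rcases hδu with rfl | ⟨h1, h2⟩
    · have h4 : (r : ℝ) ≤ 2 * δ := by exact_mod_cast hδ.le
      have h5 : ((max r δ : ℕ) : ℝ) ≤ r + δ := by exact_mod_cast (by omega : max r δ ≤ r + δ)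
      have h6 := mul_le_mul_of_nonneg_left h5 hΛ
      have h7 : Λ * δ ≤ δ * Y := by rw [mul_comm]; gcongr
      have h8 := mul_le_mul_of_nonneg_right h4 hY
      have h9 : 0 ≤ k * Y := by positivity
      rw [Nat.cast_one, one_mul]
      linarith
    · by_cases hu1 : u = 1
      · subst hu1
        have h4 : (r : ℝ) ≤ 2 * δ := by exact_mod_cast hδ.le
        have h5 : ((max r δ : ℕ) : ℝ) ≤ r + δ := by exact_mod_cast (by omega : max r δ ≤ r + δ)
        have h6 := mul_le_mul_of_nonneg_left h5 hΛ
        have h7 : Λ * δ ≤ δ * Y := by rw [mul_comm]; gcongr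
        have h8 := mul_le_mul_of_nonneg_right h4 hY
        have h9 : 0 ≤ k * Y := by positivity
        rw [Nat.cast_one, one_mul]
        linarith
      · have h4 : max r δ ≤ r * u := by
          have h5 : 2 * (r + 1) * u ≤ 3 * (r * u) := by nlinarith
          have h6 : r ≤ r * u := Nat.le_mul_of_pos_right r hu
          omega
        have h4' : ((max r δ : ℕ) : ℝ) ≤ r * u := by exact_mod_cast h4
        have h6 := mul_le_mul_of_nonneg_left h4' hΛ
        have h7 : (r + 1) * u ≤ 3 * δ := by
          obtain ⟨t, rfl⟩ : ∃ t, u = t + 2 := ⟨u - 2, by omega⟩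
          have : (r + 1) * (t + 2) ≤ 2 * (r + 1) * (t + 2 - 1) := by
            simp only [show t + 2 - 1 = t + 1 by omega]
            nlinarith
          omega
        have h7' : ((r : ℝ) + 1) * u ≤ 3 * δ := by exact_mod_cast h7
        have h8 := mul_le_mul_of_nonneg_right h7' hY
        have h9 : 0 ≤ (u - 1) * (k * Y) := mul_nonneg (by linarith) (by positivity)
        have h10 : 0 ≤ u * (k * Y) := by positivity
        have h11 : 0 ≤ u * Y := by positivity
        linarith
  refine ⟨key, le_trans ?_ key⟩
  positivity

namespace LocalSeries

variable (hW : LocalSeries G k h ε J W w)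

include hW

/-- For x ≤ 0 the velocity factor e^{-x} is at least one, and the expansion with trivial bounds
suffices without any non-resonance. -/
theorem crossingBound_fast (hε : 0 < ε) (hε1 : ε ≤ 1) (hh : 0 < h) (hconn : G.Connected)
    (hdim : IsDimensional G d M) (hM : 1 ≤ M) {μ Y x C₁ C' : ℝ} (hμ : 0 ≤ μ)
    (hY : μ + (Real.log M + d) ≤ Y)
    (hw : WeightLE G W k (Real.exp (-Y)) (C₁ * h)) (hx : x ≤ 0)
    (hC' : 4 * (Real.exp ((μ + (Real.log M + d)) * (k + 1)) * C₁) ≤ C') (hC'0 : 0 < C')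
    {S₀ S₁ : Finset Λ} {D : ℕ} (hD : ∀ x ∈ S₀, ∀ z ∈ S₁, D ≤ G.dist x z) {A : Op Λ}
    (hA : A ∈ supp S₁) :
    CrossingBound G W k (Real.exp (-Y)) (C' * h * Real.exp (-x))
      (2 * Real.exp ((μ + (Real.log M + d)) * (k + 1)) * Real.exp (-x) * Real.exp (-(μ * D)))
      S₀ A := by
  set K₃ := Real.exp ((μ + (Real.log M + d)) * (k + 1)) with hK₃
  set q := Real.exp (-Y) with hq
  have hq0 : 0 < q := Real.exp_pos _
  have hΛ : 0 ≤ Real.log M + d := add_nonneg (Real.log_nonneg hM) (by positivity)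
  have hq1 : q ≤ 1 := Real.exp_le_one_iff.2 (by linarith)
  have hqi : 1 ≤ q⁻¹ := (one_le_inv₀ hq0).2 hq1
  have hcard := fun Γ => card_mul_exp_le (k := k) hdim hM hμ hY Γ
  have hex : 1 ≤ Real.exp (-x) := Real.one_le_exp (by linarith)
  refine ⟨2 * K₃ * ‖A‖ * Real.exp (-(μ * D)), by positivity, ?_, fun Γ h1 h2 s hs => ?_⟩
  · calc _ = 2 * K₃ * 1 * Real.exp (-(μ * D)) * ‖A‖ := by ring
      _ ≤ _ := by gcongr
  have hwt : ∀ v, ∑ Γ ∈ Finset.univ.filter (fun Γ => v ∈ Γ),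
      ‖term W Γ‖ * (Γ.card * Real.exp (μ * setDiam G Γ)) ≤ K₃ * (C₁ * h) := fun v => by
    refine le_trans ?_ (mul_le_mul_of_nonneg_left (hw v) (Real.exp_pos _).le)
    rw [Finset.mul_sum]
    refine Finset.sum_le_sum fun Γ _ => ?_
    have h3 : (q⁻¹) ^ (3 * (setDiam G Γ - k)) ≤ (q⁻¹) ^ (4 * (setDiam G Γ - k)) :=
      pow_le_pow_right₀ hqi (by omega)
    calc _ ≤ ‖term W Γ‖ * (K₃ * (q⁻¹) ^ (3 * (setDiam G Γ - k))) := by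
          have := hcard Γ
          gcongr
      _ ≤ ‖term W Γ‖ * (K₃ * (q⁻¹) ^ (4 * (setDiam G Γ - k))) := by gcongr
      _ = _ := by ring
  have h3 := hW.norm_lie_heisenberg_le_of_weight hε.le hε1 hconn hD hA
    (ν := C' * h * Real.exp (-x)) (by positivity) hμ hwt (by
      calc 4 * (K₃ * (C₁ * h)) = 4 * (K₃ * C₁) * h := by ring
        _ ≤ C' * h := by gcongr
        _ ≤ C' * h * Real.exp (-x) := le_mul_of_one_le_right (by positivity) hex)
    (S₀ᶜ).card S₀ Γ 0 le_rfl (fun z hz => ⟨z, hz, by simp⟩) h1 h2 s hs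
  refine h3.trans ?_
  rw [Nat.cast_zero, mul_zero, zero_sub]
  have := hcard Γ
  calc _ ≤ 2 * ‖term W Γ‖ * (K₃ * (q⁻¹) ^ (3 * (setDiam G Γ - k))) *
        (‖A‖ * Real.exp (-(μ * D))) * Real.exp (C' * h * Real.exp (-x) * s) := by gcongr
    _ = _ := by ring

/-- Of the 3x to be paid by q^D, 2x come from the factor (h/ν)² of the screening estimate and x from
the factor e^{-x} demanded by the conclusion. -/
theorem crossingBound_single (hε : 0 < ε) (hε1 : ε ≤ 1) (hh : 0 < h) (hconn : G.Connected)
    {μ Y x C₁ C' N κ g ζ : ℝ} (hY : 0 ≤ Y) (hx : 0 ≤ x) (hC' : 8 ≤ C')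
    (hC₁ : 1 ≤ C₁) (hJ₁ : ∀ v, ∑ S ∈ Finset.univ.filter (fun S => v ∈ S), ‖W 0 S‖ ≤ C₁ * h)
    {S₀ S₁ : Finset Λ} {D : ℕ} (hD : ∀ x ∈ S₀, ∀ z ∈ S₁, D ≤ G.dist x z)
    (hSS : Disjoint S₀ S₁) (hN1 : 1 ≤ N) (hN : ∀ y, ((ball G y (D - 1)).card : ℝ) ≤ N)
    (hg : 0 < g) (hNR : 2 ≤ D → ∀ x ∈ boundary G S₀, PartialNonResonantAt G J (D - 1) g 0 ζ x)
    (hκ : 1 + 2 * (√spacingConst / g) * N * h ≤ κ)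
    (hϑ : 2 ≤ D → 8 * N ^ 2 * C₁ * κ * ε ≤ Real.exp (-Y) ^ (2 * k + 3))
    (hxY : 3 * x + μ * D ≤ (D - 5 * k) * Y) {A : Op Λ} (hA : A ∈ supp S₁) :
    CrossingBound G W k (Real.exp (-Y)) (C' * h * Real.exp (-x))
      (4 * Real.exp (-x) * Real.exp (-(μ * D))) S₀ A := by
  have hC'0 : 0 < C' := by linarith
  refine ⟨_, by positivity, ?_, fun Γ h1 h2 s hs =>
    hW.norm_lie_heisenberg_le_single hε hε1 hh hconn (Real.exp_pos _)
      (Real.exp_le_one_iff.2 (by linarith)) (by positivity) hN1 hN hC₁ hJ₁ hg hNR hκ hϑ hSS hD hA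
      h1 h2 hs⟩
  have h1 := one_add_sq_le hh hC' hx
  rw [← Real.exp_neg, neg_neg, ← Real.exp_nat_mul, ← Real.exp_nat_mul, ← Real.exp_add]
  calc _ ≤ 2 * ‖A‖ * (2 * Real.exp (2 * x)) *
        Real.exp (D * -Y + (5 * k : ℕ) * Y) := by gcongr
    _ = 4 * Real.exp (2 * x + (D * -Y + (5 * k : ℕ) * Y)) * ‖A‖ := by
        rw [Real.exp_add (2 * x)]; ring
    _ ≤ 4 * Real.exp (-x + -(μ * D)) * ‖A‖ := by
        refine mul_le_mul_of_nonneg_right ?_ (norm_nonneg _)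
        refine mul_le_mul_of_nonneg_left (Real.exp_le_exp.2 ?_) (by norm_num)
        push_cast
        linarith
    _ = _ := by rw [Real.exp_add]; ring

theorem crossingBound_many (hε : 0 < ε) (hε1 : ε ≤ 1) (hh : 0 < h) (hconn : G.Connected)
    (hdim : IsDimensional G d M) (hM : 1 ≤ M) {μ x l L C₁ C' κ g ζ α η : ℝ} {r n : ℕ}
    (hμ : 0 ≤ μ) (hα : 0 ≤ α) (hζ : 0 < ζ) (hζ1 : ζ ≤ 1) (hη0 : 0 ≤ η) (hη : η ≤ 1 / 2)
    (hl : 0 ≤ l) (hLΛ : 8 / ζ * (2 * (Real.log M + d) + 4 * μ) ≤ L)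
    (hΛL : Real.log M + d ≤ L) (hr3 : 3 ≤ r) (hkr : 5 * k ≤ r)
    (hηr : 1 ≤ η * ζ * (r + 1))
    (hG : (2 - ζ) * (α * (r + 1) / 16) + (1 - ζ) * (k * decayExp k) / ζ ≤
        (1 - η) * (decayExp k * (r - 5 * k) - 3 * (ζ * (α * (r + 1) / 16))))
    (hr : k + ζ * r / 8 ≤ (1 - η) * ζ * (r - 5 * k))
    (hw : WeightLE G W k (Real.exp (-(decayExp k * l + L))) (C₁ * h))
    (hx0 : 0 ≤ x) (hx : x ≤ ζ * (α * (r + 1) / 16) * l) (hC' : 8 ≤ C') (hC₁ : 1 ≤ C₁)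
    (hC₁' : 8 * C₁ ≤ C')
    (hJ₁ : ∀ v, ∑ S ∈ Finset.univ.filter (fun S => v ∈ S), ‖W 0 S‖ ≤ C₁ * h)
    {S₀ S₁ : Finset Λ} {D : ℕ} (hD : ∀ x ∈ S₀, ∀ z ∈ S₁, n * (r + 1) < G.dist x z)
    (hDn : D ≤ 2 * n * (r + 1)) (hn : 1 ≤ n)
    (hSS : Disjoint S₀ S₁) (hS₁ : S₁.Nonempty)
    (hg : 0 < g) (hNR : ∀ x ∈ boundary G S₀, PartialNonResonantAt G J r g n ζ x)
    (hκ : 1 + 2 * (√spacingConst / g) * (M * (r : ℝ) ^ d) * h ≤ κ)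
    (hϑ : 8 * (M * (r : ℝ) ^ d) ^ 2 * C₁ * κ * ε ≤
      Real.exp (-(decayExp k * l + L)) ^ (2 * k + 3)) {A : Op Λ} (hA : A ∈ supp S₁) :
    CrossingBound G W k (Real.exp (-(decayExp k * l + L))) (C' * h * Real.exp (-x))
      (4 * Real.exp (-x) * Real.exp (-(μ * D))) S₀ A := by
  set Y := decayExp k * l + L with hYdef
  set Λ' := Real.log M + d with hΛ'
  have hΛ0 : 0 ≤ Λ' := add_nonneg (Real.log_nonneg hM) (by positivity)
  have hγ := decayExp_pos k
  have hΛY : Λ' ≤ Y := by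
    have : 0 ≤ decayExp k * l := by positivity
    linarith
  have hY0 : 0 ≤ Y := hΛ0.trans hΛY
  have hL0 : 0 ≤ L := hΛ0.trans hΛL
  have hC'0 : 0 < C' := by linarith
  have hC₁0 : 0 < C₁ := by linarith
  have hr1 : 1 ≤ r := by omega
  have hr1' : (1 : ℝ) ≤ r := by exact_mod_cast hr1
  -- This is n r / (r + 1) rounded up: with fewer than n' units used, the region has not yet reached
  -- distance n r, as `PathPrefix.bad_le` requires.
  set n' := (n * r + r) / (r + 1) with hn'
  set B := ⌊(1 - ζ) * n⌋₊ with hB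
  have h1ζ : 0 ≤ 1 - ζ := by linarith
  have hn'n : n' ≤ n := by
    refine Nat.lt_succ_iff.1 ((Nat.div_lt_iff_lt_mul (by omega)).2 ?_)
    rw [Nat.succ_eq_add_one]
    ring_nf
    omega
  have hn'1 : n * r ≤ n' * (r + 1) := by
    have := Nat.lt_mul_div_succ (n * r + r) (b := r + 1) (by omega)
    rw [← hn', mul_add, mul_one, mul_comm (r + 1)] at this
    omega
  have hreach : ∀ U < n', (r + 1) * U < n * r := fun U hU => by
    have h1 : (U + 1) * (r + 1) ≤ n * r + r :=
      (Nat.le_div_iff_mul_le (by omega)).1 hU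
    have h2 : (U + 1) * (r + 1) = (r + 1) * U + r + 1 := by ring
    omega
  have hBle : (B : ℝ) ≤ (1 - ζ) * n := Nat.floor_le (by positivity)
  have hθn : ((n' - B : ℕ) : ℝ) ≤ n := by exact_mod_cast (by omega : n' - B ≤ n)
  -- Passing from n to n' loses at most n / (r + 1), which is at most η ζ n by the choice of scale;
  -- removing the bad steps leaves (1 - η) ζ n.
  have hθ : (1 - η) * ζ * n ≤ ((n' - B : ℕ) : ℝ) := by
    have h1 : (n' : ℝ) ≤ (n' - B : ℕ) + B := by exact_mod_cast (by omega : n' ≤ (n' - B) + B)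
    have h2 : (n * r : ℝ) ≤ n' * (r + 1) := by exact_mod_cast hn'1
    have h3 : n * 1 ≤ n * (η * ζ * (r + 1)) := by gcongr
    have h4 : ((1 - η) * ζ * n) * (r + 1) ≤ ((n' - B : ℕ) : ℝ) * (r + 1) := by
      have h5 : n' * (r + 1) ≤ ((n' - B : ℕ) + (1 - ζ) * n) * ((r : ℝ) + 1) := by
        gcongr
        linarith
      linarith
    exact le_of_mul_le_mul_right h4 (by positivity)
  obtain ⟨hQ, hfin⟩ := exponent_many_le (γ := decayExp k) (α := α) (ζ := ζ) (η := η) (μ := μ)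
    (x := x) (l := l) (L := L) (Λ := Λ') (r := r) (n := n) (B := B) (θ := (n' - B : ℕ)) (D := D)
    (k := k) hα hζ (by positivity) hγ.le hμ hΛ0 hL0 hl hx hr1' (by exact_mod_cast hkr) hζ1 hη0 hη
    hG hr (by exact_mod_cast hn) (by positivity) hBle hθ hθn (by exact_mod_cast hDn) hLΛ
  set q := Real.exp (-Y) with hq
  have hqi : q⁻¹ = Real.exp Y := by rw [hq, ← Real.exp_neg, neg_neg]
  set ν := C' * h * Real.exp (-x) with hν
  set cb := Real.exp (Λ' * r + x + k * Y) with hcb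
  set Q := Real.exp (Λ' * r + 3 * x - (r - 5 * k) * Y) with hQdef
  set N := M * (r : ℝ) ^ d with hN
  have hN1 : 1 ≤ N := one_le_mul_of_one_le_of_one_le hM (one_le_pow₀ hr1')
  have hNexp : N ≤ Real.exp (Λ' * r) := pow_le_exp_mul hM d hr1
  have hfac : ∀ P : ℝ, 0 ≤ P → 4 * P * (C₁ * h) / ν ≤ P / 2 * Real.exp x := fun P hP => by
    rw [hν, Real.exp_neg, div_le_iff₀ (by positivity)]
    have : P / 2 * Real.exp x * (C' * h * (Real.exp x)⁻¹) = P / 2 * h * C' := by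
      field_simp
    rw [this]
    have := mul_le_mul_of_nonneg_left hC₁' (show 0 ≤ P / 2 * h by positivity)
    linarith
  set Nd : ℕ → ℝ := fun δ => max N (M * (max δ 1 : ℕ) ^ d) with hNd
  have hNdexp : ∀ δ, r < 2 * δ → Nd δ ≤ Real.exp (Λ' * (max r δ : ℕ)) := fun δ hδ => by
    refine max_le (hNexp.trans ?_) ((pow_le_exp_mul hM d (le_max_right δ 1)).trans ?_)
    · apply Real.exp_le_exp.2
      gcongr
      exact le_max_left _ _
    · apply Real.exp_le_exp.2
      refine mul_le_mul_of_nonneg_left ?_ hΛ0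
      exact_mod_cast (by omega : max δ 1 ≤ max r δ)
  refine ⟨2 * ‖A‖ * (cb ^ B * Q ^ (n' - B)), by positivity, ?_, fun Γ h1 h2 s hs =>
    hW.norm_lie_heisenberg_le_many hε hε1 hh hconn (Real.exp_pos _)
      (Real.exp_le_one_iff.2 (by linarith)) hw (by positivity) (by positivity) hN1
      (fun y => hdim y r hr1) hC₁ hJ₁ hg hNR hκ hϑ hSS hS₁ hD hA hn'n hreach
      (fun b hb => Nat.le_floor hb) (Real.one_le_exp (by positivity)) (Real.exp_pos _)
      (Real.exp_le_one_iff.2 hQ) ?_ ?_ (Nd := Nd) (fun δ => le_max_left _ _)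
      (fun Γ => (card_le_setDiam hdim hM Γ).trans (le_max_right _ _))
      (fun δ u hu hδ hδu => ?_) h1 h2 hs⟩
  · rw [hcb, hQdef, ← Real.exp_nat_mul, ← Real.exp_nat_mul, ← Real.exp_add]
    have h1 : Real.exp (B * (Λ' * r + x + k * Y) +
        (n' - B : ℕ) * (Λ' * r + 3 * x - (r - 5 * k) * Y)) ≤ Real.exp (-x + -(μ * D)) := by
      apply Real.exp_le_exp.2
      linarith
    rw [Real.exp_add (-x)] at h1
    have h2 : 0 ≤ Real.exp (-x) * Real.exp (-(μ * D)) * ‖A‖ := by positivity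
    calc _ ≤ 2 * ‖A‖ * (Real.exp (-x) * Real.exp (-(μ * D))) := by gcongr
      _ = 2 * (Real.exp (-x) * Real.exp (-(μ * D)) * ‖A‖) := by ring
      _ ≤ 4 * (Real.exp (-x) * Real.exp (-(μ * D)) * ‖A‖) := by gcongr; norm_num
      _ = _ := by ring
  · rw [hqi, ← Real.exp_nat_mul]
    calc _ ≤ N / 2 * Real.exp x * Real.exp (k * Y) := by
          have := hfac N (by linarith)
          gcongr
      _ ≤ Real.exp (Λ' * r) * Real.exp x * Real.exp (k * Y) := by
          gcongr
          linarith
      _ = cb := by rw [hcb, Real.exp_add, Real.exp_add]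
  · rw [hqi, ← Real.exp_nat_mul, ← Real.exp_nat_mul, ← Real.exp_nat_mul]
    have h1 := one_add_sq_le hh hC' hx0
    rw [← hν] at h1
    calc _ ≤ N / 2 * Real.exp x * Real.exp (k * Y) *
          (2 * Real.exp (2 * x) * Real.exp (r * -Y) * Real.exp ((4 * k : ℕ) * Y)) := by
          have := hfac N (by linarith)
          gcongr
      _ = N * (Real.exp x * Real.exp (k * Y) * Real.exp (2 * x) * Real.exp (r * -Y) *
          Real.exp ((4 * k : ℕ) * Y)) := by ring
      _ ≤ Real.exp (Λ' * r) * (Real.exp x * Real.exp (k * Y) * Real.exp (2 * x) *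
          Real.exp (r * -Y) * Real.exp ((4 * k : ℕ) * Y)) := by gcongr
      _ = Q := by
          rw [hQdef, ← Real.exp_add, ← Real.exp_add, ← Real.exp_add, ← Real.exp_add,
            ← Real.exp_add]
          congr 1
          push_cast
          ring
  · obtain ⟨h1, h2⟩ := long_estimate (k := k) hΛ0 hΛY hx0 hr3 hu hδ hδu
    have hNdδ : 0 ≤ Nd δ := le_trans (by linarith) (le_max_left N _)
    rw [hqi, ← Real.exp_nat_mul, ← Real.exp_nat_mul, ← Real.exp_nat_mul, ← Real.exp_add]
    refine ⟨?_, Real.one_le_exp h2⟩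
    calc _ ≤ Nd δ / 2 * Real.exp x * Real.exp (k * Y) := by
          have := hfac (Nd δ) hNdδ
          gcongr
      _ ≤ Real.exp (Λ' * (max r δ : ℕ)) * Real.exp x * Real.exp (k * Y) := by
          have := hNdexp δ hδ
          gcongr
          linarith
      _ = Real.exp (Λ' * (max r δ : ℕ) + x + k * Y) := by rw [Real.exp_add, Real.exp_add]
      _ ≤ _ := Real.exp_le_exp.2 h1

end LocalSeries

end Regimes

/-! ### The Lieb–Robinson bound for a local series -/

section Main

theorem latticeSum_nonneg (d : ℕ) {M : ℝ} (hM : 1 ≤ M) : 0 ≤ latticeSum d M :=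
  tsum_nonneg fun r => by positivity

theorem scaleExponent_eq {ξ ζ c' b ε : ℝ} (hc' : 0 < c') (hbε : 0 ≤ Real.log ((b * ε)⁻¹)) :
    scaleExponent ξ ζ c' b ε = ζ / 8 * (Real.log ((b * ε)⁻¹) / (4 * c')) ^ (1 / ξ) := by
  rw [scaleExponent, lam, Real.div_rpow hbε (by positivity), inv_div]
  ring

theorem velocity_eq {α b ε E : ℝ} {k : ℕ} (hbε : 0 < b * ε) :
    velocity α k b ε E = Real.exp (-(α / 2 * (E - k) * Real.log ((b * ε)⁻¹))) := by
  rw [velocity, Real.rpow_def_of_pos hbε, Real.log_inv]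
  congr 1
  ring

/-- The time integral over the terms crossing the boundary of S₀ costs h/ν = e^x/C'. The factor
e^{-x} in the crossing bound cancels it, so the prefactor depends neither on h nor on ε. -/
theorem LocalSeries.norm_lie_heisenberg_le_of_crossingBound {Λ : Type} [Fintype Λ]
    [LinearOrder Λ] {G : SimpleGraph Λ} {k d : ℕ} {h ε M : ℝ} {J : Finset Λ → ℝ}
    {W : ℕ → Finset Λ → Op Λ} {w : ℕ → ℝ} (hW : LocalSeries G k h ε J W w) (hε : 0 < ε)
    (hε1 : ε ≤ 1) (hh : 0 < h) (hconn : G.Connected) (hdim : IsDimensional G d M) (hM : 1 ≤ M)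
    {q C₁ C' K₀ x E : ℝ} (hq : 0 < q) (hq2 : q ≤ 1 / 2) (hw : WeightLE G W k q (C₁ * h))
    (hC₁ : 0 ≤ C₁) (hC' : 0 < C') {S₀ : Finset Λ} {A B : Op Λ}
    (hB : B ∈ supp S₀) (hA : A ∈ supp S₀ᶜ)
    (hcr : CrossingBound G W k q (C' * h * Real.exp (-x)) (K₀ * Real.exp (-x) * E) S₀ A)
    {t : ℝ} (ht : 0 ≤ t) :
    ‖⁅B, heisenberg (ham W ∅) t A⁆‖ ≤
      4 * (2 ^ k * latticeSum d M * C₁) * K₀ / C' * (boundary G S₀).card *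
        (‖B‖ * ‖A‖ * (Real.exp (C' * h * Real.exp (-x) * t) - 1) * E) := by
  obtain ⟨K, hK0, hK, hb⟩ := hcr
  have hlat := latticeSum_nonneg d hM
  refine (hW.norm_lie_heisenberg_le_boundary hε.le hε1 hconn hM hdim hq hq2 hw (by positivity) hB
    hA (by positivity) hK0 hb ht).trans ?_
  have h1 : 0 ≤ Real.exp (C' * h * Real.exp (-x) * t) - 1 :=
    sub_nonneg.2 (Real.one_le_exp (by positivity))
  calc _ ≤ 4 * (2 ^ k * latticeSum d M * (C₁ * h)) / (C' * h * Real.exp (-x)) * ‖B‖ *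
        (boundary G S₀).card * (K₀ * Real.exp (-x) * E * ‖A‖) *
        (Real.exp (C' * h * Real.exp (-x) * t) - 1) := by gcongr
    _ = _ := by field_simp

set_option maxHeartbeats 1000000 in
-- The three regimes are put together here, with the constants chosen before c' and only b after it.
-- The perturbed terms are controlled through q = e^{-Y}, Y = γ log(1/(bε)) + L.
theorem exists_bound_localSeries (d k : ℕ) {M ξ a c ζ α : ℝ} (hM : 1 ≤ M) (hξ : 0 < ξ)
    (ha : 0 < a) (hc : 0 < c) (hζ : 0 < ζ) (hζ1 : ζ ≤ 1) (hα : 0 < α)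
    (hα1 : α < 1 / (5 * (k : ℝ) + 1)) :
    ∃ C C' : ℝ, 0 < C ∧ 0 < C' ∧ ∀ c' : ℝ, c < c' → ∃ b : ℝ, 1 ≤ b ∧
      ∀ (Λ : Type) [Fintype Λ] [LinearOrder Λ] (G : SimpleGraph Λ), G.Connected →
        IsDimensional G d M →
        ∀ (h ε : ℝ) (J : Finset Λ → ℝ) (W : ℕ → Finset Λ → Op Λ) (w : ℕ → ℝ),
        0 < h → 0 < ε → b * ε ≤ 1 → LocalSeries G k h ε J W w →
        ∀ (S₀ S₁ : Finset Λ), S₁.Nonempty → Disjoint S₀ S₁ →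
        ∀ D : ℕ, (∀ x ∈ S₀, ∀ z ∈ S₁, D ≤ G.dist x z) →
        ∀ (Δ : ℕ → ℝ), (∀ r : ℕ, h * (a * Real.exp (-c * (r : ℝ) ^ ξ)) ≤ Δ r) →
        PartialNonResonantOnBoundary G J Δ D ζ S₀ →
        ∀ (A B : Op Λ), A ∈ supp S₁ → B ∈ supp S₀ → ∀ t : ℝ, 0 ≤ t →
          ‖⁅B, heisenberg (ham W ∅) t A⁆‖ ≤ C * (boundary G S₀).card *
            (‖B‖ * ‖A‖ * (Real.exp (C' * h * velocity α k b ε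
              (min (scaleExponent ξ ζ c' b ε) (ζ * (D : ℝ) / 8)) * t) - 1) *
              Real.exp (-(α * ζ / 8) * (D : ℝ))) := by
  set μ := α * ζ / 8 with hμ
  have hμ0 : 0 < μ := by positivity
  set Λ' := Real.log M + d with hΛ'
  have hΛ0 : 0 ≤ Λ' := add_nonneg (Real.log_nonneg hM) (by positivity)
  -- The first summand feeds `exponent_many_le`; Λ' + μ makes the weights dominate volumes and e^{μ
  -- diam}; the 1 gives q ≤ 1/2.
  set L := 8 / ζ * (2 * Λ' + 4 * μ) + Λ' + μ + 1 with hL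
  have hL1 : 0 ≤ 8 / ζ * (2 * Λ' + 4 * μ) := by positivity
  have hL32 : 32 * μ ≤ L := by
    have h1 : 8 ≤ 8 / ζ := by
      rw [le_div_iff₀ hζ]
      linarith
    have h2 : 8 * (4 * μ) ≤ 8 / ζ * (2 * Λ' + 4 * μ) := by
      gcongr
      linarith
    linarith
  have hL0 : 0 ≤ L := by linarith
  set C₁ := localConst d k M with hC₁
  have hC₁1 : 1 ≤ C₁ := one_le_localConst d k M
  set K₃ := Real.exp ((μ + Λ') * (k + 1)) with hK₃
  have hK₃0 : 0 < K₃ := Real.exp_pos _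
  set C' := 8 * C₁ + 8 + 4 * (K₃ * C₁) with hC'
  have hKC : 0 ≤ K₃ * C₁ := by positivity
  have hC'8 : 8 ≤ C' := by linarith
  have hC'0 : 0 < C' := by linarith
  have hlat := latticeSum_nonneg d hM
  have hγ := lt_decayExp hα1
  have hγ0 := decayExp_pos k
  obtain ⟨η, r₀, hη0, hη2, hr₀3, hkr₀, hscale⟩ := exists_scale k hα hζ hζ1 hγ
  set R₀ := ⌈r₀⌉₊ with hR₀
  set C := 4 * (2 ^ k * latticeSum d M * C₁) * (4 + 2 * K₃) / C' with hC
  have hCnn : 0 ≤ C := by positivity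
  refine ⟨C + 1, C', by linarith, hC'0, fun c' hc' => ?_⟩
  obtain ⟨b, hb1, hb⟩ := exists_coupling (s := √spacingConst) k d hξ ha hc hc' hM hC₁1
    (Real.sqrt_nonneg _) hL0 R₀
  refine ⟨b, hb1, ?_⟩
  intro Λ _ _ G hconn hdim h ε J W w hh hε hbε hW S₀ S₁ hS₁ hSS D hD Δ hΔ hNR A B hA hB t ht
  obtain ⟨hεq, hϑ⟩ := hb ε hε hbε
  have hε1 : ε ≤ 1 := by nlinarith
  have hbε0 : 0 < b * ε := by positivity
  set l := Real.log ((b * ε)⁻¹) with hl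
  have hl0 : 0 ≤ l := Real.log_nonneg ((one_le_inv₀ hbε0).2 hbε)
  set Y := decayExp k * l + L with hY
  have hγl : 0 ≤ decayExp k * l := by positivity
  have hc'0 : 0 < c' := by linarith
  set rs := (l / (4 * c')) ^ (1 / ξ) with hrs
  have hrs0 : 0 ≤ rs := by positivity
  have hse : scaleExponent ξ ζ c' b ε = ζ / 8 * rs := scaleExponent_eq hc'0 hl0
  set E := min (scaleExponent ξ ζ c' b ε) (ζ * (D : ℝ) / 8) with hE
  have hE1 : E ≤ ζ / 8 * rs := (min_le_left _ _).trans_eq hse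
  have hE2 : E ≤ ζ * D / 8 := min_le_right _ _
  rw [velocity_eq hbε0, ← hl]
  -- So the velocity factor is v = e^{-x}.
  set x := α / 2 * (E - k) * l with hx
  set q := Real.exp (-Y) with hq
  have hq0 : 0 < q := Real.exp_pos _
  have hq2 : q ≤ 1 / 2 := by
    have h1 : q ≤ Real.exp (-1) := Real.exp_le_exp.2 (by linarith)
    have h2 := Real.add_one_le_exp (1 : ℝ)
    refine h1.trans ?_
    rw [Real.exp_neg, inv_le_comm₀ (Real.exp_pos _) (by norm_num)]
    norm_num
    linarith
  have hw : WeightLE G W k q (C₁ * h) :=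
    hW.weightLE hε hε1 hdim hq0 (by linarith) hεq
  have hJ₁ : ∀ v, ∑ S ∈ Finset.univ.filter (fun S => v ∈ S), ‖W 0 S‖ ≤ C₁ * h := fun v => by
    refine (hW.sum_zero_le hdim v).trans ?_
    rw [hC₁, localConst]
    gcongr
    linarith
  have hAS : A ∈ supp S₀ᶜ := supp_mono (Finset.subset_compl_iff_disjoint_left.2 hSS) hA
  have hgap : ∀ r : ℕ, 0 < h * (a * Real.exp (-c * (r : ℝ) ^ ξ)) := fun r => by positivity
  have hκeq : ∀ (r : ℕ) (N : ℝ),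
      1 + 2 * (√spacingConst / (h * (a * Real.exp (-c * (r : ℝ) ^ ξ)))) * N * h =
        1 + 2 * (√spacingConst / (a * Real.exp (-c * (r : ℝ) ^ ξ))) * N := fun r N => by
    field_simp
  -- it remains to bound the crossing terms
  suffices hcr : ∃ K₀, 0 ≤ K₀ ∧ K₀ ≤ 4 + 2 * K₃ ∧ CrossingBound G W k q
      (C' * h * Real.exp (-x)) (K₀ * Real.exp (-x) * Real.exp (-(μ * D))) S₀ A by
    obtain ⟨K₀, hK0, hK4, hcr⟩ := hcr
    refine (hW.norm_lie_heisenberg_le_of_crossingBound hε hε1 hh hconn hdim hM hq0 hq2 hw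
      (by linarith) hC'0 hB hAS hcr ht).trans ?_
    rw [neg_mul]
    have h1 : 0 ≤ Real.exp (C' * h * Real.exp (-x) * t) - 1 :=
      sub_nonneg.2 (Real.one_le_exp (by positivity))
    have h2 : 4 * (2 ^ k * latticeSum d M * C₁) * K₀ / C' ≤ C + 1 := by
      refine le_trans ?_ (le_add_of_nonneg_right zero_le_one)
      rw [hC]
      gcongr
    gcongr
  -- Here v ≥ 1, and the ordinary Lieb–Robinson bound applies.
  by_cases hEk : E ≤ k
  · have hx0 : x ≤ 0 :=
      mul_nonpos_of_nonpos_of_nonneg (mul_nonpos_of_nonneg_of_nonpos (by positivity)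
        (by linarith)) hl0
    exact ⟨2 * K₃, by positivity, by linarith, hW.crossingBound_fast hε hε1 hh hconn hdim hM
      hμ0.le (by linarith) hw hx0 (by linarith) hC'0 hD hA⟩
  rw [not_le] at hEk
  have hx0 : 0 ≤ x := mul_nonneg (mul_nonneg (by positivity) (by linarith)) hl0
  have hD8 : 8 * (k : ℝ) ≤ D := by
    have : ζ * D ≤ 1 * D := by gcongr
    linarith
  have hk0 : (0 : ℝ) ≤ k := by positivity
  refine ⟨4, by norm_num, by linarith, ?_⟩
  -- The working scale is r_*(ε) rounded down, but not below the threshold from which the numerical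
  -- inequalities hold.
  set r := max ⌊rs⌋₊ R₀ with hr
  by_cases hDr : D - 1 ≤ r
  · set N := M * ((max (D - 1) 1 : ℕ) : ℝ) ^ d with hN
    have hN1 : 1 ≤ N := by
      refine one_le_mul_of_one_le_of_one_le hM (one_le_pow₀ ?_)
      exact_mod_cast le_max_right _ _
    refine hW.crossingBound_single hε hε1 hh hconn (N := N) (ζ := ζ) (by linarith) hx0 hC'8 hC₁1 hJ₁ hD hSS
      hN1 (fun y => card_le_of_isDimensional hdim y (D - 1)) (hgap (D - 1)) (fun h2 y hy => ?_)
      le_rfl (fun h2 => ?_) ?_ hA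
    -- At scale D - 1 the path parameter ⌊(D - 1)/D⌋ is zero, so non-resonance in a single ball
    -- follows.
    · have h3 := hNR (D - 1) (by omega) y hy
      rw [Nat.div_eq_of_lt (by omega)] at h3
      exact h3.mono (hΔ _)
    · rw [hκeq, hN, max_eq_left (by omega : 1 ≤ D - 1)]
      refine hϑ (D - 1) (by omega) ?_
      rcases le_max_iff.1 hDr with h3 | h3
      · exact Or.inr ((Nat.cast_le.2 h3).trans (Nat.floor_le hrs0))
      · exact Or.inl h3
    · have h1 : x ≤ α / 16 * (D - 8 * k) * l := by
        rw [hx]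
        refine mul_le_mul_of_nonneg_right ?_ hl0
        have : ζ * D ≤ 1 * D := by gcongr
        have h2 : E - k ≤ (D - 8 * k) / 8 := by linarith
        calc α / 2 * (E - k) ≤ α / 2 * ((D - 8 * k) / 8) := by gcongr
          _ = _ := by ring
      have h2 : 3 * (α / 16) * (D - 8 * k) ≤ decayExp k * (D - 5 * k) := by
        have : 0 ≤ (D : ℝ) - 8 * k := by linarith
        gcongr
        · linarith
        · linarith
      have h3 := mul_le_mul_of_nonneg_right h2 hl0
      have h4 : μ * D ≤ (D - 5 * k) * L := by
        have h5 : 3 / 8 * (D : ℝ) ≤ D - 5 * k := by linarith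
        calc μ * D ≤ 3 / 8 * D * (32 * μ) := by
              have : 0 ≤ μ * D := by positivity
              linarith
          _ ≤ _ := by
              have : 0 ≤ (D : ℝ) - 5 * k := le_trans (by positivity) h5
              gcongr
      rw [hY]
      linarith
  · rw [not_le] at hDr
    have hrR : r₀ ≤ r := (Nat.le_ceil r₀).trans (Nat.cast_le.2 (le_max_right _ _))
    have hrs1 : rs ≤ r + 1 := by
      refine (Nat.lt_floor_add_one rs).le.trans ?_
      have : ((⌊rs⌋₊ : ℕ) : ℝ) ≤ r := Nat.cast_le.2 (le_max_left _ _)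
      linarith
    obtain ⟨hs1, hs2, hs3⟩ := hscale r hrR
    have hr3 : 3 ≤ r := by exact_mod_cast hr₀3.trans hrR
    have hk5 : 5 * k ≤ r := by exact_mod_cast hkr₀.trans hrR
    set n := (D - 1) / (r + 1) with hn
    have hn1 : 1 ≤ n := (Nat.one_le_div_iff (by omega)).2 (by omega)
    have hnD : n * (r + 1) ≤ D - 1 := Nat.div_mul_le_self _ _
    have hDn : D ≤ 2 * n * (r + 1) := by
      have h1 := Nat.lt_mul_div_succ (D - 1) (b := r + 1) (by omega)
      rw [← hn] at h1
      have h2 : (r + 1) * (n + 1) ≤ (r + 1) * (2 * n) := Nat.mul_le_mul_left _ (by omega)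
      rw [mul_comm]
      omega
    refine hW.crossingBound_many hε hε1 hh hconn hdim hM hμ0.le hα.le hζ hζ1 hη0.le hη2 hl0
      (by linarith) (by linarith) hr3 hk5 hs1 hs2 hs3 hw hx0 ?_ hC'8 hC₁1 (by linarith) hJ₁
      (fun x hx z hz => ?_) hDn hn1 hSS hS₁ (hgap r) (fun y hy => ?_) le_rfl ?_ hA
    · rw [hx]
      refine mul_le_mul_of_nonneg_right ?_ hl0
      have h1 : E - k ≤ ζ / 8 * (r + 1) := by
        have : ζ / 8 * rs ≤ ζ / 8 * (r + 1) := by gcongr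
        linarith
      calc α / 2 * (E - k) ≤ α / 2 * (ζ / 8 * (r + 1)) := by gcongr
        _ = _ := by ring
    · have := hD x hx z hz
      omega
    · exact (hNR r (by omega) y hy).mono (hΔ r)
    · rw [hκeq]
      refine hϑ r (by omega) ?_
      rcases le_total ⌊rs⌋₊ R₀ with h3 | h3
      · left
        rw [hr, max_eq_right h3]
      · right
        rw [hr, max_eq_left h3]
        exact Nat.floor_le hrs0

end Main

/-! ### Local perturbations as local series -/

section Assembly

set_option linter.unusedSectionVars false

variable {Λ : Type} [Fintype Λ] [DecidableEq Λ] {G : SimpleGraph Λ} {k : ℕ} {h ε : ℝ}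
  {J : Finset Λ → ℝ} {W : ℕ → Finset Λ → Op Λ} {w : ℕ → ℝ}

theorem conjTranspose_mem_supp {S : Finset Λ} {M : Op Λ} (hM : M ∈ supp S) : Mᴴ ∈ supp S := by
  rw [mem_supp_iff] at hM ⊢
  intro i hi
  obtain ⟨h1, h2⟩ := hM i hi
  refine ⟨fun σ τ hne => ?_, fun σ τ => ?_⟩
  · rw [Matrix.conjTranspose_apply, h1 τ σ hne.symm, star_zero]
  · rw [Matrix.conjTranspose_apply, h2, Matrix.conjTranspose_apply]

theorem eq_smul_one_of_mem_supp_empty {M : Op Λ} (hM : M ∈ supp ∅) :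
    M = M 0 0 • (1 : Op Λ) := by
  ext σ τ
  rw [Matrix.smul_apply, Matrix.one_apply, smul_eq_mul]
  split_ifs with hστ
  · subst hστ
    have := apply_piecewise_of_mem_supp hM (σ := σ) (τ := σ) (fun _ _ => rfl) 0 Finset.univ
      (Finset.disjoint_empty_right _)
    rw [← this]
    simp
  · obtain ⟨i, hi⟩ := Function.ne_iff.1 hστ
    rw [apply_eq_zero_of_mem_supp hM (Finset.notMem_empty i) hi, mul_zero]

/-- The local series with zeroth order `∑ J_I Z_I` and higher orders the Hermitian parts of
`ε ^ l V_l`. -/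
def seriesTerm (J : Finset Λ → ℝ) (V : ℕ → Finset Λ → Op Λ) (ε : ℝ) :
    ℕ → Finset Λ → Op Λ
  | 0, S => (J S : ℂ) • pauliZ S
  | l + 1, S => if S = ∅ then 0 else
      ((ε ^ (l + 1) / 2 : ℝ) : ℂ) • (V (l + 1) S + (V (l + 1) S)ᴴ)

/-- Only the sum of the V_{r,S} is assumed Hermitian, not each term. Hermitian parts have the same
support and no larger norm, and the term on the empty set, which no local norm controls, is
discarded as a scalar. -/
theorem exists_localSeries [Nonempty Λ] {V : ℕ → Finset Λ → Op Λ} (hε : 0 < ε)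
    (hJ : IsClassicalLocal G k h J) (hV : IsLocalPerturbation G h V) :
    ∃ w, LocalSeries G k h ε J (seriesTerm J V ε) w := by
  obtain ⟨-, hsupp, hdiam, w, hw, hsum, hle⟩ := hV
  have hstar : ∀ l S, ‖(V l S)ᴴ‖ = ‖V l S‖ := fun l S => Matrix.l2_opNorm_conjTranspose _
  have hnorm : ∀ l S, ‖seriesTerm J V ε (l + 1) S‖ ≤ ε ^ (l + 1) * ‖V (l + 1) S‖ := fun l S => by
    rw [seriesTerm]
    split_ifs
    · rw [norm_zero]
      positivity
    · rw [norm_smul, Complex.norm_real, Real.norm_of_nonneg (by positivity)]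
      calc _ ≤ ε ^ (l + 1) / 2 * (‖V (l + 1) S‖ + ‖(V (l + 1) S)ᴴ‖) := by
            gcongr
            exact norm_add_le _ _
        _ = _ := by rw [hstar]; ring
  have hw0 : ∀ l, 0 ≤ w (l + 1) := fun l =>
    (Finset.sum_nonneg fun _ _ => norm_nonneg _).trans (hw (l + 1) (by omega) (Classical.arbitrary Λ))
  -- Nothing is known about `w 0`, since the perturbation starts at order one.
  set w' : ℕ → ℝ := fun l => if l = 0 then 0 else w l with hw'
  have hsum' : Summable w' := by
    rw [← summable_nat_add_iff 1]
    exact hsum.congr fun l => by simp [hw']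
  refine ⟨w', fun S => rfl, fun I => (hJ I).1, fun I hI => (hJ I).2 hI, ?_, ?_, ?_, ?_, ?_, ?_,
    hsum', ?_⟩
  · rintro (_ | l) S
    · rw [seriesTerm, Matrix.IsHermitian, Matrix.conjTranspose_smul, pauliZ,
        Matrix.diagonal_conjTranspose]
      congr 1
      · simp
      · congr 1
        funext σ
        simp
    · rw [seriesTerm]
      split_ifs
      · exact Matrix.isHermitian_zero
      · rw [Matrix.IsHermitian, Matrix.conjTranspose_smul, Matrix.conjTranspose_add,
          Matrix.conjTranspose_conjTranspose, add_comm _ (V (l + 1) S)]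
        congr 1
        simp
  · rintro (_ | l) S
    · exact Subalgebra.smul_mem _ (pauliZ_mem_supp S) _
    · rw [seriesTerm]
      split_ifs
      · exact zero_mem _
      · have := (hsupp (l + 1) (by omega) S).mem_supp
        exact Subalgebra.smul_mem _ (add_mem this (conjTranspose_mem_supp this)) _
  · intro l hl S h0
    obtain ⟨m, rfl⟩ : ∃ m, l = m + 1 := ⟨l - 1, by omega⟩
    refine hdiam (m + 1) hl S fun hz => h0 ?_
    rw [seriesTerm, hz]
    simp
  · intro l hl
    obtain ⟨m, rfl⟩ : ∃ m, l = m + 1 := ⟨l - 1, by omega⟩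
    rw [seriesTerm, if_pos rfl]
  · intro l hl v
    obtain ⟨m, rfl⟩ : ∃ m, l = m + 1 := ⟨l - 1, by omega⟩
    refine (Finset.sum_le_sum fun S _ => hnorm m S).trans ?_
    rw [← Finset.mul_sum]
    refine mul_le_mul_of_nonneg_left ?_ (by positivity)
    simpa [hw'] using hw (m + 1) hl v
  · rintro (_ | l)
    · simp [hw']
    · simpa [hw'] using hw0 l
  · rw [hsum'.tsum_eq_zero_add]
    simpa [hw'] using hle

/-- At each order the two Hamiltonians differ only by the discarded term on the empty set. These
differences lie in the closed algebra `supp ∅` of scalars, so the limit is a scalar too, and scalars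
do not affect the evolution. -/
theorem exists_eq_ham_add {V : ℕ → Finset Λ → Op Λ} {Vε : Op Λ} (hε : 0 < ε) (hε1 : ε ≤ 1)
    (hV : IsLocalPerturbation G h V)
    (hW : LocalSeries G k h ε J (seriesTerm J V ε) w)
    (hsum : HasSum (fun r : ℕ => ((ε ^ (r + 1) : ℝ) : ℂ) • ∑ S, V (r + 1) S) Vε) :
    ∃ c : ℂ, classicalHam J Finset.univ + Vε = ham (seriesTerm J V ε) ∅ + c • 1 := by
  set W := seriesTerm J V ε with hWdef
  have h1 : HasSum (fun l => ∑ S, W l S) (∑ S, term W S) :=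
    hasSum_sum fun S _ => (hW.summable hε.le hε1 S).hasSum
  have h2 : ham W ∅ = ∑ S, term W S := by simp [ham]
  have h3 : classicalHam J Finset.univ = ∑ S, W 0 S := by
    rw [classicalHam, Finset.powerset_univ]
    rfl
  have h4 : HasSum (fun l => ∑ S, W (l + 1) S) (∑ S, term W S - ∑ S, W 0 S) := by
    have := (hasSum_nat_add_iff' 1).2 h1
    simpa using this
  have h5 := hsum.sub h4
  have h6 : Vε - (∑ S, term W S - ∑ S, W 0 S) ∈ supp (∅ : Finset Λ) := by
    refine (isClosed_supp ∅).mem_of_tendsto h5 (Filter.Eventually.of_forall fun s => ?_)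
    refine sum_mem fun l _ => ?_
    have hherm := hV.1 (l + 1) (by omega)
    have hV0 := (hV.2.1 (l + 1) (by omega) ∅).mem_supp
    have h7 : ∑ S, W (l + 1) S = ∑ S, ((ε ^ (l + 1) / 2 : ℝ) : ℂ) •
        (V (l + 1) S + (V (l + 1) S)ᴴ) -
        ((ε ^ (l + 1) / 2 : ℝ) : ℂ) • (V (l + 1) ∅ + (V (l + 1) ∅)ᴴ) := by
      rw [← Finset.sum_erase_eq_sub (Finset.mem_univ ∅),
        ← Finset.sum_erase Finset.univ (a := (∅ : Finset Λ)) (f := fun S => W (l + 1) S)]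
      · refine Finset.sum_congr rfl fun S hS => ?_
        rw [hWdef, seriesTerm, if_neg (Finset.ne_of_mem_erase hS)]
      · rw [hWdef, seriesTerm, if_pos rfl]
    have h8 : ∑ S, ((ε ^ (l + 1) / 2 : ℝ) : ℂ) • (V (l + 1) S + (V (l + 1) S)ᴴ) =
        ((ε ^ (l + 1) : ℝ) : ℂ) • ∑ S, V (l + 1) S := by
      rw [← Finset.smul_sum, Finset.sum_add_distrib, ← Matrix.conjTranspose_sum, hherm.eq,
        ← two_smul ℂ, smul_smul]
      congr 1
      push_cast
      ring
    rw [h7, h8, sub_sub_cancel]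
    exact Subalgebra.smul_mem _ (add_mem hV0 (conjTranspose_mem_supp hV0)) _
  refine ⟨(Vε - (∑ S, term W S - ∑ S, W 0 S)) 0 0, ?_⟩
  rw [h2, h3, ← eq_smul_one_of_mem_supp_empty h6]
  abel

theorem term_neg (S : Finset Λ) : term (fun l S => -W l S) S = -term W S := by
  rw [term, term, tsum_neg]

theorem ham_neg (R : Finset Λ) : ham (fun l S => -W l S) R = -ham W R := by
  simp only [ham, term_neg, Finset.sum_neg_distrib]

/-- The class of Hamiltonians is stable under H ↦ -H, that is under time reversal, which allows S₀
and S₁ to be exchanged. -/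
theorem LocalSeries.neg (hW : LocalSeries G k h ε J W w) :
    LocalSeries G k h ε (fun S => -J S) (fun l S => -W l S) w where
  zero S := by simp [hW.zero]
  abs_le I := by simpa using hW.abs_le I
  diam_zero I hI := hW.diam_zero I (by simpa using hI)
  isHermitian l S := (hW.isHermitian l S).neg
  mem_supp l S := neg_mem (hW.mem_supp l S)
  diam l hl S h0 := hW.diam l hl S (by simpa using h0)
  empty l hl := by simp [hW.empty l hl]
  norm_le l hl v := by simpa using hW.norm_le l hl v
  w_nonneg := hW.w_nonneg
  w_summable := hW.w_summable
  w_le := hW.w_le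

theorem LocalSeries.term_eq_zero (hW : LocalSeries G k 0 ε J W w) (hε : 0 ≤ ε) (S : Finset Λ) :
    term W S = 0 := by
  have h1 : ∀ l, W l S = 0 := by
    rintro (_ | l)
    · have : J S = 0 := abs_nonpos_iff.1 (hW.abs_le S)
      simp [hW.zero, this]
    · have h2 := hW.norm_apply_le (l + 1) (by omega) S hε
      have h3 : w (l + 1) ≤ 0 := by simpa using hW.sum_w_le {l + 1}
      have h4 : ε ^ (l + 1) * w (l + 1) ≤ 0 :=
        mul_nonpos_of_nonneg_of_nonpos (by positivity) h3
      exact norm_le_zero_iff.1 (h2.trans h4)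
  simp [term, h1]

theorem energy_neg (S : Finset Λ) (σ : Λ → Fin 2) :
    energy (fun I => -J I) S σ = -energy J S σ := by
  simp [energy, Finset.sum_neg_distrib]

theorem GapGE.neg {S : Finset Λ} {g : ℝ} (hg : GapGE J S g) : GapGE (fun I => -J I) S g := by
  intro σ τ hστ
  rw [energy_neg, energy_neg, neg_sub_neg, abs_sub_comm]
  exact hg σ τ hστ

theorem PartialNonResonantOnBoundary.neg {Λ : Type} [Fintype Λ] [LinearOrder Λ]
    {G : SimpleGraph Λ} {J : Finset Λ → ℝ} {Δ : ℕ → ℝ} {D : ℕ} {ζ : ℝ} {S : Finset Λ}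
    (hNR : PartialNonResonantOnBoundary G J Δ D ζ S) :
    PartialNonResonantOnBoundary G (fun I => -J I) Δ D ζ S := by
  rintro r hr x hx l Γ hΓ ⟨T, hT, hcard, hbad⟩
  refine hNR r hr x hx l Γ hΓ ⟨T, hT, hcard, fun i hi => ?_⟩
  obtain ⟨hs, hb⟩ := hbad i hi
  exact ⟨hs, fun hn => hb fun S hS => (hn S hS).neg⟩

theorem setDist_le {S T : Finset Λ} {x y : Λ} (hx : x ∈ S) (hy : y ∈ T) :
    setDist G S T ≤ G.dist x y :=
  Nat.sInf_le ⟨x, hx, y, hy, rfl⟩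

/-- The velocity is smaller than every power of `ε`. -/
theorem tendsto_velocity_div_pow {α ξ ζ c' b : ℝ} (k : ℕ) (hα : 0 < α) (hξ : 0 < ξ) (hζ : 0 < ζ)
    (hc' : 0 < c') (hb : 0 < b) (N : ℕ) :
    Filter.Tendsto (fun ε : ℝ => velocity α k b ε (scaleExponent ξ ζ c' b ε) / ε ^ N)
      (nhdsWithin 0 (Set.Ioi 0)) (nhds 0) := by
  have hl : Filter.Tendsto (fun ε : ℝ => Real.log ((b * ε)⁻¹)) (nhdsWithin 0 (Set.Ioi 0))
      Filter.atTop := by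
    have h1 : Filter.Tendsto (fun ε : ℝ => b⁻¹ * ε⁻¹) (nhdsWithin 0 (Set.Ioi 0)) Filter.atTop :=
      tendsto_inv_nhdsGT_zero.const_mul_atTop (by positivity)
    refine (Real.tendsto_log_atTop.comp h1).congr fun ε => ?_
    simp only [Function.comp, mul_inv]
  have hlam : 0 < lam ξ ζ c' := by
    rw [lam]
    positivity
  -- This is the logarithm of the quotient in the variable l = log(1/(bε)): the term -l · l^{1/ξ}
  -- dominates everything linear in l.
  have hf : Filter.Tendsto (fun l : ℝ =>
      -(l * (α / 2 * (lam ξ ζ c' * l ^ (1 / ξ) - k) - N)) + N * Real.log b)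
      Filter.atTop Filter.atBot := by
    refine Filter.tendsto_atBot_add_const_right _ _ (Filter.tendsto_neg_atTop_atBot.comp ?_)
    refine Filter.tendsto_id.atTop_mul_atTop₀ ?_
    simp only [sub_eq_add_neg]
    refine Filter.tendsto_atTop_add_const_right _ _ (Filter.Tendsto.const_mul_atTop (by positivity)
      (Filter.tendsto_atTop_add_const_right _ _ (Filter.Tendsto.const_mul_atTop hlam ?_)))
    exact tendsto_rpow_atTop (by positivity)
  refine (Real.tendsto_exp_atBot.comp (hf.comp hl)).congr' ?_
  filter_upwards [self_mem_nhdsWithin] with ε hε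
  have hε0 : (0 : ℝ) < ε := hε
  have h1 : ε = Real.exp (-(Real.log ((b * ε)⁻¹) + Real.log b)) := by
    rw [Real.log_inv, Real.log_mul hb.ne' hε0.ne', neg_add, neg_neg, add_neg_cancel_comm,
      Real.exp_log hε0]
  have h2 : ε ^ N = Real.exp (N * -(Real.log ((b * ε)⁻¹) + Real.log b)) := by
    rw [Real.exp_nat_mul, ← h1]
  rw [velocity_eq (by positivity), h2, ← Real.exp_sub, scaleExponent]
  simp only [Function.comp]
  congr 1
  ring

end Assembly

end SlowLR

end

/-! ### The theorem for general perturbations and for both choices of the boundary -/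

theorem mainTheorem2 (d k : ℕ) (M ξ a c ζ α : ℝ) (hξ : 0 < ξ) (ha : 0 < a) (hc : 0 < c)
    (hζ : 0 < ζ) (hζ1 : ζ ≤ 1) (hα : 0 < α) (hα1 : α < 1 / (5 * (k : ℝ) + 1)) :
    ∃ C C' : ℝ, 0 < C ∧ 0 < C' ∧ ∀ c' : ℝ, c < c' → ∃ b : ℝ, 0 < b ∧
      (∀ (Λ : Type) [Fintype Λ] [LinearOrder Λ] (G : SimpleGraph Λ), G.Connected →
        SlowLR.IsDimensional G d M →
        ∀ (h : ℝ) (J : Finset Λ → ℝ) (V : ℕ → Finset Λ → SlowLR.Op Λ) (ε : ℝ)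
          (Vε : SlowLR.Op Λ),
        SlowLR.IsClassicalLocal G k h J →
        SlowLR.IsLocalPerturbation G h V →
        0 < ε → b * ε ≤ 1 →
        HasSum (fun r : ℕ => ((ε ^ (r + 1) : ℝ) : ℂ) • ∑ S, V (r + 1) S) Vε →
        ∀ (S₀ S₁ : Finset Λ), S₀.Nonempty → S₁.Nonempty → Disjoint S₀ S₁ →
        ∀ (Δ : ℕ → ℝ), (∀ r : ℕ, h * (a * Real.exp (-c * (r : ℝ) ^ ξ)) ≤ Δ r) →
        ∀ (A B : SlowLR.Op Λ), SlowLR.SupportedOn A S₁ → SlowLR.SupportedOn B S₀ →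
        ∀ t : ℝ, 0 ≤ t →
          let D := SlowLR.setDist G S₀ S₁
          let H := SlowLR.classicalHam J Finset.univ + Vε
          let NR := SlowLR.PartialNonResonantOnBoundary G J Δ D ζ
          let n₀ := ((SlowLR.boundary G S₀).card : ℝ)
          let n₁ := ((SlowLR.boundary G S₁).card : ℝ)
          let v := SlowLR.velocity α k b ε
            (min (SlowLR.scaleExponent ξ ζ c' b ε) (ζ * (D : ℝ) / 8))
          let bound := ‖B‖ * ‖A‖ * (Real.exp (C' * h * v * t) - 1) *
            Real.exp (-(α * ζ / 8) * (D : ℝ))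
          (NR S₀ → ‖⁅B, SlowLR.heisenberg H t A⁆‖ ≤ C * n₀ * bound) ∧
          ((n₀ ≤ n₁ ∧ NR S₀) ∨ (n₁ ≤ n₀ ∧ NR S₁) →
            ‖⁅B, SlowLR.heisenberg H t A⁆‖ ≤ C * min n₀ n₁ * bound)) ∧
      (∀ N : ℕ, Filter.Tendsto
        (fun ε : ℝ => SlowLR.velocity α k b ε (SlowLR.scaleExponent ξ ζ c' b ε) / ε ^ N)
        (nhdsWithin 0 (Set.Ioi 0)) (nhds 0)) := by
  -- The volume bound remains true with a larger constant, and M ≥ 1 is convenient for logarithms.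
  have hM : 1 ≤ max M 1 := le_max_right _ _
  obtain ⟨C, C', hC, hC', hcore⟩ :=
    SlowLR.exists_bound_localSeries d k hM hξ ha hc hζ hζ1 hα hα1
  refine ⟨C, C', hC, hC', fun c' hc' => ?_⟩
  obtain ⟨b, hb1, hcore⟩ := hcore c' hc'
  refine ⟨b, by linarith, ?_, fun N =>
    SlowLR.tendsto_velocity_div_pow k hα hξ hζ (by linarith) (by linarith) N⟩
  intro Λ _ _ G hconn hdim h J V ε Vε hJ hV hε hbε hsum S₀ S₁ hS₀ hS₁ hSS Δ hΔ A B hA hB t ht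
    D H NR n₀ n₁ v bound
  have hdim' : SlowLR.IsDimensional G d (max M 1) := fun x r hr =>
    (hdim x r hr).trans (by gcongr; exact le_max_left _ _)
  have hε1 : ε ≤ 1 := by nlinarith
  have : Nonempty Λ := hconn.nonempty
  obtain ⟨w, hW⟩ := SlowLR.exists_localSeries hε hJ hV
  obtain ⟨z, hz⟩ := SlowLR.exists_eq_ham_add hε hε1 hV hW hsum
  have hHt : ∀ X, SlowLR.heisenberg H t X =
      SlowLR.heisenberg (SlowLR.ham (SlowLR.seriesTerm J V ε) ∅) t X := fun X => by
    rw [show H = _ from hz, SlowLR.heisenberg_add_smul_one]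
  have hA' := hA.mem_supp
  have hB' := hB.mem_supp
  rw [hHt]
  have h0 : NR S₀ → ‖⁅B, SlowLR.heisenberg (SlowLR.ham (SlowLR.seriesTerm J V ε) ∅) t A⁆‖ ≤
      C * n₀ * bound := by
    intro hNR
    rcases hW.h_nonneg.lt_or_eq with hh | hh
    · exact hcore Λ G hconn hdim' h ε J _ w hh hε hbε hW S₀ S₁ hS₁ hSS D
        (fun x hx z hz => SlowLR.setDist_le hx hz) Δ hΔ hNR A B hA' hB' t ht
    -- For h = 0 the velocity C'hv degenerates to zero; then all terms vanish, nothing evolves and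
    -- the commutator is zero.
    · subst hh
      have hham : SlowLR.ham (SlowLR.seriesTerm J V ε) ∅ = 0 :=
        Finset.sum_eq_zero fun S _ => hW.term_eq_zero hε.le S
      have hz : SlowLR.heisenberg (0 : SlowLR.Op Λ) t A = A := by
        simp [SlowLR.heisenberg]
      rw [hham, hz, SlowLR.lie_eq_zero_of_mem_supp hSS hB' hA', norm_zero]
      simp [bound]
  have h1 : NR S₁ → ‖⁅B, SlowLR.heisenberg (SlowLR.ham (SlowLR.seriesTerm J V ε) ∅) t A⁆‖ ≤
      C * n₁ * bound := by
    intro hNR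
    rcases hW.h_nonneg.lt_or_eq with hh | hh
    -- The bound for -H with the two operators and the two sets exchanged: [A, B(-t)] and [B, A(t)]
    -- have the same norm, and negating the classical coefficients preserves gaps.
    · have h2 := hcore Λ G hconn hdim' h ε _ _ w hh hε hbε hW.neg S₁ S₀ hS₀ hSS.symm D
        (fun x hx z hz => by
          rw [SimpleGraph.dist_comm]
          exact SlowLR.setDist_le hz hx) Δ hΔ hNR.neg B A hB' hA' t ht
      rw [SlowLR.ham_neg, SlowLR.heisenberg_neg, Ring.lie_def, norm_sub_rev, ← Ring.lie_def,
        SlowLR.norm_lie_heisenberg_neg (hW.ham_isHermitian hε.le hε1 ∅)] at h2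
      refine h2.trans_eq ?_
      simp only [bound, n₁, v, D]
      ring
    · subst hh
      have hham : SlowLR.ham (SlowLR.seriesTerm J V ε) ∅ = 0 :=
        Finset.sum_eq_zero fun S _ => hW.term_eq_zero hε.le S
      have hz : SlowLR.heisenberg (0 : SlowLR.Op Λ) t A = A := by
        simp [SlowLR.heisenberg]
      rw [hham, hz, SlowLR.lie_eq_zero_of_mem_supp hSS hB' hA', norm_zero]
      simp [bound]
  refine ⟨h0, ?_⟩
  rintro (⟨hn, hNR⟩ | ⟨hn, hNR⟩)
  · rw [min_eq_left hn]
    exact h0 hNR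
  · rw [min_eq_right hn]
    exact h1 hNR
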